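/- Let $I=\{1,\dots,r\}$ carry a Cartan datum: a symmetric bilinear form $\cdot$ on $\mathbb Z[I]$ with $i\cdot i\in\{2,4,6,\dots\}$ and $a_{ij}=2\,i\cdot j/(i\cdot i)\in\{0,-1,-2,\dots\}$ for $i\ne j$. Let $Y,X$ be finitely generated free abelian groups with a perfect pairing $\langle\ ,\ \rangle:Y\times X\to\mathbb Z$ and inclusions $I\subseteq Y$ and $I\subseteq X$ (the second written $i\mapsto i'$) with $\langle i,j'\rangle=a_{ij}$. Let $k$ be a field and $q\in k^*$ such that $q_i:=q^{i\cdot i/2}$ satisfies $q_i\neq q_i^{-1}$ for all $i$. Let $H=kY$ have basis $K_\mu$ $(\mu\in Y)$, let $A=k\mathbb Z[I]$ be spanned by group-like elements generated by the $g_i$, and let $\mathcal R,\bar{\mathcal R}:A\to H$ be the algebra maps $\mathcal R(g_i)=K_i^{i\cdot i/2}$, $\bar{\mathcal R}(g_i)=K_i^{-i\cdot i/2}$. Give $k\langle e^i\rangle$ the left $A$-coaction $v\mapsto v^{(1)}\otimes v^{(2)}$, multiplicative with $e^i\mapsto g_i\otimes e^i$, the action $e^i\triangleleft K_\mu=q^{\langle\mu,i'\rangle}e^i$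 by algebra automorphisms, the braiding $\Psi(v\otimes w)=w^{(2)}\otimes v\triangleleft\mathcal R(w^{(1)})$ (so $\Psi(e^i\otimes e^j)=q^{i\cdot j}e^j\otimes e^i$), and the braided Hopf algebra structure $\Delta b=b_{(1)}\otimes b_{(2)}$, $S$ with the $e^i$ primitive. Let $k\langle f_i\rangle$ be the braided Hopf algebra with $K_\mu\triangleright f_i=q^{\langle\mu,i'\rangle}f_i$, $f_i$ primitive and $\Psi(f_i\otimes f_j)=q^{i\cdot j}f_j\otimes f_i$, and let $\langle\ ,\ \rangle$ be the duality pairing with $\langle f_i,e^j\rangle=\delta_i^j(q_i-q_i^{-1})^{-1}$, $\langle cd,v\rangle=\langle c,v_{(1)}\rangle\langle d,v_{(2)}\rangle$. Let $B$ and $\bar C$ be the quotients of $k\langle e^i\rangle$ and $k\langle f_i\rangle$ by the radicals of this pairing (versions of Lusztig's algebra $f$), with the induced structure maps, and let $\bar S$ be the linear map on $\bar C$ with $\bar S(1)=1$, $\bar S(f_i)=-f_i$, extended braided-antimultiplicatively with the braiding $f_i\otimes f_j\mapsto q^{-i\cdot j}f_j\otimes f_i$. Put $x^i=(q_i-q_i^{-1})e^i\in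 B$, so that $\langle f_i,x^j\rangle=\delta_i^j$. Let $U=U_q(\mathfrak g)$ be the algebra generated by (homomorphic images of) $\bar C$, $H$ and $B$ with relations $$e^iK_\mu=q^{\langle\mu,i'\rangle}K_\mu e^i,\qquad K_\mu f_i=q^{\langle\mu,i'\rangle}f_iK_\mu,\qquad [e^i,f_j]=\delta^i_j\,\frac{K_i^{i\cdot i/2}-K_i^{-i\cdot i/2}}{q_i-q_i^{-1}}.$$ **Proposition 4.4.** There is a unique right action of $U$ on $B$ (the *fundamental representation*) in which $H$ acts by its given action on $B$ and $$v\triangleleft b=(S\,b_{(1)}{}^{(2)})\,(v\triangleleft\mathcal R(b_{(1)}{}^{(1)}))\,b_{(2)},\qquad v\triangleleft c=\langle\bar S c,v_{(2)}{}^{(2)}\rangle\,v_{(1)}\triangleleft\bar{\mathcal R}(v_{(2)}{}^{(1)})\qquad(b\in B,\ c\in\bar C).$$ It has the following properties. 1. For all $i$, $\mu$ and $v\in B$, $$x^i\triangleleft K_\mu=q^{\langle\mu,i'\rangle}x^i,\qquad v\triangleleft e^i=\frac{v\,x^i-x^i\,(v\triangleleft K_i^{i\cdot i/2})}{q_i-q_i^{-1}},\qquad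 v\triangleleft f_i=-\partial_iv,$$ where $\partial_i:B\to B$ is braided differentiation, the linear map $\partial_i=(\langle f_i,-\rangle\otimes\mathrm{id})\,\Psi^{-1}\Delta$. On ordered monomials, with $[m,t]=\frac{1-t^m}{1-t}$, $$\partial_i\big((x^1)^{\nu_1}\cdots(x^r)^{\nu_r}\big)=q^{-i\cdot\sum_{j=1}^{i-1}\nu_jj}\,(x^1)^{\nu_1}\cdots(x^{i-1})^{\nu_{i-1}}\,[\nu_i,q_i^{-2}](x^i)^{\nu_i-1}\,(x^{i+1})^{\nu_{i+1}}\cdots(x^r)^{\nu_r}.$$ 2. $U$ is a Hopf algebra with $\Delta e^i=e^i\otimes K_i^{i\cdot i/2}+1\otimes e^i$, $\Delta f_i=f_i\otimes1+K_i^{-i\cdot i/2}\otimes f_i$, $\Delta K_\mu=K_\mu\otimes K_\mu$, and $B$ is a right $U$-module algebra: $(vw)\triangleleft u=(v\triangleleft u_{(1)})(w\triangleleft u_{(2)})$ and $1\triangleleft u=\epsilon(u)1$. 3. The representation is adjoint to a version of Lusztig's Verma module representation. There is a left action of $U$ on $\bar C$ in which $f_i$ acts by left multiplication, $K_\mu$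 by the given action, and $$e^i\triangleright c=\frac{r_i(c)-K_i^{-i\cdot i/2}\triangleright{}_ir(c)}{q_i-q_i^{-1}},$$ where the maps ${}_ir,r_i$ are induced on $\bar C$ from $k\langle f_i\rangle$, on which $\Delta c=f_i\otimes{}_ir(c)+\cdots$ and $\Delta c=r_i(c)\otimes f_i+\cdots$ (the omitted terms having no component along $f_i$ in the first, respectively second, factor). The map $u\mapsto u\triangleright1$ identifies $\bar C$ with the Verma module $U/\big(\sum_iUe^i+\sum_\mu U(K_\mu-1)\big)$. The pairing $\langle\ ,\ \rangle:\bar C\times B\to k$ is well defined and non-degenerate, $\bar S$ is well defined and bijective on $\bar C$, and $$\langle\bar S(u\triangleright c),v\rangle=\langle\bar Sc,v\triangleleft u\rangle\qquad(u\in U,\ c\in\bar C,\ v\in B).$$ -/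

import Mathlib

open scoped TensorProduct

/-- A Cartan datum on a set `I`: the values `i · j` on generators of a symmetric bilinear form
on `ℤ[I]`, with `i · i ∈ {2, 4, 6, …}` and `2 (i · j) / (i · i) ∈ {0, -1, -2, …}` for `i ≠ j`. -/
structure CartanDatum (I : Type*) where
  form : I → I → ℤ
  form_symm : ∀ i j, form i j = form j i
  form_self_pos : ∀ i, 0 < form i i
  form_self_even : ∀ i, Even (form i i)
  form_self_dvd : ∀ i j, i ≠ j → form i i ∣ 2 * form i j
  form_nonpos : ∀ i j, i ≠ j → form i j ≤ 0

/-- A root datum for a Cartan datum: a perfect pairing `⟨ , ⟩ : Y × X → ℤ` and inclusions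
`I ⊆ Y`, `i ↦ i` (`coroot`) and `I ⊆ X`, `i ↦ i'` (`root`), with
`⟨i, j'⟩ = a_{ij} = 2 (i · j) / (i · i)` (an exact division). -/
structure LusztigRootDatum (I X Y : Type*) [AddCommGroup X] [AddCommGroup Y]
    extends CartanDatum I where
  pairing : Y →ₗ[ℤ] X →ₗ[ℤ] ℤ
  perfect : pairing.IsPerfPair
  coroot : I → Y
  coroot_injective : Function.Injective coroot
  root : I → X
  root_injective : Function.Injective root
  pairing_coroot_root : ∀ i j, pairing (coroot i) (root j) = 2 * form i j / form i i

noncomputable section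

namespace LusztigRootDatum

variable {I X Y : Type*} [AddCommGroup X] [AddCommGroup Y] (R : LusztigRootDatum I X Y)
variable {k : Type*} [Field k] (q : kˣ)

/-- The integer `(i · i) / 2`. -/
def half (i : I) : ℤ := R.form i i / 2

/-- The scalar `q_i = q ^ ((i · i) / 2)`. -/
def qi (i : I) : k := ((q ^ R.half i : kˣ) : k)

/-- The scalar `q_i - q_i⁻¹`. -/
def qdiff (i : I) : k := R.qi q i - (R.qi q i)⁻¹

/-! ### The weakly quasitriangular dual pair `H = k Y`, `A = k ℤ[I]`

Here `K_μ` is the basis element of `AddMonoidAlgebra k Y` at `μ`, and `g_i` the one of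
`AddMonoidAlgebra k (I →₀ ℤ)` at the generator `i` of `ℤ[I]`. -/

/-- The homomorphism `ℤ[I] → Y`, `i ↦ ((i · i) / 2) i`. -/
def toY : (I →₀ ℤ) →ₗ[ℤ] Y := Finsupp.linearCombination ℤ (fun i => R.half i • R.coroot i)

/-- The algebra map `ℛ : A → H`, `ℛ(g_i) = K_i ^ ((i · i) / 2)`. -/
def rmap (k : Type*) [Field k] : AddMonoidAlgebra k (I →₀ ℤ) →ₐ[k] AddMonoidAlgebra k Y :=
  AddMonoidAlgebra.mapDomainAlgHom k k R.toY.toAddMonoidHom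

/-- The algebra map `ℛ̄ : A → H`, `ℛ̄(g_i) = K_i ^ (-(i · i) / 2)`, the convolution inverse
of `ℛ`. -/
def rmapBar (k : Type*) [Field k] : AddMonoidAlgebra k (I →₀ ℤ) →ₐ[k] AddMonoidAlgebra k Y :=
  AddMonoidAlgebra.mapDomainAlgHom k k (-R.toY).toAddMonoidHom

/-! ### The free braided groups

The free algebra `FreeAlgebra k I` plays two roles: as `k⟨e^i⟩`, a left `A`-comodule algebra by
`e^i ↦ g_i ⊗ e^i` and a right `H`-module algebra by `e^i ◁ K_μ = q^⟨μ,i'⟩ e^i`, and as `k⟨f_i⟩`,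
a right `A`-comodule algebra by `f_i ↦ f_i ⊗ g_i` and a left `H`-module algebra by
`K_μ ▷ f_i = q^⟨μ,i'⟩ f_i`. Since `H` is commutative the left and the right action of `H` are the
same linear operators; we also write the coaction on `k⟨f_i⟩` with the factor `A` on the left. -/

/-- The algebra endomorphism `e^i ↦ q^⟨μ,i'⟩ e^i` (resp. `f_i ↦ q^⟨μ,i'⟩ f_i`). -/
def scale (μ : Y) : FreeAlgebra k I →ₐ[k] FreeAlgebra k I :=
  FreeAlgebra.lift k
    (fun i => ((q ^ R.pairing μ (R.root i) : kˣ) : k) • FreeAlgebra.ι k i)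

theorem scale_zero : R.scale q 0 = AlgHom.id k (FreeAlgebra k I) := by
  apply FreeAlgebra.hom_ext
  funext i
  simp [scale]

theorem scale_add (μ ν : Y) : R.scale q (μ + ν) = (R.scale q μ).comp (R.scale q ν) := by
  apply FreeAlgebra.hom_ext
  funext i
  simp [scale, zpow_add, smul_smul, mul_comm]

/-- The action of `H` on the free algebra: `K_μ` acts by `scale μ`. -/
def actH : AddMonoidAlgebra k Y →ₐ[k] Module.End k (FreeAlgebra k I) :=
  AddMonoidAlgebra.lift k (Module.End k (FreeAlgebra k I)) Y
    { toFun := fun μ => (R.scale q μ.toAdd).toLinearMap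
      map_one' := by
        rw [toAdd_one, scale_zero]
        rfl
      map_mul' := fun μ ν => by
        rw [toAdd_mul, scale_add]
        rfl }

/-- The coaction of `A`: the algebra map with `e^i ↦ g_i ⊗ e^i`. We write it
`v ↦ v⁽¹⁾ ⊗ v⁽²⁾`. -/
def coaction (k I : Type*) [Field k] :
    FreeAlgebra k I →ₐ[k] AddMonoidAlgebra k (I →₀ ℤ) ⊗[k] FreeAlgebra k I :=
  FreeAlgebra.lift k
    (fun i => AddMonoidAlgebra.single (Finsupp.single i 1) 1 ⊗ₜ[k] FreeAlgebra.ι k i)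

/-- For `θ : A → H`, the map `v ⊗ w ↦ (v ◁ θ(w⁽¹⁾)) ⊗ w⁽²⁾`. -/
def twist (θ : AddMonoidAlgebra k (I →₀ ℤ) →ₐ[k] AddMonoidAlgebra k Y) :
    FreeAlgebra k I ⊗[k] FreeAlgebra k I →ₗ[k] FreeAlgebra k I ⊗[k] FreeAlgebra k I :=
  (TensorProduct.lift ((R.actH q).comp θ).toLinearMap.flip).rTensor (FreeAlgebra k I) ∘ₗ
    (TensorProduct.assoc k (FreeAlgebra k I) (AddMonoidAlgebra k (I →₀ ℤ))
      (FreeAlgebra k I)).symm.toLinearMap ∘ₗ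
    (coaction k I).toLinearMap.lTensor (FreeAlgebra k I)

/-- The flip `v ⊗ w ↦ w ⊗ v`. -/
def flip (k I : Type*) [Field k] :
    FreeAlgebra k I ⊗[k] FreeAlgebra k I →ₗ[k] FreeAlgebra k I ⊗[k] FreeAlgebra k I :=
  (TensorProduct.comm k (FreeAlgebra k I) (FreeAlgebra k I)).toLinearMap

/-- The braiding `Ψ(v ⊗ w) = w⁽²⁾ ⊗ (v ◁ ℛ(w⁽¹⁾))` on `k⟨e^i⟩`; it has
`Ψ(e^i ⊗ e^j) = q^(i·j) e^j ⊗ e^i`. -/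
def braidE : FreeAlgebra k I ⊗[k] FreeAlgebra k I →ₗ[k] FreeAlgebra k I ⊗[k] FreeAlgebra k I :=
  flip k I ∘ₗ R.twist q (R.rmap k)

/-- The inverse braiding `Ψ⁻¹(w ⊗ v) = (v ◁ ℛ̄(w⁽¹⁾)) ⊗ w⁽²⁾` on `k⟨e^i⟩`. -/
def braidEInv :
    FreeAlgebra k I ⊗[k] FreeAlgebra k I →ₗ[k] FreeAlgebra k I ⊗[k] FreeAlgebra k I :=
  R.twist q (R.rmapBar k) ∘ₗ flip k I

/-- The braiding `Ψ(c ⊗ d) = (ℛ(c⁽¹⁾) ▷ d) ⊗ c⁽²⁾` on `k⟨f_i⟩`, with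
`Ψ(f_i ⊗ f_j) = q^(i·j) f_j ⊗ f_i`. -/
def braidF : FreeAlgebra k I ⊗[k] FreeAlgebra k I →ₗ[k] FreeAlgebra k I ⊗[k] FreeAlgebra k I :=
  R.twist q (R.rmap k) ∘ₗ flip k I

/-- The braiding `Ψ(c ⊗ d) = (ℛ̄(c⁽¹⁾) ▷ d) ⊗ c⁽²⁾` that is used on `k⟨f_i⟩` when it carries the
braided-opposite coproduct, with `Ψ(f_i ⊗ f_j) = q^(-i·j) f_j ⊗ f_i`. -/
def braidFBar :
    FreeAlgebra k I ⊗[k] FreeAlgebra k I →ₗ[k] FreeAlgebra k I ⊗[k] FreeAlgebra k I :=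
  R.twist q (R.rmapBar k) ∘ₗ flip k I

/-- Left multiplication by `e^i ⊗ 1 + 1 ⊗ e^i` in the braided tensor product algebra of a braiding
`Ψ`, whose product is `(b ⊗ c)(d ⊗ e) = b Ψ(c ⊗ d) e`: that is,
`d ⊗ e ↦ e^i d ⊗ e + Ψ(e^i ⊗ d) (1 ⊗ e)`. -/
def mulPrimitive
    (Ψ : FreeAlgebra k I ⊗[k] FreeAlgebra k I →ₗ[k] FreeAlgebra k I ⊗[k] FreeAlgebra k I)
    (i : I) :
    FreeAlgebra k I ⊗[k] FreeAlgebra k I →ₗ[k] FreeAlgebra k I ⊗[k] FreeAlgebra k I :=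
  (LinearMap.mulLeft k (FreeAlgebra.ι k i)).rTensor (FreeAlgebra k I) +
    (LinearMap.mul' k (FreeAlgebra k I)).lTensor (FreeAlgebra k I) ∘ₗ
    (TensorProduct.assoc k (FreeAlgebra k I) (FreeAlgebra k I) (FreeAlgebra k I)).toLinearMap ∘ₗ
    (Ψ ∘ₗ TensorProduct.mk k (FreeAlgebra k I) (FreeAlgebra k I) (FreeAlgebra.ι k i)).rTensor
      (FreeAlgebra k I)

/-- The braided coproduct: the algebra map from the free algebra to its braided tensor square with
`Δ e^i = e^i ⊗ 1 + 1 ⊗ e^i`. -/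
def coproduct
    (Ψ : FreeAlgebra k I ⊗[k] FreeAlgebra k I →ₗ[k] FreeAlgebra k I ⊗[k] FreeAlgebra k I) :
    FreeAlgebra k I →ₗ[k] FreeAlgebra k I ⊗[k] FreeAlgebra k I :=
  LinearMap.applyₗ (1 ⊗ₜ[k] 1 : FreeAlgebra k I ⊗[k] FreeAlgebra k I) ∘ₗ
    (FreeAlgebra.lift k (mulPrimitive Ψ) :
      FreeAlgebra k I →ₐ[k]
        Module.End k (FreeAlgebra k I ⊗[k] FreeAlgebra k I)).toLinearMap

theorem coproduct_one
    (Ψ : FreeAlgebra k I ⊗[k] FreeAlgebra k I →ₗ[k] FreeAlgebra k I ⊗[k] FreeAlgebra k I) :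
    coproduct Ψ 1 = 1 ⊗ₜ[k] 1 := by
  simp [coproduct]

theorem coproduct_ι_mul
    (Ψ : FreeAlgebra k I ⊗[k] FreeAlgebra k I →ₗ[k] FreeAlgebra k I ⊗[k] FreeAlgebra k I)
    (i : I) (v : FreeAlgebra k I) :
    coproduct Ψ (FreeAlgebra.ι k i * v) = mulPrimitive Ψ i (coproduct Ψ v) := by
  simp [coproduct]

/-- The braided antipode: `S 1 = 1`, `S e^i = -e^i` and `S(vw) = · Ψ(S v ⊗ S w)`. -/
def antipode
    (Ψ : FreeAlgebra k I ⊗[k] FreeAlgebra k I →ₗ[k] FreeAlgebra k I ⊗[k] FreeAlgebra k I) :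
    FreeAlgebra k I →ₗ[k] FreeAlgebra k I :=
  LinearMap.applyₗ (1 : FreeAlgebra k I) ∘ₗ
    (FreeAlgebra.lift k (fun i => LinearMap.mul' k (FreeAlgebra k I) ∘ₗ Ψ ∘ₗ
        TensorProduct.mk k (FreeAlgebra k I) (FreeAlgebra k I) (-FreeAlgebra.ι k i)) :
      FreeAlgebra k I →ₐ[k] Module.End k (FreeAlgebra k I)).toLinearMap

theorem antipode_one
    (Ψ : FreeAlgebra k I ⊗[k] FreeAlgebra k I →ₗ[k] FreeAlgebra k I ⊗[k] FreeAlgebra k I) :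
    antipode Ψ 1 = 1 := by
  simp [antipode]

theorem antipode_ι_mul
    (Ψ : FreeAlgebra k I ⊗[k] FreeAlgebra k I →ₗ[k] FreeAlgebra k I ⊗[k] FreeAlgebra k I)
    (i : I) (v : FreeAlgebra k I) :
    antipode Ψ (FreeAlgebra.ι k i * v) =
      LinearMap.mul' k (FreeAlgebra k I) (Ψ ((-FreeAlgebra.ι k i) ⊗ₜ[k] antipode Ψ v)) := by
  simp only [antipode, LinearMap.comp_apply, AlgHom.toLinearMap_apply, map_mul,
    FreeAlgebra.lift_ι_apply, LinearMap.applyₗ_apply_apply, Module.End.mul_apply,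
    TensorProduct.mk_apply]

/-- The coefficient of the generator `i` in an element of the free algebra. -/
def genCoeff (k : Type*) [Field k] (i : I) : FreeAlgebra k I →ₗ[k] k :=
  { toFun := fun v => (FreeAlgebra.equivMonoidAlgebraFreeMonoid v).coeff (FreeMonoid.of i)
    map_add' := fun v w => by simp
    map_smul' := fun c v => by simp }

/-- The operator `v ↦ ⟨f_i, v₍₁₎⟩ v₍₂₎` on `k⟨e^i⟩`, where `⟨f_i, e^j⟩ = δ_{ij} (q_i - q_i⁻¹)⁻¹`
and `⟨f_i, -⟩` vanishes on words of length different from `1`. -/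
def contract (i : I) : FreeAlgebra k I →ₗ[k] FreeAlgebra k I :=
  (TensorProduct.lid k (FreeAlgebra k I)).toLinearMap ∘ₗ
    ((R.qdiff q i)⁻¹ • genCoeff k i).rTensor (FreeAlgebra k I) ∘ₗ coproduct (R.braidE q)

/-- The duality pairing `⟨ , ⟩` between `k⟨f_i⟩` (first argument) and `k⟨e^i⟩`, determined by
`⟨1, v⟩ = ε(v)`, `⟨f_i, e^j⟩ = δ_{ij} (q_i - q_i⁻¹)⁻¹` and `⟨c d, v⟩ = ⟨c, v₍₁₎⟩ ⟨d, v₍₂₎⟩`. -/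
def freePairing : FreeAlgebra k I →ₗ[k] FreeAlgebra k I →ₗ[k] k :=
  (LinearMap.llcomp k (FreeAlgebra k I) (FreeAlgebra k I) k
      (FreeAlgebra.algebraMapInv : FreeAlgebra k I →ₐ[k] k).toLinearMap) ∘ₗ
    (MulOpposite.opLinearEquiv k).symm.toLinearMap ∘ₗ
    (FreeAlgebra.lift k (fun i => MulOpposite.op (R.contract q i)) :
      FreeAlgebra k I →ₐ[k] (Module.End k (FreeAlgebra k I))ᵐᵒᵖ).toLinearMap

theorem freePairing_one (v : FreeAlgebra k I) :
    R.freePairing q 1 v = FreeAlgebra.algebraMapInv v := by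
  simp [freePairing]

theorem freePairing_ι_mul (i : I) (c v : FreeAlgebra k I) :
    R.freePairing q (FreeAlgebra.ι k i * c) v = R.freePairing q c (R.contract q i v) := by
  simp [freePairing]

/-! ### The quotients by the radicals of the pairing -/

/-- `a` and `b` in `k⟨e^i⟩` differ by an element of the radical of the pairing. -/
def RelE (a b : FreeAlgebra k I) : Prop := ∀ c, R.freePairing q c a = R.freePairing q c b

/-- `c` and `d` in `k⟨f_i⟩` differ by an element of the radical of the pairing. -/
def RelF (c d : FreeAlgebra k I) : Prop := ∀ a, R.freePairing q c a = R.freePairing q d a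

/-- The algebra `B` (Lusztig's `f`): the quotient of `k⟨e^i⟩` by the radical of the pairing. -/
abbrev B : Type _ := RingQuot (R.RelE q)

/-- The algebra `C̄` (again a version of `f`): the quotient of `k⟨f_i⟩` by the radical of the
pairing. As an algebra it is the dual `D` of `B`. -/
abbrev C : Type _ := RingQuot (R.RelF q)

/-- The projection `k⟨e^i⟩ → B`. -/
def toB : FreeAlgebra k I →ₐ[k] R.B q := RingQuot.mkAlgHom k (R.RelE q)

/-- The projection `k⟨f_i⟩ → C̄`. -/
def toC : FreeAlgebra k I →ₐ[k] R.C q := RingQuot.mkAlgHom k (R.RelF q)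

/-- The generators `x^i` of `B`, normalised by `⟨f_i, x^j⟩ = δ_{ij}`, that is
`x^i = (q_i - q_i⁻¹) e^i`. -/
def x (i : I) : R.B q := R.qdiff q i • R.toB q (FreeAlgebra.ι k i)

/-! ### The quantum group `U = U_q(𝔤)` -/

/-- Symbols for the generators of `U`. -/
inductive Gen (I Y : Type*) where
  | e : I → Gen I Y
  | f : I → Gen I Y
  | K : Y → Gen I Y

/-- The element `i ↦ ((i · i) / 2) i` of `Y`, so that `K_{kappa i} = K_i ^ ((i · i) / 2)`. -/
def kappa (i : I) : Y := R.half i • R.coroot i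

/-- The defining relations of `U`: `H`, `B` and `C̄` are mapped homomorphically to `U`, and the
cross relations hold. -/
inductive URel : FreeAlgebra k (Gen I Y) → FreeAlgebra k (Gen I Y) → Prop
  | K_zero : URel (FreeAlgebra.ι k (Gen.K 0)) 1
  | K_add (μ ν : Y) : URel (FreeAlgebra.ι k (Gen.K (μ + ν)))
      (FreeAlgebra.ι k (Gen.K μ) * FreeAlgebra.ι k (Gen.K ν))
  | e_K (i : I) (μ : Y) : URel (FreeAlgebra.ι k (Gen.e i) * FreeAlgebra.ι k (Gen.K μ))
      (((q ^ R.pairing μ (R.root i) : kˣ) : k) •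
        (FreeAlgebra.ι k (Gen.K μ) * FreeAlgebra.ι k (Gen.e i)))
  | K_f (i : I) (μ : Y) : URel (FreeAlgebra.ι k (Gen.K μ) * FreeAlgebra.ι k (Gen.f i))
      (((q ^ R.pairing μ (R.root i) : kˣ) : k) •
        (FreeAlgebra.ι k (Gen.f i) * FreeAlgebra.ι k (Gen.K μ)))
  | e_f_same (i : I) : URel
      (FreeAlgebra.ι k (Gen.e i) * FreeAlgebra.ι k (Gen.f i) -
        FreeAlgebra.ι k (Gen.f i) * FreeAlgebra.ι k (Gen.e i))
      ((R.qdiff q i)⁻¹ •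
        (FreeAlgebra.ι k (Gen.K (R.kappa i)) - FreeAlgebra.ι k (Gen.K (-R.kappa i))))
  | e_f_ne (i j : I) (h : i ≠ j) : URel
      (FreeAlgebra.ι k (Gen.e i) * FreeAlgebra.ι k (Gen.f j))
      (FreeAlgebra.ι k (Gen.f j) * FreeAlgebra.ι k (Gen.e i))
  | e_rad (a b : FreeAlgebra k I) (h : R.RelE q a b) : URel
      (FreeAlgebra.lift k (fun i => FreeAlgebra.ι k (Gen.e i)) a)
      (FreeAlgebra.lift k (fun i => FreeAlgebra.ι k (Gen.e i)) b)
  | f_rad (c d : FreeAlgebra k I) (h : R.RelF q c d) : URel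
      (FreeAlgebra.lift k (fun i => FreeAlgebra.ι k (Gen.f i)) c)
      (FreeAlgebra.lift k (fun i => FreeAlgebra.ι k (Gen.f i)) d)

/-- The quantum group `U = U_q(𝔤)`, generated by `C̄`, `H` and `B` with the cross relations. -/
abbrev U : Type _ := RingQuot (R.URel q)

/-- The generator `e^i` of `U`. -/
def e (i : I) : R.U q := RingQuot.mkAlgHom k (R.URel q) (FreeAlgebra.ι k (Gen.e i))

/-- The generator `f_i` of `U`. -/
def f (i : I) : R.U q := RingQuot.mkAlgHom k (R.URel q) (FreeAlgebra.ι k (Gen.f i))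

/-- The generator `K_μ` of `U`. -/
def K (μ : Y) : R.U q := RingQuot.mkAlgHom k (R.URel q) (FreeAlgebra.ι k (Gen.K μ))

/-- The canonical map `B → U`. -/
def inclB : R.B q →ₐ[k] R.U q :=
  RingQuot.liftAlgHom k
    ⟨(RingQuot.mkAlgHom k (R.URel q)).comp
        (FreeAlgebra.lift k (fun i => FreeAlgebra.ι k (Gen.e i))),
      fun _ _ h => RingQuot.mkAlgHom_rel k (URel.e_rad _ _ h)⟩

/-- The canonical map `C̄ → U`. -/
def inclC : R.C q →ₐ[k] R.U q :=
  RingQuot.liftAlgHom k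
    ⟨(RingQuot.mkAlgHom k (R.URel q)).comp
        (FreeAlgebra.lift k (fun i => FreeAlgebra.ι k (Gen.f i))),
      fun _ _ h => RingQuot.mkAlgHom_rel k (URel.f_rad _ _ h)⟩

/-- `(Δ, ε, S)` is a Hopf algebra structure on `U` with
`Δ e^i = e^i ⊗ K_i^((i·i)/2) + 1 ⊗ e^i`, `Δ f_i = f_i ⊗ 1 + K_i^(-(i·i)/2) ⊗ f_i` and
`Δ K_μ = K_μ ⊗ K_μ`. -/
structure IsHopf (Δ : R.U q →ₐ[k] R.U q ⊗[k] R.U q) (ε : R.U q →ₐ[k] k)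
    (S : R.U q →ₗ[k] R.U q) : Prop where
  comul_e : ∀ i, Δ (R.e q i) = R.e q i ⊗ₜ[k] R.K q (R.kappa i) + 1 ⊗ₜ[k] R.e q i
  comul_f : ∀ i, Δ (R.f q i) = R.f q i ⊗ₜ[k] 1 + R.K q (-R.kappa i) ⊗ₜ[k] R.f q i
  comul_K : ∀ μ, Δ (R.K q μ) = R.K q μ ⊗ₜ[k] R.K q μ
  coassoc : (TensorProduct.assoc k (R.U q) (R.U q) (R.U q)).toLinearMap ∘ₗ
    Δ.toLinearMap.rTensor (R.U q) ∘ₗ Δ.toLinearMap =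
      Δ.toLinearMap.lTensor (R.U q) ∘ₗ Δ.toLinearMap
  counit_left : ∀ u, TensorProduct.lid k (R.U q) (ε.toLinearMap.rTensor (R.U q) (Δ u)) = u
  counit_right : ∀ u, TensorProduct.rid k (R.U q) (ε.toLinearMap.lTensor (R.U q) (Δ u)) = u
  antipode_left : ∀ u,
    LinearMap.mul' k (R.U q) (S.rTensor (R.U q) (Δ u)) = algebraMap k (R.U q) (ε u)
  antipode_right : ∀ u,
    LinearMap.mul' k (R.U q) (S.lTensor (R.U q) (Δ u)) = algebraMap k (R.U q) (ε u)

/-! ### The fundamental representation -/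

/-- The right braided adjoint action
`v ⊗ b ↦ (S b₍₁₎⁽²⁾) (v ◁ ℛ(b₍₁₎⁽¹⁾)) b₍₂₎` on `k⟨e^i⟩`. -/
def adjointAction : FreeAlgebra k I ⊗[k] FreeAlgebra k I →ₗ[k] FreeAlgebra k I :=
  LinearMap.mul' k (FreeAlgebra k I) ∘ₗ
    (LinearMap.mul' k (FreeAlgebra k I) ∘ₗ
      (antipode (R.braidE q)).rTensor (FreeAlgebra k I) ∘ₗ R.braidE q).rTensor
        (FreeAlgebra k I) ∘ₗ
    (TensorProduct.assoc k (FreeAlgebra k I) (FreeAlgebra k I)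
      (FreeAlgebra k I)).symm.toLinearMap ∘ₗ
    (coproduct (R.braidE q)).lTensor (FreeAlgebra k I)

/-- The braided coregular action `v ↦ ⟨S̄ c, v₍₂₎⁽²⁾⟩ v₍₁₎ ◁ ℛ̄(v₍₂₎⁽¹⁾)` of `c ∈ k⟨f_i⟩`
on `k⟨e^i⟩`, where `S̄` is the braided antipode for the braided-opposite coproduct of `k⟨f_i⟩`. -/
def coregularAction (c : FreeAlgebra k I) : FreeAlgebra k I →ₗ[k] FreeAlgebra k I :=
  (TensorProduct.rid k (FreeAlgebra k I)).toLinearMap ∘ₗ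
    (R.freePairing q (antipode (R.braidFBar q) c)).lTensor (FreeAlgebra k I) ∘ₗ
    R.twist q (R.rmapBar k) ∘ₗ coproduct (R.braidE q)

/-- A right action of `U` on `B`, given as an algebra map `ρ` to the opposite of the algebra of
endomorphisms, so that `v ◁ u = act ρ v u`. -/
def act (ρ : R.U q →ₐ[k] (Module.End k (R.B q))ᵐᵒᵖ) (v : R.B q) : R.U q →ₗ[k] R.B q :=
  LinearMap.applyₗ v ∘ₗ (MulOpposite.opLinearEquiv k).symm.toLinearMap ∘ₗ ρ.toLinearMap

theorem act_apply (ρ : R.U q →ₐ[k] (Module.End k (R.B q))ᵐᵒᵖ) (v : R.B q) (u : R.U q) :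
    R.act q ρ v u = (ρ u).unop v := rfl

/-- `ρ` is the fundamental (Schrödinger) representation of `U` on `B`: `H` acts tautologically,
`B` by the right braided adjoint action, and `C̄` by the braided coregular action. The structure
maps of the braided groups `B` and `C̄` are those induced from `k⟨e^i⟩` and `k⟨f_i⟩`, so the
formulas are written on representatives. -/
structure IsFundamentalRep (ρ : R.U q →ₐ[k] (Module.End k (R.B q))ᵐᵒᵖ) : Prop where
  act_K : ∀ (v : FreeAlgebra k I) (μ : Y),
    R.act q ρ (R.toB q v) (R.K q μ) = R.toB q (R.actH q (AddMonoidAlgebra.single μ 1) v)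
  act_B : ∀ v b : FreeAlgebra k I,
    R.act q ρ (R.toB q v) (R.inclB q (R.toB q b)) = R.toB q (R.adjointAction q (v ⊗ₜ[k] b))
  act_C : ∀ v c : FreeAlgebra k I,
    R.act q ρ (R.toB q v) (R.inclC q (R.toC q c)) = R.toB q (R.coregularAction q c v)

/-- Braided differentiation on `k⟨e^i⟩`: `∂_i v` is defined by
`Ψ⁻¹(v₍₁₎ ⊗ v₍₂₎) = x^i ⊗ ∂_i v + …`, where the remaining terms have first factors on which
`⟨f_i, -⟩` vanishes. -/
def freeDeriv (i : I) : FreeAlgebra k I →ₗ[k] FreeAlgebra k I :=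
  (TensorProduct.lid k (FreeAlgebra k I)).toLinearMap ∘ₗ
    (R.freePairing q (FreeAlgebra.ι k i)).rTensor (FreeAlgebra k I) ∘ₗ
    R.braidEInv q ∘ₗ coproduct (R.braidE q)

/-! ### Lusztig's Verma module -/

/-- Lusztig's operator `_i r` on `k⟨f_i⟩`: `Δ c = f_i ⊗ (_i r)(c) + …`. -/
def leftSkew (i : I) : FreeAlgebra k I →ₗ[k] FreeAlgebra k I :=
  (TensorProduct.lid k (FreeAlgebra k I)).toLinearMap ∘ₗ
    (genCoeff k i).rTensor (FreeAlgebra k I) ∘ₗ coproduct (R.braidF q)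

/-- Lusztig's operator `r_i` on `k⟨f_i⟩`: `Δ c = r_i(c) ⊗ f_i + …`. -/
def rightSkew (i : I) : FreeAlgebra k I →ₗ[k] FreeAlgebra k I :=
  (TensorProduct.rid k (FreeAlgebra k I)).toLinearMap ∘ₗ
    (genCoeff k i).lTensor (FreeAlgebra k I) ∘ₗ coproduct (R.braidF q)

/-- `lam` is the Verma module representation (left action, highest weight `0`) of `U` on `C̄`:
`f_i` acts by left multiplication, `K_μ` by the `H`-action on `C̄`, and `e^i` by the difference
`c ↦ (r_i(c) - K_i^(-(i·i)/2) ▷ (_i r)(c)) / (q_i - q_i⁻¹)`; and `u ↦ u ▷ 1` presents `C̄` as the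
quotient of `U` by the left ideal generated by all `e^i` and all `K_μ - 1`. -/
structure IsVermaRep (lam : R.U q →ₐ[k] Module.End k (R.C q)) : Prop where
  act_f : ∀ (i : I) (c : R.C q), lam (R.f q i) c = R.toC q (FreeAlgebra.ι k i) * c
  act_K : ∀ (μ : Y) (c : FreeAlgebra k I),
    lam (R.K q μ) (R.toC q c) = R.toC q (R.actH q (AddMonoidAlgebra.single μ 1) c)
  act_e : ∀ (i : I) (c : FreeAlgebra k I),
    lam (R.e q i) (R.toC q c) = (R.qdiff q i)⁻¹ • R.toC q (R.rightSkew q i c -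
      R.actH q (AddMonoidAlgebra.single (-R.kappa i) 1) (R.leftSkew q i c))
  surjective : Function.Surjective (fun u => lam u 1)
  kernel : ∀ u, lam u 1 = 0 ↔
    u ∈ Ideal.span (Set.range (R.e q) ∪ Set.range (fun μ => R.K q μ - 1))

end LusztigRootDatum

end

/-! ### Word-by-word induction in free algebras -/

namespace FreeAlgebra

variable {k I : Type*} [CommSemiring k]

/-! The braided groups k⟨e^i⟩ and k⟨f_i⟩ are the same free algebra with the same coproduct
(`coproduct_braidF`), and the whole argument runs on Lusztig's skew derivations `leftSkew` and
`rightSkew`, which strip one letter from the left or the right leg of the coproduct. Multiplication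
by a generator on either side is adjoint to one of them up to the factor (q_i - q_i⁻¹)⁻¹. Hence the
pairing is symmetric (`freePairing_symm`) and has a single radical. Any operator with an adjoint
preserves this radical (`mem_radical_of_adjoint`): multiplication by generators, the K_μ, the
antipodes, the homogeneous components and, because q_i ≠ q_i⁻¹, the skew derivations. So the radical
is a homogeneous two-sided ideal, and its coproduct dies in B ⊗ B because products of functionals
separate points there (`map_toB_coproduct_eq_zero`).

The ideal is known only as a radical, not by explicit relations, so every algebra map out of U needs
an argument that it kills the radical. One tool is a q-binomial principle (`lift_add_eq`): if y_i
x_j = q^(i·j) x_j y_i, then the algebra map e^i ↦ x_i + y_i is the product of the two maps e^i ↦ x_i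
and e^i ↦ y_i along the coproduct, so it kills the radical if both do. Another is twisting by
commuting group-like elements (`lift_mul_eq_zero`), where homogeneity enters. The last is to
identify the map with a closed formula built from operations that descend to the quotient.

For the fundamental representation the generators act by v ↦ v e^i - e^i (K_i^((i·i)/2) v) and by a
rescaled, twisted right skew derivation. The cross relations follow from the braided Leibniz rule
(`opF_opE`). The operators of the e^i assemble to the braided adjoint action (`lift_opE_unop`, an
instance of the q-binomial principle), those of the f_i to the coregular action (`lift_opF_unop`),
and both formulas descend. Braided differentiation is minus the operator of f_i (`freeDeriv_eq`),
and the monomial formula is its Leibniz rule.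

The Verma operators are adjoint, through S̄ and the non-degenerate pairing, to those of the
fundamental representation, so they inherit the relations of U without a separate check
(`pairingCB_lift_genMap`). The kernel of u ↦ u ▷ 1 needs no triangular decomposition: modulo the
left ideal every element of U comes from C̄ (`exists_sub_inclC_mem`), and on C̄ the map u ↦ u ▷ 1 is
the identity (`verma_inclC`).

The Hopf structure and the module algebra property are verified on generators. The substantial point
is that the coproduct and antipode respect the radical: the q-binomial and twisting principles give
the first, a bosonisation formula for the antipode the second. -/

theorem induction_left {p : FreeAlgebra k I → Prop} (one : p 1)
    (ι_mul : ∀ i v, p v → p (ι k i * v)) (add : ∀ v w, p v → p w → p (v + w))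
    (smul : ∀ (r : k) v, p v → p (r • v)) (v : FreeAlgebra k I) : p v := by
  -- The strengthened statement composes under products, so the case of a product of two arbitrary
  -- elements is immediate.
  suffices h : ∀ w, p w → p (v * w) by simpa using h 1 one
  induction v using FreeAlgebra.induction with
  | grade0 r => intro w hw; rw [← Algebra.smul_def]; exact smul r w hw
  | grade1 i => exact fun w hw => ι_mul i w hw
  | mul a b ha hb => intro w hw; rw [mul_assoc]; exact ha _ (hb _ hw)
  | add a b ha hb => intro w hw; rw [add_mul]; exact add _ _ (ha _ hw) (hb _ hw)

theorem linearMap_ext_left {M : Type*} [AddCommMonoid M] [Module k M]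
    {f g : FreeAlgebra k I →ₗ[k] M} (one : f 1 = g 1)
    (ι_mul : ∀ i v, f v = g v → f (ι k i * v) = g (ι k i * v)) : f = g := by
  ext v
  induction v using induction_left with
  | one => exact one
  | ι_mul i v h => exact ι_mul i v h
  | add v w hv hw => simp only [map_add, hv, hw]
  | smul r v hv => simp only [map_smul, hv]

theorem induction_right {p : FreeAlgebra k I → Prop} (one : p 1)
    (mul_ι : ∀ i v, p v → p (v * ι k i)) (add : ∀ v w, p v → p w → p (v + w))
    (smul : ∀ (r : k) v, p v → p (r • v)) (v : FreeAlgebra k I) : p v := by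
  suffices h : ∀ w, p w → p (w * v) by simpa using h 1 one
  induction v using FreeAlgebra.induction with
  | grade0 r => intro w hw; rw [← Algebra.commutes, ← Algebra.smul_def]; exact smul r w hw
  | grade1 i => exact fun w hw => mul_ι i w hw
  | mul a b ha hb => intro w hw; rw [← mul_assoc]; exact hb _ (ha _ hw)
  | add a b ha hb => intro w hw; rw [mul_add]; exact add _ _ (ha _ hw) (hb _ hw)

end FreeAlgebra

noncomputable section

open FreeAlgebra (ι induction_left induction_right)

namespace LusztigRootDatum

variable {I X Y : Type*} [AddCommGroup X] [AddCommGroup Y] (R : LusztigRootDatum I X Y)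
variable {k : Type*} [Field k] (q : kˣ)

/-! ### Scalars and scaling automorphisms -/

/-- The scalar `q ^ (i · j)`. -/
def chi (i j : I) : k := ((q ^ R.form i j : kˣ) : k)

theorem chi_symm (i j : I) : R.chi q i j = R.chi q j i := by
  rw [chi, chi, R.form_symm]

theorem two_mul_half (i : I) : 2 * R.half i = R.form i i :=
  Int.two_mul_ediv_two_of_even (R.form_self_even i)

/-- The division defining a_{ij} is exact, so multiplying by (i·i)/2 recovers i·j in ℤ. All braiding
factors q^(i·j) below enter through this identity. -/
theorem pairing_kappa_root (i j : I) : R.pairing (R.kappa i) (R.root j) = R.form i j := by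
  have hd : R.form i i ∣ 2 * R.form i j := by
    rcases eq_or_ne i j with rfl | h
    · exact Dvd.intro_left 2 rfl
    · exact R.form_self_dvd i j h
  obtain ⟨m, hm⟩ := hd
  have h0 := (R.form_self_pos i).ne'
  rw [kappa, map_zsmul, LinearMap.smul_apply, R.pairing_coroot_root, hm,
    Int.mul_ediv_cancel_left _ h0, smul_eq_mul]
  have := R.two_mul_half i
  rw [← this] at hm
  linarith

theorem toY_single (i : I) : R.toY (Finsupp.single i 1) = R.kappa i := by
  simp [toY, kappa]

theorem rmap_single (i : I) :
    R.rmap k (AddMonoidAlgebra.single (Finsupp.single i 1) 1) =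
      AddMonoidAlgebra.single (R.kappa i) 1 := by
  simp [rmap, ← toY_single]

theorem rmapBar_single (i : I) :
    R.rmapBar k (AddMonoidAlgebra.single (Finsupp.single i 1) 1) =
      AddMonoidAlgebra.single (-R.kappa i) 1 := by
  simp [rmapBar, ← toY_single]

@[simp]
theorem scale_ι (μ : Y) (i : I) :
    R.scale q μ (ι k i) = ((q ^ R.pairing μ (R.root i) : kˣ) : k) • ι k i := by
  simp [scale]

theorem scale_kappa_ι (i j : I) : R.scale q (R.kappa i) (ι k j) = R.chi q i j • ι k j := by
  rw [scale_ι, pairing_kappa_root, chi]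

theorem scale_neg_kappa_ι (i j : I) :
    R.scale q (-R.kappa i) (ι k j) = (R.chi q i j)⁻¹ • ι k j := by
  rw [scale_ι, map_neg, LinearMap.neg_apply, pairing_kappa_root, chi, zpow_neg]
  simp

theorem chi_ne_zero (i j : I) : R.chi q i j ≠ 0 := Units.ne_zero _

theorem scale_scale (μ ν : Y) (v : FreeAlgebra k I) :
    R.scale q μ (R.scale q ν v) = R.scale q (μ + ν) v := by
  rw [scale_add]; rfl

theorem scale_comm (μ ν : Y) (v : FreeAlgebra k I) :
    R.scale q μ (R.scale q ν v) = R.scale q ν (R.scale q μ v) := by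
  rw [scale_scale, scale_scale, add_comm]

@[simp]
theorem scale_neg_scale (μ : Y) (v : FreeAlgebra k I) :
    R.scale q (-μ) (R.scale q μ v) = v := by
  rw [scale_scale, neg_add_cancel, scale_zero]; rfl

@[simp]
theorem scale_scale_neg (μ : Y) (v : FreeAlgebra k I) :
    R.scale q μ (R.scale q (-μ) v) = v := by
  rw [scale_scale, add_neg_cancel, scale_zero]; rfl

@[simp]
theorem actH_single (μ : Y) (v : FreeAlgebra k I) :
    R.actH q (AddMonoidAlgebra.single μ 1) v = R.scale q μ v := by
  simp [actH]

/-! ### The coaction and the braiding -/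

theorem coaction_ι_mul (i : I) (v : FreeAlgebra k I) :
    coaction k I (ι k i * v) =
      (AddMonoidAlgebra.single (Finsupp.single i 1) 1 ⊗ₜ ι k i) * coaction k I v := by
  simp [coaction]

section Twist

variable (θ : AddMonoidAlgebra k (I →₀ ℤ) →ₐ[k] AddMonoidAlgebra k Y)

theorem twist_tmul (v w : FreeAlgebra k I) :
    R.twist q θ (v ⊗ₜ w) =
      (((R.actH q).comp θ).toLinearMap.flip v).rTensor (FreeAlgebra k I) (coaction k I w) := by
  simp only [twist, LinearMap.comp_apply, LinearMap.lTensor_tmul, AlgHom.toLinearMap_apply]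
  induction coaction k I w using TensorProduct.induction_on with
  | zero => simp
  | tmul a w => simp
  | add s t hs ht => simp only [TensorProduct.tmul_add, map_add, hs, ht]

theorem twist_tmul_one (v : FreeAlgebra k I) : R.twist q θ (v ⊗ₜ 1) = v ⊗ₜ 1 := by
  rw [twist_tmul, map_one, Algebra.TensorProduct.one_def]
  simp

variable {θ} {τ : I → Y}

/-- Since `θ` sends g_i to one group-like element K_{τ i}, the maps ℛ and ℛ̄ are treated together,
with τ = κ and τ = -κ. Commutativity of A allows the new g_i to act before the rest of the word. -/
theorem twist_tmul_ι_mul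
    (hθ : ∀ i, θ (AddMonoidAlgebra.single (Finsupp.single i 1) 1) =
      AddMonoidAlgebra.single (τ i) 1) (v w : FreeAlgebra k I) (i : I) :
    R.twist q θ (v ⊗ₜ (ι k i * w)) =
      (LinearMap.mulLeft k (ι k i)).lTensor _ (R.twist q θ (R.scale q (τ i) v ⊗ₜ w)) := by
  rw [twist_tmul, twist_tmul, coaction_ι_mul]
  induction coaction k I w using TensorProduct.induction_on with
  | zero => simp
  | tmul a w =>
    rw [Algebra.TensorProduct.tmul_mul_tmul, mul_comm _ a]
    simp [hθ]
  | add s t hs ht => simp only [mul_add, map_add, hs, ht]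
end Twist

end LusztigRootDatum

namespace LusztigRootDatum

variable {I X Y : Type*} [AddCommGroup X] [AddCommGroup Y] (R : LusztigRootDatum I X Y)
variable {k : Type*} [Field k] (q : kˣ)

section Twist

variable {θ : AddMonoidAlgebra k (I →₀ ℤ) →ₐ[k] AddMonoidAlgebra k Y} {τ : I → Y}

theorem twist_one_tmul
    (hθ : ∀ i, θ (AddMonoidAlgebra.single (Finsupp.single i 1) 1) =
      AddMonoidAlgebra.single (τ i) 1) (w : FreeAlgebra k I) :
    R.twist q θ (1 ⊗ₜ w) = 1 ⊗ₜ w := by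
  induction w using induction_left with
  | one => exact R.twist_tmul_one q θ 1
  | ι_mul i v h => rw [R.twist_tmul_ι_mul q hθ, map_one, h]; simp
  | add v w hv hw => simp only [TensorProduct.tmul_add, map_add, hv, hw]
  | smul r v hv => simp only [TensorProduct.tmul_smul, map_smul, hv]

/-- Moving a letter past a word costs the same scalar whichever of the two is regarded as acting;
this is where symmetry of the form enters. -/
theorem twist_ι_mul_tmul
    (hθ : ∀ i, θ (AddMonoidAlgebra.single (Finsupp.single i 1) 1) =
      AddMonoidAlgebra.single (τ i) 1)
    (hτ : ∀ i j, R.pairing (τ i) (R.root j) = R.pairing (τ j) (R.root i))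
    (i : I) (v w : FreeAlgebra k I) :
    R.twist q θ ((ι k i * v) ⊗ₜ w) =
      (LinearMap.mulLeft k (ι k i)).rTensor _ (R.twist q θ (v ⊗ₜ R.scale q (τ i) w)) := by
  induction w using induction_left generalizing v with
  | one => simp only [twist_tmul_one, map_one]; simp
  | ι_mul j w h =>
    rw [R.twist_tmul_ι_mul q hθ, map_mul, map_mul, scale_ι, scale_ι, smul_mul_assoc,
      smul_mul_assoc, TensorProduct.tmul_smul, ← TensorProduct.smul_tmul', map_smul, map_smul,
      map_smul, map_smul, h, R.twist_tmul_ι_mul q hθ, hτ i j]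
    congr 1
    exact LinearMap.congr_fun ((LinearMap.lTensor_comp_rTensor ..).trans
      (LinearMap.rTensor_comp_lTensor ..).symm) _
  | add v w hv hw => simp only [TensorProduct.tmul_add, map_add, hv, hw]
  | smul r v hv => simp only [TensorProduct.tmul_smul, map_smul, hv]

theorem twist_tmul_ι
    (hθ : ∀ i, θ (AddMonoidAlgebra.single (Finsupp.single i 1) 1) =
      AddMonoidAlgebra.single (τ i) 1) (v : FreeAlgebra k I) (i : I) :
    R.twist q θ (v ⊗ₜ ι k i) = R.scale q (τ i) v ⊗ₜ ι k i := by
  have := R.twist_tmul_ι_mul q hθ v 1 i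
  rw [mul_one, twist_tmul_one] at this
  simpa using this

theorem twist_ι_tmul
    (hθ : ∀ i, θ (AddMonoidAlgebra.single (Finsupp.single i 1) 1) =
      AddMonoidAlgebra.single (τ i) 1)
    (hτ : ∀ i j, R.pairing (τ i) (R.root j) = R.pairing (τ j) (R.root i))
    (i : I) (w : FreeAlgebra k I) :
    R.twist q θ (ι k i ⊗ₜ w) = ι k i ⊗ₜ R.scale q (τ i) w := by
  have := R.twist_ι_mul_tmul q hθ hτ i 1 w
  rw [mul_one, R.twist_one_tmul q hθ] at this
  simpa using this

end Twist

theorem pairing_kappa_symm (i j : I) :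
    R.pairing (R.kappa i) (R.root j) = R.pairing (R.kappa j) (R.root i) := by
  rw [pairing_kappa_root, pairing_kappa_root, R.form_symm]

theorem pairing_neg_kappa_symm (i j : I) :
    R.pairing (-R.kappa i) (R.root j) = R.pairing (-R.kappa j) (R.root i) := by
  rw [map_neg, map_neg, LinearMap.neg_apply, LinearMap.neg_apply, pairing_kappa_symm]

theorem braidE_ι_tmul (i : I) (v : FreeAlgebra k I) :
    R.braidE q (ι k i ⊗ₜ v) = R.scale q (R.kappa i) v ⊗ₜ ι k i := by
  rw [braidE, LinearMap.comp_apply, R.twist_ι_tmul q R.rmap_single R.pairing_kappa_symm, flip]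
  simp

theorem braidF_ι_tmul (i : I) (v : FreeAlgebra k I) :
    R.braidF q (ι k i ⊗ₜ v) = R.scale q (R.kappa i) v ⊗ₜ ι k i := by
  rw [braidF, LinearMap.comp_apply, flip]
  simp only [LinearEquiv.coe_coe, TensorProduct.comm_tmul]
  exact R.twist_tmul_ι q R.rmap_single v i

theorem braidFBar_ι_tmul (i : I) (v : FreeAlgebra k I) :
    R.braidFBar q (ι k i ⊗ₜ v) = R.scale q (-R.kappa i) v ⊗ₜ ι k i := by
  rw [braidFBar, LinearMap.comp_apply, flip]
  simp only [LinearEquiv.coe_coe, TensorProduct.comm_tmul]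
  exact R.twist_tmul_ι q R.rmapBar_single v i

/-! ### The coproduct -/

/-- The coproduct only braids a single generator past an arbitrary element, and there the two
braidings agree. One coproduct therefore serves both sides of the pairing. -/
theorem coproduct_braidF : coproduct (R.braidF q) = coproduct (R.braidE q) := by
  have h (i : I) : mulPrimitive (R.braidF q) i = mulPrimitive (R.braidE q) i := by
    have : R.braidF q ∘ₗ TensorProduct.mk k _ _ (ι k i) =
        R.braidE q ∘ₗ TensorProduct.mk k _ _ (ι k i) := by
      ext v
      simp [braidE_ι_tmul, braidF_ι_tmul]
    rw [mulPrimitive, mulPrimitive, this]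
  rw [coproduct, coproduct, funext h]

theorem mulPrimitive_tmul (i : I) (v w : FreeAlgebra k I) :
    mulPrimitive (R.braidE q) i (v ⊗ₜ w) =
      (ι k i * v) ⊗ₜ w + R.scale q (R.kappa i) v ⊗ₜ (ι k i * w) := by
  simp [mulPrimitive, braidE_ι_tmul]

/-- A linear map intertwining the coproduct with a map out of the free algebra is determined by its
behaviour on left multiplication by primitive elements. -/
theorem comp_coproduct_ext {M : Type*} [AddCommGroup M] [Module k M]
    (F : FreeAlgebra k I ⊗[k] FreeAlgebra k I →ₗ[k] M) (G : FreeAlgebra k I →ₗ[k] M)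
    (N : I → M →ₗ[k] M) (one : F (1 ⊗ₜ 1) = G 1)
    (hF : ∀ i v w, F ((ι k i * v) ⊗ₜ w + R.scale q (R.kappa i) v ⊗ₜ (ι k i * w)) =
      N i (F (v ⊗ₜ w)))
    (hG : ∀ i v, G (ι k i * v) = N i (G v)) : F ∘ₗ coproduct (R.braidE q) = G := by
  apply FreeAlgebra.linearMap_ext_left
  · rw [LinearMap.comp_apply, coproduct_one, one]
  · intro i v h
    rw [LinearMap.comp_apply, coproduct_ι_mul, hG, ← h, LinearMap.comp_apply]
    induction coproduct (R.braidE q) v using TensorProduct.induction_on with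
    | zero => simp
    | tmul a b => rw [mulPrimitive_tmul, hF]
    | add s t hs ht => simp only [map_add, hs, ht]

theorem coproduct_scale (μ : Y) (v : FreeAlgebra k I) :
    coproduct (R.braidE q) (R.scale q μ v) =
      TensorProduct.map (R.scale q μ).toLinearMap (R.scale q μ).toLinearMap
        (coproduct (R.braidE q) v) := by
  induction v using induction_left with
  | one => simp [coproduct_one]
  | ι_mul i v h =>
    rw [map_mul, scale_ι, smul_mul_assoc, map_smul, coproduct_ι_mul, coproduct_ι_mul, h]
    induction coproduct (R.braidE q) v using TensorProduct.induction_on with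
    | zero => simp
    | tmul a b =>
      simp only [TensorProduct.map_tmul, mulPrimitive_tmul, map_add, AlgHom.toLinearMap_apply,
        map_mul, scale_ι, smul_mul_assoc, TensorProduct.tmul_smul, ← TensorProduct.smul_tmul',
        smul_add, R.scale_comm q μ]
    | add s t hs ht => simp only [map_add, smul_add, hs, ht]
  | add v w hv hw => simp only [map_add, hv, hw]
  | smul r v hv => simp only [map_smul, hv]

/-- The counit of the free algebra. -/
def counit (k I : Type*) [Field k] : FreeAlgebra k I →ₐ[k] k := FreeAlgebra.algebraMapInv

@[simp]
theorem counit_ι_mul (i : I) (v : FreeAlgebra k I) : counit k I (ι k i * v) = 0 := by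
  simp [counit, FreeAlgebra.algebraMapInv]

@[simp]
theorem counit_mul_ι (i : I) (v : FreeAlgebra k I) : counit k I (v * ι k i) = 0 := by
  simp [counit, FreeAlgebra.algebraMapInv]

@[simp]
theorem counit_scale (μ : Y) (v : FreeAlgebra k I) :
    counit k I (R.scale q μ v) = counit k I v := by
  induction v using induction_left with
  | one => simp
  | ι_mul i v h => simp
  | add v w hv hw => simp only [map_add, hv, hw]
  | smul r v hv => simp only [map_smul, hv]

theorem counit_lTensor_coproduct (v : FreeAlgebra k I) :
    TensorProduct.rid k _ ((counit k I).toLinearMap.lTensor _ (coproduct (R.braidE q) v)) = v :=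
  LinearMap.congr_fun (R.comp_coproduct_ext q
    ((TensorProduct.rid k _).toLinearMap ∘ₗ (counit k I).toLinearMap.lTensor _) LinearMap.id
    (fun i => LinearMap.mulLeft k (ι k i)) (by simp) (by simp) (by simp)) v

theorem counit_rTensor_coproduct (v : FreeAlgebra k I) :
    TensorProduct.lid k _ ((counit k I).toLinearMap.rTensor _ (coproduct (R.braidE q) v)) = v :=
  LinearMap.congr_fun (R.comp_coproduct_ext q
    ((TensorProduct.lid k _).toLinearMap ∘ₗ (counit k I).toLinearMap.rTensor _) LinearMap.id
    (fun i => LinearMap.mulLeft k (ι k i)) (by simp) (by simp) (by simp)) v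

/-! ### Coefficients of generators -/

@[simp]
theorem genCoeff_one (i : I) : genCoeff k i 1 = 0 := by
  simp [genCoeff, MonoidAlgebra.one_def]

theorem coeff_one_eq_counit (v : FreeAlgebra k I) :
    (FreeAlgebra.equivMonoidAlgebraFreeMonoid v).coeff 1 = counit k I v := by
  induction v using induction_left with
  | one => simp [MonoidAlgebra.one_def]
  | ι_mul i v h =>
    rw [counit_ι_mul, map_mul]
    simp [FreeAlgebra.equivMonoidAlgebraFreeMonoid]
  | add v w hv hw => simp only [map_add, MonoidAlgebra.coeff_add, Finsupp.add_apply, hv, hw]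
  | smul r v hv => simp only [map_smul, MonoidAlgebra.coeff_smul, Finsupp.smul_apply, hv]

@[simp]
theorem genCoeff_ι_mul [DecidableEq I] (i j : I) (v : FreeAlgebra k I) :
    genCoeff k i (ι k j * v) = if i = j then counit k I v else 0 := by
  rw [← coeff_one_eq_counit]
  have h : genCoeff k i (ι k j * v) = (MonoidAlgebra.single (FreeMonoid.of j) (1 : k) *
      FreeAlgebra.equivMonoidAlgebraFreeMonoid v).coeff (FreeMonoid.of i) := by
    simp [genCoeff, FreeAlgebra.equivMonoidAlgebraFreeMonoid]
  rw [h]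
  split_ifs with hij
  · subst hij
    have := MonoidAlgebra.coeff_single_mul_mul (FreeAlgebra.equivMonoidAlgebraFreeMonoid v)
      (1 : k) (FreeMonoid.of i) 1
    rwa [mul_one, one_mul] at this
  · refine MonoidAlgebra.coeff_single_mul_of_forall_mul_ne _ _ fun d hd => hij ?_
    have := congrArg FreeMonoid.toList hd
    simp only [FreeMonoid.toList_mul, FreeMonoid.toList_of, List.singleton_append,
      List.cons.injEq] at this
    exact this.1.symm

theorem genCoeff_scale (i : I) (μ : Y) (v : FreeAlgebra k I) :
    genCoeff k i (R.scale q μ v) =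
      ((q ^ R.pairing μ (R.root i) : kˣ) : k) * genCoeff k i v := by
  classical
  induction v using induction_left with
  | one => simp
  | ι_mul j v h =>
    rw [map_mul, scale_ι, smul_mul_assoc, map_smul, genCoeff_ι_mul, genCoeff_ι_mul]
    by_cases hij : i = j
    · subst hij; simp
    · simp [hij]
  | add v w hv hw => simp only [map_add, mul_add, hv, hw]
  | smul r v hv => simp only [map_smul, hv, smul_eq_mul]; ring

end LusztigRootDatum

namespace LusztigRootDatum

variable {I X Y : Type*} [AddCommGroup X] [AddCommGroup Y] (R : LusztigRootDatum I X Y)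
variable {k : Type*} [Field k] (q : kˣ)

/-! ### Skew derivations -/

@[simp]
theorem leftSkew_one (i : I) : R.leftSkew q i 1 = 0 := by
  simp [leftSkew, coproduct_one]

@[simp]
theorem rightSkew_one (i : I) : R.rightSkew q i 1 = 0 := by
  simp [rightSkew, coproduct_one]

theorem leftSkew_eq (i : I) (v : FreeAlgebra k I) :
    R.leftSkew q i v =
      TensorProduct.lid k _ ((genCoeff k i).rTensor _ (coproduct (R.braidE q) v)) := by
  rw [leftSkew, coproduct_braidF]; rfl

theorem rightSkew_eq (i : I) (v : FreeAlgebra k I) :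
    R.rightSkew q i v =
      TensorProduct.rid k _ ((genCoeff k i).lTensor _ (coproduct (R.braidE q) v)) := by
  rw [rightSkew, coproduct_braidF]; rfl

theorem genCoeff_scale_kappa (i j : I) (v : FreeAlgebra k I) :
    genCoeff k i (R.scale q (R.kappa j) v) = R.chi q i j * genCoeff k i v := by
  rw [genCoeff_scale, pairing_kappa_root, R.form_symm]; rfl

section

variable [DecidableEq I]

/-- In (e^j ⊗ 1 + 1 ⊗ e^j) Δv, the first summand has a left leg of degree one only where the old
left leg is a scalar, which the counit extracts; the second braids e^j past a left leg equal to the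
letter i. -/
theorem leftSkew_ι_mul (i j : I) (v : FreeAlgebra k I) :
    R.leftSkew q i (ι k j * v) =
      (if i = j then v else 0) + R.chi q i j • (ι k j * R.leftSkew q i v) := by
  conv_rhs => rw [← R.counit_rTensor_coproduct q v]
  rw [leftSkew_eq, leftSkew_eq, coproduct_ι_mul]
  rw [R.counit_rTensor_coproduct q v]
  have key (t : FreeAlgebra k I ⊗[k] FreeAlgebra k I) :
      TensorProduct.lid k _ ((genCoeff k i).rTensor _ (mulPrimitive (R.braidE q) j t)) =
        (if i = j then TensorProduct.lid k _ ((counit k I).toLinearMap.rTensor _ t) else 0) +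
          R.chi q i j • (ι k j * TensorProduct.lid k _ ((genCoeff k i).rTensor _ t)) := by
    induction t using TensorProduct.induction_on with
    | zero => simp
    | tmul a b =>
      rw [mulPrimitive_tmul, map_add, map_add, LinearMap.rTensor_tmul, LinearMap.rTensor_tmul,
        genCoeff_ι_mul, genCoeff_scale_kappa]
      split_ifs <;> simp [mul_smul]
    | add s t hs ht =>
      simp only [map_add, hs, ht, mul_add, smul_add]
      split_ifs <;> abel
  rw [key, R.counit_rTensor_coproduct q v]

theorem rightSkew_ι_mul (i j : I) (v : FreeAlgebra k I) :
    R.rightSkew q i (ι k j * v) =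
      ι k j * R.rightSkew q i v + if i = j then R.scale q (R.kappa i) v else 0 := by
  rw [rightSkew_eq, rightSkew_eq, coproduct_ι_mul]
  have key (t : FreeAlgebra k I ⊗[k] FreeAlgebra k I) :
      TensorProduct.rid k _ ((genCoeff k i).lTensor _ (mulPrimitive (R.braidE q) j t)) =
        ι k j * TensorProduct.rid k _ ((genCoeff k i).lTensor _ t) +
        (if i = j then R.scale q (R.kappa i) (TensorProduct.rid k _
          ((counit k I).toLinearMap.lTensor _ t)) else 0) := by
    induction t using TensorProduct.induction_on with
    | zero => simp
    | tmul a b =>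
      rw [mulPrimitive_tmul, map_add, map_add, LinearMap.lTensor_tmul, LinearMap.lTensor_tmul,
        genCoeff_ι_mul]
      split_ifs with h
      · subst h; simp
      · simp
    | add s t hs ht =>
      simp only [map_add, hs, ht, mul_add]
      split_ifs <;> abel
  rw [key, R.counit_lTensor_coproduct q v]

theorem leftSkew_ι (i j : I) : R.leftSkew q i (ι k j) = if i = j then 1 else 0 := by
  simpa using R.leftSkew_ι_mul q i j 1

theorem rightSkew_ι (i j : I) : R.rightSkew q i (ι k j) = if i = j then 1 else 0 := by
  simpa using R.rightSkew_ι_mul q i j 1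

theorem leftSkew_scale (i : I) (μ : Y) (v : FreeAlgebra k I) :
    R.leftSkew q i (R.scale q μ v) =
      ((q ^ R.pairing μ (R.root i) : kˣ) : k) • R.scale q μ (R.leftSkew q i v) := by
  induction v using induction_left with
  | one => simp
  | ι_mul j v h =>
    rw [map_mul, scale_ι, smul_mul_assoc, map_smul, leftSkew_ι_mul, leftSkew_ι_mul, h]
    simp only [smul_add, map_add, map_smul, map_mul, scale_ι, smul_mul_assoc, mul_smul_comm]
    congr 1
    · split_ifs with h
      · rw [h]
      · simp
    · simp only [smul_smul]; congr 1; ring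
  | add v w hv hw => simp only [map_add, smul_add, hv, hw]
  | smul r v hv => simp only [map_smul, hv]; exact smul_comm ..

theorem rightSkew_scale (i : I) (μ : Y) (v : FreeAlgebra k I) :
    R.rightSkew q i (R.scale q μ v) =
      ((q ^ R.pairing μ (R.root i) : kˣ) : k) • R.scale q μ (R.rightSkew q i v) := by
  induction v using induction_left with
  | one => simp
  | ι_mul j v h =>
    rw [map_mul, scale_ι, smul_mul_assoc, map_smul, rightSkew_ι_mul, rightSkew_ι_mul, h]
    simp only [smul_add, map_add, map_mul, scale_ι, smul_mul_assoc, mul_smul_comm]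
    congr 1
    · simp only [smul_smul]; congr 1; ring
    · split_ifs with h
      · rw [h, R.scale_comm q μ]
      · simp
  | add v w hv hw => simp only [map_add, smul_add, hv, hw]
  | smul r v hv => simp only [map_smul, hv]; exact smul_comm ..

theorem leftSkew_scale_kappa (i j : I) (v : FreeAlgebra k I) :
    R.leftSkew q i (R.scale q (R.kappa j) v) =
      R.chi q i j • R.scale q (R.kappa j) (R.leftSkew q i v) := by
  rw [leftSkew_scale, pairing_kappa_root, R.form_symm]; rfl

theorem rightSkew_scale_kappa (i j : I) (v : FreeAlgebra k I) :
    R.rightSkew q i (R.scale q (R.kappa j) v) =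
      R.chi q i j • R.scale q (R.kappa j) (R.rightSkew q i v) := by
  rw [rightSkew_scale, pairing_kappa_root, R.form_symm]; rfl

theorem rightSkew_mul (i : I) (v w : FreeAlgebra k I) :
    R.rightSkew q i (v * w) =
      v * R.rightSkew q i w + R.rightSkew q i v * R.scale q (R.kappa i) w := by
  induction v using induction_left with
  | one => simp
  | ι_mul j v h =>
    rw [mul_assoc, rightSkew_ι_mul, rightSkew_ι_mul, h]
    split_ifs
    · rw [map_mul]; noncomm_ring
    · noncomm_ring
  | add v w hv hw => simp only [add_mul, map_add, hv, hw]; abel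
  | smul r v hv => simp only [smul_mul_assoc, map_smul, hv, smul_add]

theorem leftSkew_mul_ι (i j : I) (v : FreeAlgebra k I) :
    R.leftSkew q i (v * ι k j) =
      R.leftSkew q i v * ι k j + if i = j then R.scale q (R.kappa i) v else 0 := by
  induction v using induction_left with
  | one => simp [leftSkew_ι]
  | ι_mul m v h =>
    rw [mul_assoc, leftSkew_ι_mul, leftSkew_ι_mul, h, map_mul, scale_kappa_ι, add_mul, mul_add,
      smul_add, smul_mul_assoc, mul_assoc, ← add_assoc]
    congr 1
    · split_ifs <;> simp
    · split_ifs <;> simp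
  | add v w hv hw => simp only [add_mul, map_add, hv, hw]; split_ifs <;> abel
  | smul r v hv => simp only [smul_mul_assoc, map_smul, hv, smul_add]; split_ifs <;> simp

theorem rightSkew_mul_ι (i j : I) (v : FreeAlgebra k I) :
    R.rightSkew q i (v * ι k j) =
      (if i = j then v else 0) + R.chi q i j • (R.rightSkew q i v * ι k j) := by
  rw [rightSkew_mul, rightSkew_ι, scale_kappa_ι, mul_smul_comm]
  split_ifs <;> simp

/-- A shadow of coassociativity: extracting a letter on the left and one on the right are
independent. It makes the pairing behave well under multiplication on the right. -/
theorem leftSkew_rightSkew (i j : I) (v : FreeAlgebra k I) :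
    R.leftSkew q j (R.rightSkew q i v) = R.rightSkew q i (R.leftSkew q j v) := by
  induction v using induction_left with
  | one => simp
  | ι_mul m v h =>
    rw [rightSkew_ι_mul, leftSkew_ι_mul, map_add, leftSkew_ι_mul, map_add, map_smul,
      rightSkew_ι_mul, h, smul_add, add_assoc]
    congr 1
    · split_ifs <;> simp
    · congr 1
      split_ifs with hi
      · subst hi; rw [leftSkew_scale_kappa]
      · simp
  | add v w hv hw => simp only [map_add, hv, hw]
  | smul r v hv => simp only [map_smul, hv]

/-- Coassociativity with one outer leg evaluated at a letter. Together with its right-handed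
counterpart it replaces the full coassociativity of the braided coproduct. -/
theorem coproduct_leftSkew (i : I) (v : FreeAlgebra k I) :
    coproduct (R.braidE q) (R.leftSkew q i v) =
      (R.leftSkew q i).rTensor _ (coproduct (R.braidE q) v) := by
  induction v using induction_left with
  | one => simp [coproduct_one]
  | ι_mul j v h =>
    rw [leftSkew_ι_mul, map_add, map_smul, coproduct_ι_mul, coproduct_ι_mul, h,
      apply_ite (coproduct (R.braidE q)), map_zero]
    induction coproduct (R.braidE q) v using TensorProduct.induction_on with
    | zero => simp
    | tmul a b =>
      simp only [LinearMap.rTensor_tmul, mulPrimitive_tmul, map_add, leftSkew_ι_mul,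
        leftSkew_scale_kappa, TensorProduct.add_tmul, ← TensorProduct.smul_tmul', smul_add]
      split_ifs <;> simp [add_assoc]
    | add s t hs ht =>
      simp only [map_add, smul_add, ← hs, ← ht]
      split_ifs <;> abel
  | add v w hv hw => simp only [map_add, hv, hw]
  | smul r v hv => simp only [map_smul, hv]

theorem coproduct_rightSkew (i : I) (v : FreeAlgebra k I) :
    coproduct (R.braidE q) (R.rightSkew q i v) =
      (R.rightSkew q i).lTensor _ (coproduct (R.braidE q) v) := by
  induction v using induction_left with
  | one => simp [coproduct_one]
  | ι_mul j v h =>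
    rw [rightSkew_ι_mul, map_add, coproduct_ι_mul, coproduct_ι_mul, h,
      apply_ite (coproduct (R.braidE q)), map_zero, coproduct_scale]
    induction coproduct (R.braidE q) v using TensorProduct.induction_on with
    | zero => simp
    | tmul a b =>
      simp only [LinearMap.lTensor_tmul, mulPrimitive_tmul, map_add, rightSkew_ι_mul,
        TensorProduct.tmul_add]
      split_ifs with hij
      · subst hij; simp [add_assoc]
      · simp
    | add s t hs ht =>
      simp only [map_add, ← hs, ← ht]
      split_ifs <;> abel
  | add v w hv hw => simp only [map_add, hv, hw]
  | smul r v hv => simp only [map_smul, hv]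

end

theorem counit_leftSkew (i : I) (v : FreeAlgebra k I) :
    counit k I (R.leftSkew q i v) = genCoeff k i v := by
  classical
  induction v using induction_left with
  | one => simp
  | ι_mul j v h => rw [leftSkew_ι_mul, genCoeff_ι_mul]; split_ifs <;> simp
  | add v w hv hw => simp only [map_add, hv, hw]
  | smul r v hv => simp only [map_smul, hv]

theorem counit_rightSkew (i : I) (v : FreeAlgebra k I) :
    counit k I (R.rightSkew q i v) = genCoeff k i v := by
  classical
  induction v using induction_left with
  | one => simp
  | ι_mul j v h => rw [rightSkew_ι_mul, genCoeff_ι_mul]; split_ifs <;> simp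
  | add v w hv hw => simp only [map_add, hv, hw]
  | smul r v hv => simp only [map_smul, hv]

/-! ### The pairing -/

theorem contract_eq (i : I) (v : FreeAlgebra k I) :
    R.contract q i v = (R.qdiff q i)⁻¹ • R.leftSkew q i v := by
  rw [leftSkew_eq, contract]
  simp [LinearMap.rTensor_smul]

theorem freePairing_ι_mul_left (i : I) (c v : FreeAlgebra k I) :
    R.freePairing q (ι k i * c) v =
      (R.qdiff q i)⁻¹ * R.freePairing q c (R.leftSkew q i v) := by
  rw [freePairing_ι_mul, contract_eq, map_smul, smul_eq_mul]

theorem freePairing_one_left (v : FreeAlgebra k I) : R.freePairing q 1 v = counit k I v :=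
  R.freePairing_one q v

/-- The pairing is defined by peeling letters off on the left. Commuting skew derivations carry the
rightmost letter through the recursion; at its end the two derivations agree because they have the
same counit. -/
theorem freePairing_mul_ι_left (i : I) (c v : FreeAlgebra k I) :
    R.freePairing q (c * ι k i) v =
      (R.qdiff q i)⁻¹ * R.freePairing q c (R.rightSkew q i v) := by
  classical
  induction c using induction_left generalizing v with
  | one =>
    have h := R.freePairing_ι_mul_left q i 1 v
    rw [mul_one] at h
    rw [one_mul, h, freePairing_one_left, freePairing_one_left, counit_leftSkew,
      counit_rightSkew]
  | ι_mul j c h =>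
    rw [mul_assoc, freePairing_ι_mul_left, h, freePairing_ι_mul_left, leftSkew_rightSkew]
    ring
  | add v w hv hw => simp only [add_mul, map_add, LinearMap.add_apply, hv, hw, mul_add]
  | smul r v hv =>
    simp only [smul_mul_assoc, map_smul, LinearMap.smul_apply, hv, smul_eq_mul]; ring

/-- The Leibniz rules in the two arguments match term by term, because δ_{ij} and q^(i·j) are both
symmetric in i and j. -/
theorem freePairing_ι_mul_right (i : I) (c v : FreeAlgebra k I) :
    R.freePairing q c (ι k i * v) =
      (R.qdiff q i)⁻¹ * R.freePairing q (R.leftSkew q i c) v := by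
  classical
  induction c using induction_left generalizing v with
  | one => simp [freePairing_one_left]
  | ι_mul j c h =>
    rw [freePairing_ι_mul_left, leftSkew_ι_mul, leftSkew_ι_mul, map_add, map_smul, h, map_add,
      map_smul, LinearMap.add_apply, LinearMap.smul_apply, freePairing_ι_mul_left, mul_add,
      mul_add, R.chi_symm q i j]
    congr 1
    · by_cases hij : i = j
      · subst hij; simp
      · simp [hij, Ne.symm hij]
    · simp only [smul_eq_mul]; ring
  | add v w hv hw => simp only [map_add, LinearMap.add_apply, hv, hw, mul_add]
  | smul r v hv => simp only [map_smul, LinearMap.smul_apply, hv, smul_eq_mul]; ring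

theorem freePairing_symm (c v : FreeAlgebra k I) :
    R.freePairing q c v = R.freePairing q v c := by
  induction c using induction_left generalizing v with
  | one =>
    rw [freePairing_one_left]
    induction v using induction_left with
    | one => simp [freePairing_one_left]
    | ι_mul i v h => simp [freePairing_ι_mul_left]
    | add v w hv hw => simp only [map_add, LinearMap.add_apply, hv, hw]
    | smul r v hv => simp only [map_smul, LinearMap.smul_apply, hv]
  | ι_mul i c h => rw [freePairing_ι_mul_left, freePairing_ι_mul_right, h]
  | add v w hv hw => simp only [map_add, LinearMap.add_apply, hv, hw]
  | smul r v hv => simp only [map_smul, LinearMap.smul_apply, hv]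

theorem freePairing_mul_ι_right (i : I) (c v : FreeAlgebra k I) :
    R.freePairing q c (v * ι k i) =
      (R.qdiff q i)⁻¹ * R.freePairing q (R.rightSkew q i c) v := by
  rw [freePairing_symm, freePairing_mul_ι_left, freePairing_symm]

theorem freePairing_scale (μ : Y) (c v : FreeAlgebra k I) :
    R.freePairing q (R.scale q μ c) v = R.freePairing q c (R.scale q μ v) := by
  classical
  induction c using induction_left generalizing v with
  | one => simp [freePairing_one_left]
  | ι_mul i c h =>
    rw [map_mul, scale_ι, smul_mul_assoc, map_smul, LinearMap.smul_apply, freePairing_ι_mul_left,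
      freePairing_ι_mul_left, h, leftSkew_scale, map_smul, smul_eq_mul, smul_eq_mul]
    ring
  | add v w hv hw => simp only [map_add, LinearMap.add_apply, hv, hw]
  | smul r v hv => simp only [map_smul, LinearMap.smul_apply, hv]

/-- The value of the product of two functionals on a tensor. -/
def tensorPairing (c d : FreeAlgebra k I) : FreeAlgebra k I ⊗[k] FreeAlgebra k I →ₗ[k] k :=
  LinearMap.mul' k k ∘ₗ TensorProduct.map (R.freePairing q c) (R.freePairing q d)

/-- The duality of product and coproduct, which the definition imposes only for a generator `c`,
extends to all `c` by `coproduct_leftSkew`. -/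
theorem freePairing_mul_left (c d v : FreeAlgebra k I) :
    R.freePairing q (c * d) v = R.tensorPairing q c d (coproduct (R.braidE q) v) := by
  classical
  induction c using induction_left generalizing v with
  | one =>
    rw [one_mul]
    conv_lhs => rw [← R.counit_rTensor_coproduct q v]
    induction coproduct (R.braidE q) v using TensorProduct.induction_on with
    | zero => simp
    | tmul a b => simp [tensorPairing, freePairing_one_left]
    | add s t hs ht => simp only [map_add, hs, ht]
  | ι_mul i c h =>
    rw [mul_assoc, freePairing_ι_mul_left, h, coproduct_leftSkew]
    induction coproduct (R.braidE q) v using TensorProduct.induction_on with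
    | zero => simp
    | tmul a b => simp [tensorPairing, freePairing_ι_mul_left, mul_assoc]
    | add s t hs ht => simp only [map_add, mul_add, hs, ht]
  | add v w hv hw =>
    simp only [add_mul, map_add, LinearMap.add_apply, hv, hw, tensorPairing,
      TensorProduct.map_add_left, LinearMap.comp_add]
  | smul r v hv =>
    simp only [smul_mul_assoc, map_smul, LinearMap.smul_apply, hv, tensorPairing,
      TensorProduct.map_smul_left, LinearMap.comp_smul]

end LusztigRootDatum

/-- A ring quotient identifies elements along the congruence generated by the relation. Mapping to
the quotient by `c` shows that nothing more is identified when the relation is already a congruence.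
-/
theorem RingQuot.mkAlgHom_eq_iff_of_ringCon {k A : Type*} [CommSemiring k] [Semiring A]
    [Algebra k A] {r : A → A → Prop} (c : RingCon A) (hc : ∀ a b, r a b ↔ c a b) (a b : A) :
    RingQuot.mkAlgHom k r a = RingQuot.mkAlgHom k r b ↔ r a b := by
  refine ⟨fun h => ?_, fun h => RingQuot.mkAlgHom_rel k h⟩
  let φ : RingQuot r →+* c.Quotient := RingQuot.lift
    ⟨c.mk', fun x y hxy => (RingCon.eq c).2 ((hc x y).1 hxy)⟩
  have hφ (x : A) : φ (RingQuot.mkAlgHom k r x) = c.mk' x := by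
    rw [← RingQuot.lift_mkRingHom_apply c.mk' (fun x y hxy => (RingCon.eq c).2 ((hc x y).1 hxy)) x,
      ← RingQuot.mkAlgHom_coe k]
    rfl
  have h' := congrArg φ h
  rw [hφ, hφ] at h'
  exact (hc a b).2 ((RingCon.eq c).1 h')

namespace LusztigRootDatum

variable {I X Y : Type*} [AddCommGroup X] [AddCommGroup Y] (R : LusztigRootDatum I X Y)
variable {k : Type*} [Field k] (q : kˣ)

/-! ### Antipodes -/

section Antipode

variable {Ψ Φ : FreeAlgebra k I ⊗[k] FreeAlgebra k I →ₗ[k] FreeAlgebra k I ⊗[k] FreeAlgebra k I}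
variable {τ σ : I → Y}

theorem antipode_ι_mul_eq (hΨ : ∀ i v, Ψ (ι k i ⊗ₜ v) = R.scale q (τ i) v ⊗ₜ ι k i)
    (i : I) (v : FreeAlgebra k I) :
    antipode Ψ (ι k i * v) = -(R.scale q (τ i) (antipode Ψ v) * ι k i) := by
  rw [antipode_ι_mul, TensorProduct.neg_tmul, map_neg, hΨ, map_neg, LinearMap.mul'_apply]

theorem antipode_scale (hΨ : ∀ i v, Ψ (ι k i ⊗ₜ v) = R.scale q (τ i) v ⊗ₜ ι k i)
    (μ : Y) (v : FreeAlgebra k I) :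
    antipode Ψ (R.scale q μ v) = R.scale q μ (antipode Ψ v) := by
  induction v using induction_left with
  | one => simp [antipode_one]
  | ι_mul i v h =>
    rw [map_mul, scale_ι, smul_mul_assoc, map_smul, R.antipode_ι_mul_eq q hΨ,
      R.antipode_ι_mul_eq q hΨ, h, map_neg, map_mul, scale_ι, mul_smul_comm, R.scale_comm q μ,
      smul_neg]
  | add v w hv hw => simp only [map_add, hv, hw]
  | smul r v hv => simp only [map_smul, hv]

/-- The antipode is defined by a recursion on the left; symmetry of the braiding scalars makes the
mirrored recursion hold as well. -/
theorem antipode_mul_ι (hΨ : ∀ i v, Ψ (ι k i ⊗ₜ v) = R.scale q (τ i) v ⊗ₜ ι k i)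
    (hτ : ∀ i j, R.pairing (τ i) (R.root j) = R.pairing (τ j) (R.root i))
    (i : I) (v : FreeAlgebra k I) :
    antipode Ψ (v * ι k i) = -(ι k i * R.scale q (τ i) (antipode Ψ v)) := by
  induction v using induction_left with
  | one =>
    have := R.antipode_ι_mul_eq q hΨ i 1
    rw [mul_one] at this
    simp [this, antipode_one]
  | ι_mul j v h =>
    rw [mul_assoc, R.antipode_ι_mul_eq q hΨ, h, R.antipode_ι_mul_eq q hΨ]
    simp only [map_neg, map_mul, scale_ι, smul_mul_assoc, mul_smul_comm, hτ i j,
      R.scale_comm q (τ i), neg_mul, mul_neg, mul_assoc, neg_neg]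
  | add v w hv hw => simp only [add_mul, mul_add, map_add, hv, hw, neg_add]
  | smul r v hv => simp only [smul_mul_assoc, mul_smul_comm, map_smul, hv, smul_neg]

/-- Each antipode reverses words; the scalings picked up by opposite braidings cancel. In particular
S̄ is the inverse of S. -/
theorem antipode_antipode (hΨ : ∀ i v, Ψ (ι k i ⊗ₜ v) = R.scale q (τ i) v ⊗ₜ ι k i)
    (hτ : ∀ i j, R.pairing (τ i) (R.root j) = R.pairing (τ j) (R.root i))
    (hΦ : ∀ i v, Φ (ι k i ⊗ₜ v) = R.scale q (σ i) v ⊗ₜ ι k i) (hσ : ∀ i, τ i + σ i = 0)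
    (v : FreeAlgebra k I) :
    antipode Ψ (antipode Φ v) = v := by
  induction v using induction_left with
  | one => simp [antipode_one]
  | ι_mul i v h =>
    rw [R.antipode_ι_mul_eq q hΦ, map_neg, R.antipode_mul_ι q hΨ hτ, R.antipode_scale q hΨ, h,
      scale_scale, hσ, scale_zero, neg_neg, AlgHom.id_apply]
  | add v w hv hw => simp only [map_add, hv, hw]
  | smul r v hv => simp only [map_smul, hv]

end Antipode

theorem antipode_antipodeBar (v : FreeAlgebra k I) :
    antipode (R.braidE q) (antipode (R.braidFBar q) v) = v :=
  R.antipode_antipode q (R.braidE_ι_tmul q) R.pairing_kappa_symm (R.braidFBar_ι_tmul q)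
    (fun _ => add_neg_cancel _) v

theorem antipodeBar_antipode (v : FreeAlgebra k I) :
    antipode (R.braidFBar q) (antipode (R.braidE q) v) = v :=
  R.antipode_antipode q (R.braidFBar_ι_tmul q) R.pairing_neg_kappa_symm (R.braidE_ι_tmul q)
    (fun _ => neg_add_cancel _) v

/-- The antipode reverses words, so it exchanges the left and right skew derivations up to a sign
and a K_i^((i·i)/2). -/
theorem leftSkew_antipode (i : I) (v : FreeAlgebra k I) :
    R.leftSkew q i (antipode (R.braidE q) v) =
      -antipode (R.braidE q) (R.scale q (R.kappa i) (R.rightSkew q i v)) := by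
  classical
  induction v using induction_left with
  | one => simp [antipode_one]
  | ι_mul j v h =>
    rw [R.antipode_ι_mul_eq q (R.braidE_ι_tmul q), map_neg, leftSkew_mul_ι, leftSkew_scale_kappa,
      h, rightSkew_ι_mul, map_add, map_add, map_mul, scale_kappa_ι, smul_mul_assoc, smul_mul_assoc,
      map_smul,
      R.antipode_ι_mul_eq q (R.braidE_ι_tmul q)]
    congr 2
    · simp
    · split_ifs with hij
      · subst hij; simp only [R.antipode_scale q (R.braidE_ι_tmul q)]
      · simp
  | add v w hv hw => simp only [map_add, hv, hw, neg_add]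
  | smul r v hv => simp only [map_smul, hv, smul_neg]

theorem rightSkew_antipode (i : I) (v : FreeAlgebra k I) :
    R.rightSkew q i (antipode (R.braidE q) v) =
      -antipode (R.braidE q) (R.scale q (R.kappa i) (R.leftSkew q i v)) := by
  classical
  induction v using induction_left with
  | one => simp [antipode_one]
  | ι_mul j v h =>
    rw [R.antipode_ι_mul_eq q (R.braidE_ι_tmul q), map_neg, rightSkew_mul_ι, rightSkew_scale_kappa,
      h, leftSkew_ι_mul, map_add, map_add, map_smul, map_mul, scale_kappa_ι, smul_mul_assoc,
      smul_mul_assoc, map_smul, map_smul, R.antipode_ι_mul_eq q (R.braidE_ι_tmul q)]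
    congr 2
    · split_ifs with hij
      · subst hij; simp only [R.antipode_scale q (R.braidE_ι_tmul q)]
      · simp
    · simp
  | add v w hv hw => simp only [map_add, hv, hw, neg_add]
  | smul r v hv => simp only [map_smul, hv, smul_neg]

theorem antipodeBar_leftSkew (i : I) (v : FreeAlgebra k I) :
    antipode (R.braidFBar q) (R.leftSkew q i v) =
      -R.scale q (R.kappa i) (R.rightSkew q i (antipode (R.braidFBar q) v)) := by
  have h := R.leftSkew_antipode q i (antipode (R.braidFBar q) v)
  rw [antipode_antipodeBar] at h
  rw [h, map_neg, antipodeBar_antipode]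

theorem antipodeBar_rightSkew (i : I) (v : FreeAlgebra k I) :
    antipode (R.braidFBar q) (R.rightSkew q i v) =
      -R.scale q (R.kappa i) (R.leftSkew q i (antipode (R.braidFBar q) v)) := by
  have h := R.rightSkew_antipode q i (antipode (R.braidFBar q) v)
  rw [antipode_antipodeBar] at h
  rw [h, map_neg, antipodeBar_antipode]

/-- Self-adjointness comes from matching the recursion of S in one argument with its exchange of
skew derivations in the other. It lets S, and then S̄ = S⁻¹, descend to the quotients. -/
theorem freePairing_antipode (c v : FreeAlgebra k I) :
    R.freePairing q c (antipode (R.braidE q) v) = R.freePairing q (antipode (R.braidE q) c) v := by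
  induction v using induction_left generalizing c with
  | one =>
    rw [antipode_one, freePairing_symm, freePairing_one_left, R.freePairing_symm q _ 1,
      freePairing_one_left]
    induction c using induction_left with
    | one => simp [antipode_one]
    | ι_mul i c h => rw [R.antipode_ι_mul_eq q (R.braidE_ι_tmul q)]; simp
    | add v w hv hw => simp only [map_add, hv, hw]
    | smul r v hv => simp only [map_smul, hv]
  | ι_mul i v h =>
    rw [R.antipode_ι_mul_eq q (R.braidE_ι_tmul q), map_neg, freePairing_mul_ι_right,
      freePairing_ι_mul_right, ← freePairing_scale, h, leftSkew_antipode, map_neg,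
      LinearMap.neg_apply, mul_neg]
  | add v w hv hw => simp only [map_add, hv, hw]
  | smul r v hv => simp only [map_smul, hv]

theorem freePairing_antipodeBar (c v : FreeAlgebra k I) :
    R.freePairing q c (antipode (R.braidFBar q) v) =
      R.freePairing q (antipode (R.braidFBar q) c) v := by
  conv_lhs => rw [← R.antipode_antipodeBar q c]
  rw [← freePairing_antipode, antipode_antipodeBar]

/-! ### The radical -/

/-- The radical of the pairing on the free algebra. -/
def radical : Submodule k (FreeAlgebra k I) := LinearMap.ker (R.freePairing q)

/-- Symmetry of the pairing identifies its left and right radicals, so B and C̄ are quotients of one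
free algebra by the same ideal. -/
theorem mem_radical {v : FreeAlgebra k I} :
    v ∈ R.radical q ↔ ∀ c, R.freePairing q c v = 0 := by
  rw [radical, LinearMap.mem_ker, LinearMap.ext_iff]
  simp only [R.freePairing_symm q v, LinearMap.zero_apply]

/-- An element orthogonal to everything is orthogonal to the image of the adjoint. All stability
properties of the radical used below rest on this remark. -/
theorem mem_radical_of_adjoint {T T' : FreeAlgebra k I → FreeAlgebra k I} {r : k}
    (h : ∀ c v, R.freePairing q c (T v) = r * R.freePairing q (T' c) v) {v : FreeAlgebra k I}
    (hv : v ∈ R.radical q) : T v ∈ R.radical q := by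
  rw [mem_radical] at hv ⊢
  intro c
  rw [h, hv, mul_zero]

theorem ι_mul_mem_radical (i : I) {v : FreeAlgebra k I} (hv : v ∈ R.radical q) :
    ι k i * v ∈ R.radical q :=
  R.mem_radical_of_adjoint q (R.freePairing_ι_mul_right q i) hv

theorem mul_ι_mem_radical (i : I) {v : FreeAlgebra k I} (hv : v ∈ R.radical q) :
    v * ι k i ∈ R.radical q :=
  R.mem_radical_of_adjoint q (T := fun v => v * ι k i) (R.freePairing_mul_ι_right q i) hv

theorem scale_mem_radical (μ : Y) {v : FreeAlgebra k I} (hv : v ∈ R.radical q) :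
    R.scale q μ v ∈ R.radical q :=
  R.mem_radical_of_adjoint q (T' := R.scale q μ) (r := 1)
    (fun c v => by rw [freePairing_scale, one_mul]) hv

theorem antipode_mem_radical {v : FreeAlgebra k I} (hv : v ∈ R.radical q) :
    antipode (R.braidE q) v ∈ R.radical q :=
  R.mem_radical_of_adjoint q (r := 1)
    (fun c v => by rw [freePairing_antipode, one_mul]) hv

theorem antipodeBar_mem_radical {v : FreeAlgebra k I} (hv : v ∈ R.radical q) :
    antipode (R.braidFBar q) v ∈ R.radical q :=
  R.mem_radical_of_adjoint q (r := 1)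
    (fun c v => by rw [freePairing_antipodeBar, one_mul]) hv

/-- The adjunction is normalised with (q_i - q_i⁻¹)⁻¹ in front of the derivation; solving it for the
derivation is where q_i ≠ q_i⁻¹ is needed. -/
theorem leftSkew_mem_radical (i : I) (hq : R.qdiff q i ≠ 0) {v : FreeAlgebra k I}
    (hv : v ∈ R.radical q) : R.leftSkew q i v ∈ R.radical q :=
  R.mem_radical_of_adjoint q (T' := fun c => ι k i * c) (r := R.qdiff q i)
    (fun c v => by rw [freePairing_ι_mul_left, mul_inv_cancel_left₀ hq]) hv

theorem rightSkew_mem_radical (i : I) (hq : R.qdiff q i ≠ 0) {v : FreeAlgebra k I}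
    (hv : v ∈ R.radical q) : R.rightSkew q i v ∈ R.radical q :=
  R.mem_radical_of_adjoint q (T' := fun c => c * ι k i) (r := R.qdiff q i)
    (fun c v => by rw [freePairing_mul_ι_left, mul_inv_cancel_left₀ hq]) hv

theorem mul_mem_radical_left (a : FreeAlgebra k I) {v : FreeAlgebra k I}
    (hv : v ∈ R.radical q) : a * v ∈ R.radical q := by
  induction a using induction_left with
  | one => rwa [one_mul]
  | ι_mul i a h => rw [mul_assoc]; exact R.ι_mul_mem_radical q i h
  | add a b ha hb => rw [add_mul]; exact add_mem ha hb
  | smul r a h => rw [smul_mul_assoc]; exact Submodule.smul_mem _ r h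

theorem mul_mem_radical_right (a : FreeAlgebra k I) {v : FreeAlgebra k I}
    (hv : v ∈ R.radical q) : v * a ∈ R.radical q := by
  induction a using induction_left generalizing v with
  | one => rwa [mul_one]
  | ι_mul i a h => rw [← mul_assoc]; exact h (R.mul_ι_mem_radical q i hv)
  | add a b ha hb => rw [mul_add]; exact add_mem (ha hv) (hb hv)
  | smul r a h => rw [mul_smul_comm]; exact Submodule.smul_mem _ r (h hv)

/-- Congruence modulo the radical. -/
def radicalCon : RingCon (FreeAlgebra k I) where
  r a b := a - b ∈ R.radical q
  iseqv :=
    { refl := fun a => by rw [sub_self]; exact zero_mem _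
      symm := fun {a b} h => by rw [← neg_sub]; exact neg_mem h
      trans := fun {a b c} h h' => by rw [← sub_add_sub_cancel a b c]; exact add_mem h h' }
  add' := fun {a b c d} h h' => by rw [add_sub_add_comm]; exact add_mem h h'
  mul' := fun {a b c d} h h' => by
    rw [show a * c - b * d = a * (c - d) + (a - b) * d by noncomm_ring]
    exact add_mem (R.mul_mem_radical_left q a h') (R.mul_mem_radical_right q d h)

theorem relE_iff (a b : FreeAlgebra k I) : R.RelE q a b ↔ a - b ∈ R.radical q := by
  simp only [RelE, mem_radical, map_sub, sub_eq_zero]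

theorem relF_iff (a b : FreeAlgebra k I) : R.RelF q a b ↔ a - b ∈ R.radical q := by
  simp only [RelF, mem_radical, map_sub, sub_eq_zero, R.freePairing_symm q a,
    R.freePairing_symm q b]

theorem toB_eq_iff (a b : FreeAlgebra k I) : R.toB q a = R.toB q b ↔ R.RelE q a b :=
  RingQuot.mkAlgHom_eq_iff_of_ringCon (R.radicalCon q) (R.relE_iff q) a b

theorem toC_eq_iff (a b : FreeAlgebra k I) : R.toC q a = R.toC q b ↔ R.RelF q a b :=
  RingQuot.mkAlgHom_eq_iff_of_ringCon (R.radicalCon q) (R.relF_iff q) a b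

theorem toB_eq_zero_iff (a : FreeAlgebra k I) : R.toB q a = 0 ↔ a ∈ R.radical q := by
  rw [← map_zero (R.toB q), toB_eq_iff, relE_iff, sub_zero]

theorem toC_eq_zero_iff (a : FreeAlgebra k I) : R.toC q a = 0 ↔ a ∈ R.radical q := by
  rw [← map_zero (R.toC q), toC_eq_iff, relF_iff, sub_zero]

theorem toB_surjective : Function.Surjective (R.toB q) := RingQuot.mkAlgHom_surjective k _

theorem toC_surjective : Function.Surjective (R.toC q) := RingQuot.mkAlgHom_surjective k _

end LusztigRootDatum

/-! ### Linear maps and operators induced on B and C̄ -/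

/-- Factor a linear map through a surjective one whose kernel it kills. -/
def LinearMap.factor {k V W Z : Type*} [Field k] [AddCommGroup V] [AddCommGroup W]
    [AddCommGroup Z] [Module k V] [Module k W] [Module k Z] (p : V →ₗ[k] W)
    (hp : Function.Surjective p) (f : V →ₗ[k] Z) (h : ∀ v, p v = 0 → f v = 0) : W →ₗ[k] Z :=
  (LinearMap.ker p).liftQ f h ∘ₗ (p.quotKerEquivOfSurjective hp).symm.toLinearMap

theorem LinearMap.factor_apply {k V W Z : Type*} [Field k] [AddCommGroup V] [AddCommGroup W]
    [AddCommGroup Z] [Module k V] [Module k W] [Module k Z] (p : V →ₗ[k] W)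
    (hp : Function.Surjective p) (f : V →ₗ[k] Z) (h : ∀ v, p v = 0 → f v = 0) (v : V) :
    p.factor hp f h (p v) = f v := by
  have : (p.quotKerEquivOfSurjective hp).symm (p v) = Submodule.Quotient.mk v := by
    rw [LinearEquiv.symm_apply_eq]; rfl
  simp only [LinearMap.factor, LinearMap.comp_apply, LinearEquiv.coe_coe, this]
  rfl

namespace LusztigRootDatum

variable {I X Y : Type*} [AddCommGroup X] [AddCommGroup Y] (R : LusztigRootDatum I X Y)
variable {k : Type*} [Field k] (q : kˣ)

section Factor

variable {Z : Type*} [AddCommGroup Z] [Module k Z]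

/-- The linear map on `B` induced by a linear map that vanishes on the radical. -/
def factorB (f : FreeAlgebra k I →ₗ[k] Z) (h : ∀ v ∈ R.radical q, f v = 0) : R.B q →ₗ[k] Z :=
  (R.toB q).toLinearMap.factor (R.toB_surjective q) f
    fun v hv => h v ((R.toB_eq_zero_iff q v).1 hv)

theorem factorB_toB (f : FreeAlgebra k I →ₗ[k] Z) (h : ∀ v ∈ R.radical q, f v = 0)
    (v : FreeAlgebra k I) : R.factorB q f h (R.toB q v) = f v :=
  LinearMap.factor_apply ..

/-- The linear map on `C̄` induced by a linear map that vanishes on the radical. -/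
def factorC (f : FreeAlgebra k I →ₗ[k] Z) (h : ∀ v ∈ R.radical q, f v = 0) : R.C q →ₗ[k] Z :=
  (R.toC q).toLinearMap.factor (R.toC_surjective q) f
    fun v hv => h v ((R.toC_eq_zero_iff q v).1 hv)

theorem factorC_toC (f : FreeAlgebra k I →ₗ[k] Z) (h : ∀ v ∈ R.radical q, f v = 0)
    (v : FreeAlgebra k I) : R.factorC q f h (R.toC q v) = f v :=
  LinearMap.factor_apply ..

end Factor

/-- The operator induced on `B` by an operator preserving the radical. -/
def descendB (T : FreeAlgebra k I →ₗ[k] FreeAlgebra k I)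
    (hT : ∀ v ∈ R.radical q, T v ∈ R.radical q) : R.B q →ₗ[k] R.B q :=
  R.factorB q ((R.toB q).toLinearMap ∘ₗ T) fun v hv => (R.toB_eq_zero_iff q _).2 (hT v hv)

theorem descendB_toB (T : FreeAlgebra k I →ₗ[k] FreeAlgebra k I)
    (hT : ∀ v ∈ R.radical q, T v ∈ R.radical q) (v : FreeAlgebra k I) :
    R.descendB q T hT (R.toB q v) = R.toB q (T v) :=
  R.factorB_toB ..

/-- The operator induced on `C̄` by an operator preserving the radical. -/
def descendC (T : FreeAlgebra k I →ₗ[k] FreeAlgebra k I)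
    (hT : ∀ v ∈ R.radical q, T v ∈ R.radical q) : R.C q →ₗ[k] R.C q :=
  R.factorC q ((R.toC q).toLinearMap ∘ₗ T) fun v hv => (R.toC_eq_zero_iff q _).2 (hT v hv)

theorem descendC_toC (T : FreeAlgebra k I →ₗ[k] FreeAlgebra k I)
    (hT : ∀ v ∈ R.radical q, T v ∈ R.radical q) (v : FreeAlgebra k I) :
    R.descendC q T hT (R.toC q v) = R.toC q (T v) :=
  R.factorC_toC ..

end LusztigRootDatum

/-! ### Separation of points on tensor products -/

section Tensor

variable {k V W : Type*} [Field k] [AddCommGroup V] [AddCommGroup W] [Module k V] [Module k W]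

theorem TensorProduct.apply_rid_lTensor (f : V →ₗ[k] k) (g : W →ₗ[k] k) (t : V ⊗[k] W) :
    f (TensorProduct.rid k V (g.lTensor V t)) =
      g (TensorProduct.lid k W (f.rTensor W t)) := by
  induction t using TensorProduct.induction_on with
  | zero => simp
  | tmul a b => simp [mul_comm]
  | add s t hs ht => simp only [map_add, hs, ht]

theorem TensorProduct.apply_lid_rTensor (f : V →ₗ[k] k) (g : W →ₗ[k] k) (t : V ⊗[k] W) :
    g (TensorProduct.lid k W (f.rTensor W t)) =
      LinearMap.mul' k k (TensorProduct.map f g t) := by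
  induction t using TensorProduct.induction_on with
  | zero => simp
  | tmul a b => simp
  | add s t hs ht => simp only [map_add, hs, ht]

/-- Products of functionals from two families that separate points separate points of the tensor
product. -/
theorem TensorProduct.eq_zero_of_separating {α β : Type*} {f : α → V →ₗ[k] k}
    {g : β → W →ₗ[k] k} (hf : ∀ v, (∀ a, f a v = 0) → v = 0)
    (hg : ∀ w, (∀ b, g b w = 0) → w = 0) (t : V ⊗[k] W)
    (h : ∀ a b, LinearMap.mul' k k (TensorProduct.map (f a) (g b) t) = 0) : t = 0 := by
  classical
  -- W may be infinite-dimensional, so a basis of W alone is used: each coordinate of `t` lies in V,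
  -- where the first family detects it, and exchanging the two contractions lets the second family
  -- act.
  let b := Module.Basis.ofVectorSpace k W
  apply (TensorProduct.equivFinsuppOfBasisRight b).injective
  rw [map_zero]
  ext m
  rw [TensorProduct.equivFinsuppOfBasisRight_apply, Finsupp.zero_apply]
  apply hf
  intro a
  have h0 : TensorProduct.lid k W ((f a).rTensor W t) = 0 :=
    hg _ fun c => by rw [TensorProduct.apply_lid_rTensor, h]
  rw [TensorProduct.apply_rid_lTensor, h0, map_zero]

end Tensor

namespace LusztigRootDatum

variable {I X Y : Type*} [AddCommGroup X] [AddCommGroup Y] (R : LusztigRootDatum I X Y)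
variable {k : Type*} [Field k] (q : kˣ)

/-! ### The induced pairing and coproduct -/

theorem freePairing_eq_zero : ∀ c ∈ R.radical q, R.freePairing q c = 0 := fun _ h => h

/-- The pairing between `C̄` and `B`. -/
def pairingCB : R.C q →ₗ[k] R.B q →ₗ[k] k :=
  (R.factorB q (R.factorC q (R.freePairing q) (R.freePairing_eq_zero q)).flip fun v hv => by
    ext c
    obtain ⟨c, rfl⟩ := R.toC_surjective q c
    rw [LinearMap.flip_apply, factorC_toC, LinearMap.zero_apply, (R.mem_radical q).1 hv]).flip

@[simp]
theorem pairingCB_apply (c v : FreeAlgebra k I) :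
    R.pairingCB q (R.toC q c) (R.toB q v) = R.freePairing q c v := by
  rw [pairingCB, LinearMap.flip_apply, factorB_toB, LinearMap.flip_apply, factorC_toC]

theorem pairingCB_left (c : R.C q) (h : ∀ v, R.pairingCB q c (R.toB q v) = 0) : c = 0 := by
  obtain ⟨c, rfl⟩ := R.toC_surjective q c
  rw [toC_eq_zero_iff, mem_radical]
  intro v
  rw [freePairing_symm, ← pairingCB_apply, h]

theorem pairingCB_right (v : R.B q) (h : ∀ c, R.pairingCB q (R.toC q c) v = 0) : v = 0 := by
  obtain ⟨v, rfl⟩ := R.toB_surjective q v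
  rw [toB_eq_zero_iff, mem_radical]
  intro c
  rw [← pairingCB_apply, h]

theorem pairingCB_nondegenerate : (R.pairingCB q).Nondegenerate :=
  ⟨fun c h => R.pairingCB_left q c fun _ => h _, fun v h => R.pairingCB_right q v fun _ => h _⟩

/-- The functional ⟨c, -⟩ ⊗ ⟨d, -⟩ takes the value ⟨c d, v⟩ = 0 on Δv, and such functionals separate
the points of B ⊗ B. Thus the coproduct descends to B. -/
theorem map_toB_coproduct_eq_zero {v : FreeAlgebra k I} (hv : v ∈ R.radical q) :
    TensorProduct.map (R.toB q).toLinearMap (R.toB q).toLinearMap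
      (coproduct (R.braidE q) v) = 0 := by
  refine TensorProduct.eq_zero_of_separating (f := fun c => R.pairingCB q (R.toC q c))
    (g := fun c => R.pairingCB q (R.toC q c)) (R.pairingCB_right q) (R.pairingCB_right q) _ ?_
  intro c d
  rw [← (R.mem_radical q).1 hv (c * d), freePairing_mul_left, tensorPairing,
    LinearMap.comp_apply, ← LinearMap.comp_apply (TensorProduct.map _ _), ← TensorProduct.map_comp]
  congr 3 <;> ext <;> simp

/-- A linear map on the tensor square vanishes on coproducts of elements of the radical if it
vanishes as soon as one factor belongs to the radical. -/
theorem apply_coproduct_eq_zero {Z : Type*} [AddCommGroup Z] [Module k Z]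
    (β : FreeAlgebra k I →ₗ[k] FreeAlgebra k I →ₗ[k] Z)
    (h₁ : ∀ v ∈ R.radical q, ∀ w, β v w = 0) (h₂ : ∀ v, ∀ w ∈ R.radical q, β v w = 0)
    {v : FreeAlgebra k I} (hv : v ∈ R.radical q) :
    TensorProduct.lift β (coproduct (R.braidE q) v) = 0 := by
  let β₁ : R.B q →ₗ[k] FreeAlgebra k I →ₗ[k] Z := R.factorB q β fun v hv =>
    LinearMap.ext fun w => h₁ v hv w
  have hβ₁ (v w) : β₁ (R.toB q v) w = β v w := LinearMap.congr_fun (R.factorB_toB q _ _ v) w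
  let β₂ : R.B q →ₗ[k] R.B q →ₗ[k] Z := R.factorB q β₁.flip fun w hw => by
    ext v
    obtain ⟨v, rfl⟩ := R.toB_surjective q v
    exact (hβ₁ v w).trans (h₂ v w hw)
  have hβ₂ (v w) : β₂ (R.toB q w) (R.toB q v) = β v w :=
    (LinearMap.congr_fun (R.factorB_toB q _ _ w) _).trans (hβ₁ v w)
  have hβ : TensorProduct.lift β = TensorProduct.lift β₂.flip ∘ₗ
      TensorProduct.map (R.toB q).toLinearMap (R.toB q).toLinearMap :=
    TensorProduct.ext' fun v w => (hβ₂ v w).symm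
  rw [hβ, LinearMap.comp_apply, R.map_toB_coproduct_eq_zero q hv, map_zero]

/-! ### The grading -/

/-- The component of degree `α ∈ ℤ[I]`. -/
def component (k : Type*) [Field k] (α : I →₀ ℤ) : FreeAlgebra k I →ₗ[k] FreeAlgebra k I :=
  (TensorProduct.lid k _).toLinearMap ∘ₗ
    ((AddMonoidAlgebra.basis (I →₀ ℤ) k).coord α).rTensor _ ∘ₗ (coaction k I).toLinearMap

theorem component_one (α : I →₀ ℤ) : ∃ r : k, component k α (1 : FreeAlgebra k I) = r • 1 := by
  refine ⟨(AddMonoidAlgebra.basis (I →₀ ℤ) k).coord α 1, ?_⟩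
  simp only [component, LinearMap.comp_apply, AlgHom.toLinearMap_apply, map_one,
    Algebra.TensorProduct.one_def, LinearMap.rTensor_tmul, LinearEquiv.coe_coe,
    TensorProduct.lid_tmul]

theorem component_ι_mul (α : I →₀ ℤ) (i : I) (v : FreeAlgebra k I) :
    component k α (ι k i * v) = ι k i * component k (α - Finsupp.single i 1) v := by
  simp only [component, LinearMap.comp_apply, AlgHom.toLinearMap_apply, coaction_ι_mul]
  induction coaction k I v using TensorProduct.induction_on with
  | zero => simp
  | tmul a w =>
    simp [AddMonoidAlgebra.basis, AddMonoidAlgebra.coeffLinearEquiv, sub_eq_neg_add]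
  | add s t hs ht => simp only [mul_add, map_add, hs, ht]

theorem leftSkew_component (i : I) (α : I →₀ ℤ) (v : FreeAlgebra k I) :
    R.leftSkew q i (component k α v) =
      component k (α - Finsupp.single i 1) (R.leftSkew q i v) := by
  classical
  induction v using induction_left generalizing α with
  | one => obtain ⟨r, hr⟩ := component_one (k := k) α; simp [hr]
  | ι_mul j v h =>
    rw [component_ι_mul, leftSkew_ι_mul, leftSkew_ι_mul, h, map_add, map_smul, component_ι_mul,
      sub_right_comm]
    congr 1
    split_ifs with hij
    · rw [hij]
    · simp
  | add v w hv hw => simp only [map_add, hv, hw]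
  | smul r v hv => simp only [map_smul, hv]

/-- Different degrees are orthogonal because each skew derivation lowers the degree by one letter.
Projections to components are then self-adjoint, which makes the radical homogeneous. -/
theorem freePairing_component (α : I →₀ ℤ) (c v : FreeAlgebra k I) :
    R.freePairing q c (component k α v) = R.freePairing q (component k α c) v := by
  induction c using induction_left generalizing α v with
  | one =>
    obtain ⟨r, hr⟩ := component_one (k := k) (I := I) α
    rw [hr, map_smul, LinearMap.smul_apply, freePairing_one_left, freePairing_one_left]
    induction v using induction_left with
    | one => simp [hr]
    | ι_mul i v h => simp [component_ι_mul]
    | add v w hv hw => simp only [map_add, hv, hw, smul_add]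
    | smul r v hv => simp only [map_smul, hv]; exact smul_comm ..
  | ι_mul i c h =>
    rw [freePairing_ι_mul_left, leftSkew_component, h, component_ι_mul, freePairing_ι_mul_left]
  | add v w hv hw => simp only [map_add, LinearMap.add_apply, hv, hw]
  | smul r v hv => simp only [map_smul, LinearMap.smul_apply, hv]

theorem component_mem_radical (α : I →₀ ℤ) {v : FreeAlgebra k I} (hv : v ∈ R.radical q) :
    component k α v ∈ R.radical q :=
  R.mem_radical_of_adjoint q (r := 1) (fun c v => by rw [freePairing_component, one_mul]) hv

theorem lTensor_toB_coaction_eq_zero {v : FreeAlgebra k I} (hv : v ∈ R.radical q) :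
    (R.toB q).toLinearMap.lTensor _ (coaction k I v) = 0 := by
  classical
  apply (TensorProduct.equivFinsuppOfBasisLeft (AddMonoidAlgebra.basis (I →₀ ℤ) k)).injective
  rw [map_zero]
  ext α
  rw [TensorProduct.equivFinsuppOfBasisLeft_apply, Finsupp.zero_apply,
    ← (R.toB_eq_zero_iff q _).2 (R.component_mem_radical q α hv)]
  simp only [component, LinearMap.comp_apply, AlgHom.toLinearMap_apply]
  induction coaction k I v using TensorProduct.induction_on with
  | zero => simp
  | tmul a w => simp
  | add s t hs ht => simp only [map_add, hs, ht]

/-- The radical is homogeneous, in the form of a statement about its coaction. -/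
theorem apply_coaction_eq_zero {Z : Type*} [AddCommGroup Z] [Module k Z]
    (β : AddMonoidAlgebra k (I →₀ ℤ) →ₗ[k] FreeAlgebra k I →ₗ[k] Z)
    (h : ∀ a, ∀ v ∈ R.radical q, β a v = 0) {v : FreeAlgebra k I} (hv : v ∈ R.radical q) :
    TensorProduct.lift β (coaction k I v) = 0 := by
  let β' : R.B q →ₗ[k] AddMonoidAlgebra k (I →₀ ℤ) →ₗ[k] Z := R.factorB q β.flip fun v hv =>
    LinearMap.ext fun a => h a v hv
  have hβ' (a v) : β' (R.toB q v) a = β a v := LinearMap.congr_fun (R.factorB_toB q _ _ v) a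
  have hβ : TensorProduct.lift β =
      TensorProduct.lift β'.flip ∘ₗ (R.toB q).toLinearMap.lTensor _ :=
    TensorProduct.ext' fun a v => (hβ' a v).symm
  rw [hβ, LinearMap.comp_apply, R.lTensor_toB_coaction_eq_zero q hv, map_zero]

/-! ### Algebra maps that vanish on the radical -/

section Lift

variable {W : Type*} [Ring W] [Algebra k W]

/-- Moving `y` past a word letter by letter collects q^(i·j) for every letter j, which is how
K_i^((i·i)/2) scales that word. -/
theorem lift_mul_lift_scale {x : I → W} {y : W} {i : I}
    (h : ∀ j, y * x j = R.chi q i j • (x j * y)) (v : FreeAlgebra k I) :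
    y * FreeAlgebra.lift k x v = FreeAlgebra.lift k x (R.scale q (R.kappa i) v) * y := by
  induction v using induction_left with
  | one => simp
  | ι_mul j v hv =>
    rw [map_mul, map_mul, map_mul, scale_kappa_ι, map_smul, FreeAlgebra.lift_ι_apply, ← mul_assoc,
      h, smul_mul_assoc, smul_mul_assoc, smul_mul_assoc, mul_assoc, hv, mul_assoc]
  | add v w hv hw => simp only [map_add, mul_add, add_mul, hv, hw]
  | smul r v hv => simp only [map_smul, mul_smul_comm, smul_mul_assoc, hv]

/-- A q-binomial theorem: under `h` the product map from the braided tensor square to `W` respects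
left multiplication by primitive elements, so both sides satisfy the same recursion. No closed
expansion of the coproduct is required. -/
theorem lift_add_eq {x y : I → W} (h : ∀ i j, y i * x j = R.chi q i j • (x j * y i))
    (v : FreeAlgebra k I) :
    FreeAlgebra.lift k (fun i => x i + y i) v =
      LinearMap.mul' k W (TensorProduct.map (FreeAlgebra.lift k x).toLinearMap
        (FreeAlgebra.lift k y).toLinearMap (coproduct (R.braidE q) v)) :=
  (LinearMap.congr_fun (R.comp_coproduct_ext q
    (LinearMap.mul' k W ∘ₗ TensorProduct.map (FreeAlgebra.lift k x).toLinearMap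
      (FreeAlgebra.lift k y).toLinearMap) (FreeAlgebra.lift k (fun i => x i + y i)).toLinearMap
    (fun i => LinearMap.mulLeft k (x i + y i)) (by simp)
    (fun i v w => by
      simp only [map_add, LinearMap.comp_apply, TensorProduct.map_tmul, LinearMap.mul'_apply,
        AlgHom.toLinearMap_apply, map_mul, FreeAlgebra.lift_ι_apply, LinearMap.mulLeft_apply,
        add_mul, ← mul_assoc, R.lift_mul_lift_scale q (h i)])
    (fun i v => by simp)) v).symm

/-- Every term of the coproduct of a radical element can be taken modulo the radical in either leg,
and each leg is killed by its own map. The relations of B thus pass to sums of q-commuting families.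
-/
theorem lift_add_eq_zero {x y : I → W} (h : ∀ i j, y i * x j = R.chi q i j • (x j * y i))
    (hx : ∀ v ∈ R.radical q, FreeAlgebra.lift k x v = 0)
    (hy : ∀ v ∈ R.radical q, FreeAlgebra.lift k y v = 0) {v : FreeAlgebra k I}
    (hv : v ∈ R.radical q) : FreeAlgebra.lift k (fun i => x i + y i) v = 0 := by
  rw [R.lift_add_eq q h]
  have := R.apply_coproduct_eq_zero q ((LinearMap.mul k W).compl₁₂
    (FreeAlgebra.lift k x).toLinearMap (FreeAlgebra.lift k y).toLinearMap)
    (fun v hv w => by simp [hx v hv]) (fun v w hw => by simp [hy w hw]) hv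
  rw [← this]
  induction coproduct (R.braidE q) v using TensorProduct.induction_on with
  | zero => simp
  | tmul a b => simp
  | add s t hs ht => simp only [map_add, hs, ht]

/-- The commuting factors collect into `G` of the degree, so the map is the product of `G` and `lift
x` along the coaction, and homogeneity of the radical applies. -/
theorem lift_mul_eq_zero {x : I → W} (G : AddMonoidAlgebra k (I →₀ ℤ) →ₐ[k] W)
    (h : ∀ i a, Commute (G a) (x i))
    (hx : ∀ v ∈ R.radical q, FreeAlgebra.lift k x v = 0) {v : FreeAlgebra k I}
    (hv : v ∈ R.radical q) :
    FreeAlgebra.lift k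
      (fun i => G (AddMonoidAlgebra.single (Finsupp.single i 1) 1) * x i) v = 0 := by
  have h0 := R.apply_coaction_eq_zero q ((LinearMap.mul k W).compl₁₂ G.toLinearMap
    (FreeAlgebra.lift k x).toLinearMap) (fun a v hv => by simp [hx v hv]) hv
  refine Eq.trans ?_ h0
  -- The remaining identity holds for every `v`, not only in the radical, and must be freed of those
  -- hypotheses before the induction.
  clear h0 hv hx
  induction v using induction_left with
  | one => simp [Algebra.TensorProduct.one_def]
  | ι_mul i v hv =>
    rw [map_mul, hv, coaction_ι_mul, FreeAlgebra.lift_ι_apply]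
    induction coaction k I v using TensorProduct.induction_on with
    | zero => simp
    | tmul a w =>
      simp only [TensorProduct.lift.tmul, LinearMap.compl₁₂_apply, AlgHom.toLinearMap_apply,
        LinearMap.mul_apply', Algebra.TensorProduct.tmul_mul_tmul, map_mul,
        FreeAlgebra.lift_ι_apply, mul_assoc]
      rw [← mul_assoc (x i), ← (h i a).eq, mul_assoc]
    | add s t hs ht => simp only [map_add, mul_add, hs, ht]
  | add v w hv hw => simp only [map_add, hv, hw]
  | smul r v hv => simp only [map_smul, hv]

end Lift

end LusztigRootDatum

namespace LusztigRootDatum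

variable {I X Y : Type*} [AddCommGroup X] [AddCommGroup Y] (R : LusztigRootDatum I X Y)
variable {k : Type*} [Field k] (q : kˣ)

/-! ### The algebra `U` -/

section U

variable {W : Type*} [Ring W] [Algebra k W]

/-- Elements `e'`, `f'`, `K'` of an algebra satisfying the defining relations of `U`. -/
structure SatisfiesURel (e' f' : I → W) (K' : Y → W) : Prop where
  K_zero : K' 0 = 1
  K_add : ∀ μ ν, K' (μ + ν) = K' μ * K' ν
  e_K : ∀ i μ, e' i * K' μ = ((q ^ R.pairing μ (R.root i) : kˣ) : k) • (K' μ * e' i)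
  K_f : ∀ i μ, K' μ * f' i = ((q ^ R.pairing μ (R.root i) : kˣ) : k) • (f' i * K' μ)
  e_f_same : ∀ i, e' i * f' i - f' i * e' i =
    (R.qdiff q i)⁻¹ • (K' (R.kappa i) - K' (-R.kappa i))
  e_f_ne : ∀ i j, i ≠ j → e' i * f' j = f' j * e' i
  e_rad : ∀ v ∈ R.radical q, FreeAlgebra.lift k e' v = 0
  f_rad : ∀ v ∈ R.radical q, FreeAlgebra.lift k f' v = 0

/-- The values on generators of a map out of `U`. -/
def genMap (e' f' : I → W) (K' : Y → W) : Gen I Y → W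
  | .e i => e' i
  | .f i => f' i
  | .K μ => K' μ

theorem lift_lift_ι {J : Type*} (x : J → W) (g : I → J) (v : FreeAlgebra k I) :
    FreeAlgebra.lift k x (FreeAlgebra.lift k (fun i => ι k (g i)) v) =
      FreeAlgebra.lift k (fun i => x (g i)) v := by
  rw [← AlgHom.comp_apply]
  congr 1
  ext i
  simp

variable {R q}

theorem SatisfiesURel.lift_eq {e' f' : I → W} {K' : Y → W} (h : R.SatisfiesURel q e' f' K')
    {a b : FreeAlgebra k (Gen I Y)} (hab : R.URel q a b) :
    FreeAlgebra.lift k (genMap e' f' K') a = FreeAlgebra.lift k (genMap e' f' K') b := by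
  cases hab with
  | K_zero => simpa [genMap] using h.K_zero
  | K_add μ ν => simpa [genMap] using h.K_add μ ν
  | e_K i μ => simpa [genMap] using h.e_K i μ
  | K_f i μ => simpa [genMap] using h.K_f i μ
  | e_f_same i => simpa [genMap] using h.e_f_same i
  | e_f_ne i j hij => simpa [genMap] using h.e_f_ne i j hij
  | e_rad a b hab =>
    rw [lift_lift_ι, lift_lift_ι, ← sub_eq_zero, ← map_sub]
    exact h.e_rad _ ((R.relE_iff q a b).1 hab)
  | f_rad a b hab =>
    rw [lift_lift_ι, lift_lift_ι, ← sub_eq_zero, ← map_sub]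
    exact h.f_rad _ ((R.relF_iff q a b).1 hab)

/-- The algebra map out of `U` given by elements satisfying its defining relations. -/
def SatisfiesURel.liftU {e' f' : I → W} {K' : Y → W} (h : R.SatisfiesURel q e' f' K') :
    R.U q →ₐ[k] W :=
  RingQuot.liftAlgHom k ⟨FreeAlgebra.lift k (genMap e' f' K'), fun _ _ => h.lift_eq⟩

section

variable {e' f' : I → W} {K' : Y → W} (h : R.SatisfiesURel q e' f' K')

@[simp]
theorem SatisfiesURel.liftU_e (i : I) : h.liftU (R.e q i) = e' i := by
  rw [liftU, e, RingQuot.liftAlgHom_mkAlgHom_apply]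
  exact FreeAlgebra.lift_ι_apply _ _

@[simp]
theorem SatisfiesURel.liftU_f (i : I) : h.liftU (R.f q i) = f' i := by
  rw [liftU, f, RingQuot.liftAlgHom_mkAlgHom_apply]
  exact FreeAlgebra.lift_ι_apply _ _

@[simp]
theorem SatisfiesURel.liftU_K (μ : Y) : h.liftU (R.K q μ) = K' μ := by
  rw [liftU, K, RingQuot.liftAlgHom_mkAlgHom_apply]
  exact FreeAlgebra.lift_ι_apply _ _

end

variable (R q)

theorem U_algHom_ext {f g : R.U q →ₐ[k] W} (he : ∀ i, f (R.e q i) = g (R.e q i))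
    (hf : ∀ i, f (R.f q i) = g (R.f q i)) (hK : ∀ μ, f (R.K q μ) = g (R.K q μ)) : f = g := by
  apply RingQuot.ringQuot_ext'
  apply FreeAlgebra.hom_ext
  funext x
  cases x with
  | e i => exact he i
  | f i => exact hf i
  | K μ => exact hK μ

theorem U_induction_left {p : R.U q → Prop} (one : p 1) (e_mul : ∀ i u, p u → p (R.e q i * u))
    (f_mul : ∀ i u, p u → p (R.f q i * u)) (K_mul : ∀ μ u, p u → p (R.K q μ * u))
    (add : ∀ u v, p u → p v → p (u + v)) (smul : ∀ (r : k) u, p u → p (r • u)) (u : R.U q) :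
    p u := by
  obtain ⟨w, rfl⟩ := RingQuot.mkAlgHom_surjective k (R.URel q) u
  induction w using induction_left with
  | one => rwa [map_one]
  | ι_mul x w h =>
    rw [map_mul]
    cases x with
    | e i => exact e_mul i _ h
    | f i => exact f_mul i _ h
    | K μ => exact K_mul μ _ h
  | add v w hv hw => rw [map_add]; exact add _ _ hv hw
  | smul r v hv => rw [map_smul]; exact smul r _ hv

theorem U_induction_mul {p : R.U q → Prop} (one : p 1) (he : ∀ i, p (R.e q i))
    (hf : ∀ i, p (R.f q i)) (hK : ∀ μ, p (R.K q μ)) (mul : ∀ u v, p u → p v → p (u * v))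
    (add : ∀ u v, p u → p v → p (u + v)) (smul : ∀ (r : k) u, p u → p (r • u)) (u : R.U q) :
    p u :=
  R.U_induction_left q one (fun i _ => mul _ _ (he i)) (fun i _ => mul _ _ (hf i))
    (fun μ _ => mul _ _ (hK μ)) add smul u

@[simp]
theorem inclB_ι (i : I) : R.inclB q (R.toB q (ι k i)) = R.e q i :=
  (RingQuot.liftAlgHom_mkAlgHom_apply ..).trans
    (congrArg _ (FreeAlgebra.lift_ι_apply _ _))

@[simp]
theorem inclC_ι (i : I) : R.inclC q (R.toC q (ι k i)) = R.f q i :=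
  (RingQuot.liftAlgHom_mkAlgHom_apply ..).trans
    (congrArg _ (FreeAlgebra.lift_ι_apply _ _))

theorem lift_e (v : FreeAlgebra k I) :
    FreeAlgebra.lift k (R.e q) v = R.inclB q (R.toB q v) := by
  rw [← AlgHom.comp_apply]
  congr 1
  ext i
  simp

theorem lift_f (v : FreeAlgebra k I) :
    FreeAlgebra.lift k (R.f q) v = R.inclC q (R.toC q v) := by
  rw [← AlgHom.comp_apply]
  congr 1
  ext i
  simp

/-- The generators of `U` satisfy its defining relations. -/
theorem satisfiesURel : R.SatisfiesURel q (R.e q) (R.f q) (R.K q) where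
  K_zero := (RingQuot.mkAlgHom_rel k (URel.K_zero (R := R) (q := q))).trans (map_one _)
  K_add μ ν := (RingQuot.mkAlgHom_rel k (URel.K_add (R := R) (q := q) μ ν)).trans (map_mul ..)
  e_K i μ := by
    have := RingQuot.mkAlgHom_rel k (URel.e_K (R := R) (q := q) i μ)
    rw [map_mul, map_smul, map_mul] at this
    exact this
  K_f i μ := by
    have := RingQuot.mkAlgHom_rel k (URel.K_f (R := R) (q := q) i μ)
    rw [map_mul, map_smul, map_mul] at this
    exact this
  e_f_same i := by
    have := RingQuot.mkAlgHom_rel k (URel.e_f_same (R := R) (q := q) i)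
    rw [map_sub, map_mul, map_mul, map_smul, map_sub] at this
    exact this
  e_f_ne i j hij := by
    have := RingQuot.mkAlgHom_rel k (URel.e_f_ne (R := R) (q := q) i j hij)
    rw [map_mul, map_mul] at this
    exact this
  e_rad v hv := by rw [lift_e, (R.toB_eq_zero_iff q v).2 hv, map_zero]
  f_rad v hv := by rw [lift_f, (R.toC_eq_zero_iff q v).2 hv, map_zero]

end U

/-! ### The operators of the fundamental representation on the free algebra -/

/-- The right action of `e^i`. -/
def opE (i : I) : Module.End k (FreeAlgebra k I) :=
  LinearMap.mulRight k (ι k i) - LinearMap.mulLeft k (ι k i) ∘ₗ (R.scale q (R.kappa i)).toLinearMap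

/-- The right action of `f_i`. -/
def opF (i : I) : Module.End k (FreeAlgebra k I) :=
  -((R.qdiff q i)⁻¹ • (R.scale q (-R.kappa i)).toLinearMap ∘ₗ R.rightSkew q i)

theorem opE_apply (i : I) (v : FreeAlgebra k I) :
    R.opE q i v = v * ι k i - ι k i * R.scale q (R.kappa i) v := by
  simp [opE]

theorem opF_apply (i : I) (v : FreeAlgebra k I) :
    R.opF q i v = -((R.qdiff q i)⁻¹ • R.scale q (-R.kappa i) (R.rightSkew q i v)) := by
  simp [opF]

theorem opE_mem_radical (i : I) {v : FreeAlgebra k I} (hv : v ∈ R.radical q) :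
    R.opE q i v ∈ R.radical q := by
  rw [opE_apply]
  exact sub_mem (R.mul_ι_mem_radical q i hv)
    (R.ι_mul_mem_radical q i (R.scale_mem_radical q _ hv))

theorem opF_mem_radical (i : I) (hq : R.qdiff q i ≠ 0) {v : FreeAlgebra k I}
    (hv : v ∈ R.radical q) : R.opF q i v ∈ R.radical q := by
  rw [opF_apply]
  exact neg_mem (Submodule.smul_mem _ _
    (R.scale_mem_radical q _ (R.rightSkew_mem_radical q i hq hv)))

theorem opE_scale (i : I) (μ : Y) (v : FreeAlgebra k I) :
    R.scale q μ (R.opE q i v) =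
      ((q ^ R.pairing μ (R.root i) : kˣ) : k) • R.opE q i (R.scale q μ v) := by
  rw [opE_apply, opE_apply, map_sub, map_mul, map_mul, scale_ι, mul_smul_comm, smul_mul_assoc,
    R.scale_comm q μ, smul_sub]

theorem opF_scale (i : I) (μ : Y) (v : FreeAlgebra k I) :
    R.opF q i (R.scale q μ v) =
      ((q ^ R.pairing μ (R.root i) : kˣ) : k) • R.scale q μ (R.opF q i v) := by
  classical
  rw [opF_apply, opF_apply, rightSkew_scale, map_smul, map_neg, map_smul, R.scale_comm q μ,
    smul_neg, smul_comm]

/-- The inverse scaling built into the operator cancels the scaling of the second factor in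
`rightSkew_mul`. What remains is the coproduct of f_i acting on a product. -/
theorem opF_mul (i : I) (v w : FreeAlgebra k I) :
    R.opF q i (v * w) =
      R.opF q i v * w + R.scale q (-R.kappa i) v * R.opF q i w := by
  classical
  simp only [opF_apply, rightSkew_mul, map_add, map_mul, scale_neg_scale, smul_add, neg_add,
    neg_mul, smul_mul_assoc, mul_neg, mul_smul_comm]
  exact add_comm _ _

theorem opF_ι [DecidableEq I] (i j : I) :
    R.opF q i (ι k j) = -((R.qdiff q i)⁻¹ • if i = j then 1 else 0) := by
  rw [opF_apply, rightSkew_ι]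
  split_ifs <;> simp

/-- By the Leibniz rule the terms in which the derivation hits `v` cancel, the two braiding scalars
being inverse to each other. Only the derivative of e^i itself survives. The order of composition is
that of a right action. -/
theorem opF_opE [DecidableEq I] (i j : I) (v : FreeAlgebra k I) :
    R.opF q j (R.opE q i v) - R.opE q i (R.opF q j v) =
      if i = j then (R.qdiff q i)⁻¹ •
        (R.scale q (R.kappa i) v - R.scale q (-R.kappa i) v) else 0 := by
  rw [opE_apply, map_sub, opF_mul, opF_mul, opF_scale, opE_apply, pairing_kappa_root, opF_ι,
    scale_neg_kappa_ι, R.chi_symm q j i]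
  have h : (R.chi q i j)⁻¹ • ι k i * ((q ^ R.form i j : kˣ) : k) •
      R.scale q (R.kappa i) (R.opF q j v) = ι k i * R.scale q (R.kappa i) (R.opF q j v) := by
    rw [smul_mul_smul_comm, ← chi, inv_mul_cancel₀ (R.chi_ne_zero q i j), one_smul]
  rw [h]
  by_cases hij : i = j
  · subst hij
    simp only [if_true, mul_neg, neg_mul, mul_smul_comm, smul_mul_assoc, mul_one, one_mul,
      smul_sub]
    abel
  · simp [hij, Ne.symm hij]

/-! ### The braided adjoint action -/

theorem twist_tmul_scale {θ : AddMonoidAlgebra k (I →₀ ℤ) →ₐ[k] AddMonoidAlgebra k Y}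
    {τ : I → Y} (hθ : ∀ i, θ (AddMonoidAlgebra.single (Finsupp.single i 1) 1) =
      AddMonoidAlgebra.single (τ i) 1) (μ : Y) (v w : FreeAlgebra k I) :
    R.twist q θ (v ⊗ₜ R.scale q μ w) =
      (R.scale q μ).toLinearMap.lTensor _ (R.twist q θ (v ⊗ₜ w)) := by
  induction w using induction_left generalizing v with
  | one => rw [map_one, twist_tmul_one]; simp
  | ι_mul i w h =>
    rw [map_mul, scale_ι, smul_mul_assoc, TensorProduct.tmul_smul, map_smul,
      R.twist_tmul_ι_mul q hθ, R.twist_tmul_ι_mul q hθ, h]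
    induction R.twist q θ (R.scale q (τ i) v ⊗ₜ w) using TensorProduct.induction_on with
    | zero => simp
    | tmul a b => simp [← TensorProduct.tmul_smul]
    | add s t hs ht => simp only [map_add, smul_add, hs, ht]
  | add v w hv hw => simp only [map_add, TensorProduct.tmul_add, hv, hw]
  | smul r v hv => simp only [map_smul, TensorProduct.tmul_smul, hv]

theorem braidE_tmul (v w : FreeAlgebra k I) :
    R.braidE q (v ⊗ₜ w) = TensorProduct.comm k _ _ (R.twist q (R.rmap k) (v ⊗ₜ w)) := rfl

theorem braidE_tmul_ι_mul (v w : FreeAlgebra k I) (i : I) :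
    R.braidE q (v ⊗ₜ (ι k i * w)) =
      (LinearMap.mulLeft k (ι k i)).rTensor _ (R.braidE q (R.scale q (R.kappa i) v ⊗ₜ w)) := by
  rw [braidE_tmul, R.twist_tmul_ι_mul q R.rmap_single, braidE_tmul]
  induction R.twist q (R.rmap k) (R.scale q (R.kappa i) v ⊗ₜ w) using
    TensorProduct.induction_on with
  | zero => simp
  | tmul a b => simp
  | add s t hs ht => simp only [map_add, hs, ht]

theorem braidE_ι_mul_tmul (v w : FreeAlgebra k I) (i : I) :
    R.braidE q ((ι k i * v) ⊗ₜ w) =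
      TensorProduct.map (R.scale q (R.kappa i)).toLinearMap (LinearMap.mulLeft k (ι k i))
        (R.braidE q (v ⊗ₜ w)) := by
  rw [braidE_tmul, R.twist_ι_mul_tmul q R.rmap_single R.pairing_kappa_symm,
    R.twist_tmul_scale q R.rmap_single, braidE_tmul]
  induction R.twist q (R.rmap k) (v ⊗ₜ w) using TensorProduct.induction_on with
  | zero => simp
  | tmul a b => simp
  | add s t hs ht => simp only [map_add, hs, ht]

/-- The action of `K_μ` on `B`. -/
def scaleB (μ : Y) : R.B q →ₗ[k] R.B q :=
  R.descendB q (R.scale q μ).toLinearMap fun _ => R.scale_mem_radical q μ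

@[simp]
theorem scaleB_toB (μ : Y) (v : FreeAlgebra k I) :
    R.scaleB q μ (R.toB q v) = R.toB q (R.scale q μ v) :=
  R.descendB_toB ..

/-- The bilinear map `(v, b) ↦ (S b⁽²⁾) (v ◁ ℛ(b⁽¹⁾))`. -/
def conj (v : FreeAlgebra k I) : FreeAlgebra k I →ₗ[k] FreeAlgebra k I :=
  LinearMap.mul' k _ ∘ₗ (antipode (R.braidE q)).rTensor _ ∘ₗ R.braidE q ∘ₗ
    TensorProduct.mk k _ _ v

theorem adjointAction_tmul (v b : FreeAlgebra k I) :
    R.adjointAction q (v ⊗ₜ b) =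
      TensorProduct.lift ((LinearMap.mul k (FreeAlgebra k I)).comp (R.conj q v))
        (coproduct (R.braidE q) b) := by
  simp only [adjointAction, LinearMap.comp_apply, LinearMap.lTensor_tmul]
  induction coproduct (R.braidE q) b using TensorProduct.induction_on with
  | zero => simp
  | tmul a b => simp [conj]
  | add s t hs ht => simp only [TensorProduct.tmul_add, map_add, hs, ht]

theorem conj_one (v : FreeAlgebra k I) : R.conj q v 1 = v := by
  simp only [conj, LinearMap.comp_apply, TensorProduct.mk_apply, braidE_tmul, twist_tmul_one]
  simp [antipode_one]

theorem conj_neg (v : FreeAlgebra k I) : R.conj q (-v) = -R.conj q v := by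
  ext b
  simp [conj]

/-- The map `conj` is thereby the right action of the free algebra in which e^i acts by v ↦ -e^i
(K_i^((i·i)/2) v), one of the two halves of the adjoint action. -/
theorem conj_ι_mul (v b : FreeAlgebra k I) (i : I) :
    R.conj q v (ι k i * b) = -R.conj q (ι k i * R.scale q (R.kappa i) v) b := by
  simp only [conj, LinearMap.comp_apply, TensorProduct.mk_apply, braidE_tmul_ι_mul,
    braidE_ι_mul_tmul]
  induction R.braidE q (R.scale q (R.kappa i) v ⊗ₜ b) using TensorProduct.induction_on with
  | zero => simp
  | tmul a b =>
    simp only [LinearMap.rTensor_tmul, LinearMap.mulLeft_apply, TensorProduct.map_tmul,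
      LinearMap.mul'_apply, AlgHom.toLinearMap_apply,
      R.antipode_ι_mul_eq q (R.braidE_ι_tmul q), R.antipode_scale q (R.braidE_ι_tmul q)]
    noncomm_ring
  | add s t hs ht => simp only [map_add, hs, ht, neg_add]

/-- Braiding moves a radical element past `v` only by applying scalings to it, so the left leg stays
in the radical; the antipode and the product then preserve this. -/
theorem conj_mem_radical (v : FreeAlgebra k I) {b : FreeAlgebra k I} (hb : b ∈ R.radical q) :
    R.conj q v b ∈ R.radical q := by
  have h1 : (R.toB q).toLinearMap.rTensor _ (R.braidE q (v ⊗ₜ b)) = 0 := by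
    induction v using induction_left with
    | one =>
      rw [braidE_tmul, R.twist_one_tmul q R.rmap_single, TensorProduct.comm_tmul,
        LinearMap.rTensor_tmul, AlgHom.toLinearMap_apply, (R.toB_eq_zero_iff q b).2 hb,
        TensorProduct.zero_tmul]
    | ι_mul i v h =>
      have h2 : (R.toB q).toLinearMap.rTensor _ (R.braidE q ((ι k i * v) ⊗ₜ b)) =
          TensorProduct.map (R.scaleB q (R.kappa i)) (LinearMap.mulLeft k (ι k i))
            ((R.toB q).toLinearMap.rTensor _ (R.braidE q (v ⊗ₜ b))) := by
        rw [braidE_ι_mul_tmul]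
        induction R.braidE q (v ⊗ₜ b) using TensorProduct.induction_on with
        | zero => simp
        | tmul a b => simp
        | add s t hs ht => simp only [map_add, hs, ht]
      rw [h2, h, map_zero]
    | add v w hv hw => simp only [TensorProduct.add_tmul, map_add, hv, hw, add_zero]
    | smul r v hv => simp only [← TensorProduct.smul_tmul', map_smul, hv, smul_zero]
  let N : R.B q →ₗ[k] FreeAlgebra k I →ₗ[k] R.B q :=
    (LinearMap.mul k (R.B q)).compl₁₂ (R.descendB q (antipode (R.braidE q))
      fun v hv => R.antipode_mem_radical q hv) (R.toB q).toLinearMap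
  have h3 : R.toB q (R.conj q v b) =
      TensorProduct.lift N ((R.toB q).toLinearMap.rTensor _ (R.braidE q (v ⊗ₜ b))) := by
    simp only [conj, LinearMap.comp_apply, TensorProduct.mk_apply]
    induction R.braidE q (v ⊗ₜ b) using TensorProduct.induction_on with
    | zero => simp
    | tmul a b => simp [N, descendB_toB]
    | add s t hs ht => simp only [map_add, hs, ht]
  rw [← toB_eq_zero_iff, h3, h1, map_zero]

theorem adjointAction_mem_radical (v : FreeAlgebra k I) {b : FreeAlgebra k I}
    (hb : b ∈ R.radical q) : R.adjointAction q (v ⊗ₜ b) ∈ R.radical q := by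
  rw [← toB_eq_zero_iff, adjointAction_tmul]
  have := R.apply_coproduct_eq_zero q (((LinearMap.mul k (FreeAlgebra k I)).comp
    (R.conj q v)).compr₂ (R.toB q).toLinearMap)
    (fun a ha b => (R.toB_eq_zero_iff q _).2
      (R.mul_mem_radical_right q b (R.conj_mem_radical q v ha)))
    (fun a b hb => (R.toB_eq_zero_iff q _).2 (R.mul_mem_radical_left q _ hb)) hb
  rw [← this]
  induction coproduct (R.braidE q) b using TensorProduct.induction_on with
  | zero => simp
  | tmul a b => simp
  | add s t hs ht => simp only [map_add, hs, ht]

/-- The operator of e^i is a sum of a twisted left multiplication and a right multiplication. These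
q-commute in the opposite algebra, so `lift_add_eq` splits the action of `b` along its coproduct,
giving the braided adjoint action. -/
theorem lift_opE_unop (b v : FreeAlgebra k I) :
    (FreeAlgebra.lift k (fun i => MulOpposite.op (R.opE q i)) b).unop v =
      R.adjointAction q (v ⊗ₜ b) := by
  let x : I → (Module.End k (FreeAlgebra k I))ᵐᵒᵖ := fun i => MulOpposite.op
    (-(LinearMap.mulLeft k (ι k i) ∘ₗ (R.scale q (R.kappa i)).toLinearMap))
  let y : I → (Module.End k (FreeAlgebra k I))ᵐᵒᵖ := fun i =>
    MulOpposite.op (LinearMap.mulRight k (ι k i))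
  have hxy : (fun i => MulOpposite.op (R.opE q i)) = fun i => x i + y i := by
    funext i
    apply MulOpposite.unop_injective
    simp only [x, y, opE, MulOpposite.unop_op, MulOpposite.unop_add]
    abel
  have hx (b v : FreeAlgebra k I) : (FreeAlgebra.lift k x b).unop v = R.conj q v b := by
    induction b using induction_left generalizing v with
    | one => simp [conj_one]
    | ι_mul i b h =>
      have hv : (x i).unop v = -(ι k i * R.scale q (R.kappa i) v) := by simp [x]
      rw [map_mul, MulOpposite.unop_mul, Module.End.mul_apply, h, conj_ι_mul,
        FreeAlgebra.lift_ι_apply, hv, conj_neg, LinearMap.neg_apply]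
    | add a b ha hb => simp [ha, hb]
    | smul r b hb => simp [hb]
  have hy (b v : FreeAlgebra k I) : (FreeAlgebra.lift k y b).unop v = v * b := by
    induction b using induction_left generalizing v with
    | one => simp
    | ι_mul i b h =>
      rw [map_mul, MulOpposite.unop_mul, Module.End.mul_apply, h, FreeAlgebra.lift_ι_apply,
        ← mul_assoc]
      rfl
    | add a b ha hb => simp [ha, hb, mul_add]
    | smul r b hb => simp [hb]
  rw [hxy, R.lift_add_eq q, adjointAction_tmul]
  · induction coproduct (R.braidE q) b using TensorProduct.induction_on with
    | zero => simp
    | tmul a b => simp [hx, hy]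
    | add s t hs ht => simp only [map_add, MulOpposite.unop_add, LinearMap.add_apply, hs, ht]
  · intro i j
    apply MulOpposite.unop_injective
    ext v
    simp only [x, y, MulOpposite.unop_mul, MulOpposite.unop_smul, MulOpposite.unop_op,
      Module.End.mul_apply, LinearMap.neg_apply, LinearMap.comp_apply, LinearMap.mulRight_apply,
      LinearMap.mulLeft_apply, AlgHom.toLinearMap_apply, LinearMap.smul_apply, map_mul,
      scale_kappa_ι, mul_smul_comm, map_neg, smul_neg, mul_assoc, R.chi_symm q i j]

/-! ### The braided coregular action -/

/-- Stripping a letter i from `w` lowers its degree and removes one factor K_i^(-(i·i)/2) from the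
twist; the scaling of `v` supplies it again. -/
theorem twist_rightSkew (i : I) (v w : FreeAlgebra k I) :
    R.twist q (R.rmapBar k) (R.scale q (-R.kappa i) v ⊗ₜ R.rightSkew q i w) =
      (R.rightSkew q i).lTensor _ (R.twist q (R.rmapBar k) (v ⊗ₜ w)) := by
  classical
  induction w using induction_left generalizing v with
  | one => simp [twist_tmul_one]
  | ι_mul j w h =>
    rw [rightSkew_ι_mul, TensorProduct.tmul_add, map_add, R.twist_tmul_ι_mul q R.rmapBar_single,
      R.twist_tmul_ι_mul q R.rmapBar_single, R.scale_comm q, h]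
    have h2 : R.twist q (R.rmapBar k) (R.scale q (-R.kappa i) v ⊗ₜ
        (if i = j then R.scale q (R.kappa i) w else 0)) = if i = j then
        (R.scale q (R.kappa i)).toLinearMap.lTensor _
          (R.twist q (R.rmapBar k) (R.scale q (-R.kappa j) v ⊗ₜ w)) else 0 := by
      split_ifs with hij
      · rw [R.twist_tmul_scale q R.rmapBar_single, hij]
      · simp
    rw [h2]
    induction R.twist q (R.rmapBar k) (R.scale q (-R.kappa j) v ⊗ₜ w) using
      TensorProduct.induction_on with
    | zero => simp
    | tmul a b =>
      simp only [LinearMap.lTensor_tmul, LinearMap.mulLeft_apply, rightSkew_ι_mul,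
        TensorProduct.tmul_add, AlgHom.toLinearMap_apply]
      split_ifs <;> simp
    | add s t hs ht =>
      simp only [map_add, ← hs, ← ht]
      split_ifs <;> abel
  | add v w hv hw => simp only [map_add, TensorProduct.tmul_add, hv, hw]
  | smul r v hv => simp only [map_smul, TensorProduct.tmul_smul, hv]

/-- S̄ turns left multiplication by f_i into scaled right multiplication, whose adjoint is the
operator of f_i. This feeds both the coregular action and the Verma adjunction. -/
theorem freePairing_antipodeBar_ι_mul (i : I) (c v : FreeAlgebra k I) :
    R.freePairing q (antipode (R.braidFBar q) (ι k i * c)) v =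
      R.freePairing q (antipode (R.braidFBar q) c) (R.opF q i v) := by
  rw [R.antipode_ι_mul_eq q (R.braidFBar_ι_tmul q), map_neg, LinearMap.neg_apply,
    freePairing_mul_ι_left, freePairing_scale, opF_apply, map_neg, map_smul, smul_eq_mul]

/-- The operator of f_i passes through the coproduct and the twist to their last leg, where its
adjoint under the pairing with S̄ is left multiplication by f_i. So the coregular formula is a right
action. -/
theorem coregularAction_ι_mul (i : I) (c v : FreeAlgebra k I) :
    R.coregularAction q (ι k i * c) v = R.coregularAction q c (R.opF q i v) := by
  classical
  simp only [coregularAction, LinearMap.comp_apply, opF_apply, map_neg, map_smul,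
    coproduct_scale, coproduct_rightSkew]
  induction coproduct (R.braidE q) v using TensorProduct.induction_on with
  | zero => simp
  | tmul a b =>
    rw [LinearMap.lTensor_tmul, TensorProduct.map_tmul, AlgHom.toLinearMap_apply,
      AlgHom.toLinearMap_apply, R.twist_tmul_scale q R.rmapBar_single, twist_rightSkew]
    induction R.twist q (R.rmapBar k) (a ⊗ₜ b) using TensorProduct.induction_on with
    | zero => simp
    | tmul a b =>
      simp only [LinearMap.lTensor_tmul, LinearEquiv.coe_coe, TensorProduct.rid_tmul,
        freePairing_antipodeBar_ι_mul, opF_apply, map_neg, map_smul, AlgHom.toLinearMap_apply,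
        neg_smul, smul_assoc]
    | add s t hs ht => simp only [map_add, smul_add, neg_add, hs, ht]
  | add s t hs ht => simp only [map_add, smul_add, neg_add, hs, ht]

theorem coregularAction_one (v : FreeAlgebra k I) : R.coregularAction q 1 v = v := by
  have h (a b : FreeAlgebra k I) : TensorProduct.rid k _ ((R.freePairing q 1).lTensor _
      (R.twist q (R.rmapBar k) (a ⊗ₜ b))) = counit k I b • a := by
    induction b using induction_left generalizing a with
    | one => rw [twist_tmul_one]; simp [freePairing_one_left]
    | ι_mul i b h =>
      rw [R.twist_tmul_ι_mul q R.rmapBar_single, counit_ι_mul, zero_smul]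
      induction R.twist q (R.rmapBar k) (R.scale q (-R.kappa i) a ⊗ₜ b) using
        TensorProduct.induction_on with
      | zero => simp
      | tmul a b => simp [freePairing_one_left]
      | add s t hs ht => simp only [map_add, hs, ht, add_zero]
    | add v w hv hw => simp only [map_add, TensorProduct.tmul_add, add_smul, hv, hw]
    | smul r v hv => simp only [map_smul, TensorProduct.tmul_smul, hv, smul_assoc]
  conv_rhs => rw [← R.counit_lTensor_coproduct q v]
  simp only [coregularAction, LinearMap.comp_apply, antipode_one, LinearEquiv.coe_coe]
  induction coproduct (R.braidE q) v using TensorProduct.induction_on with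
  | zero => simp
  | tmul a b => simp [h]
  | add s t hs ht => simp only [map_add, hs, ht]

theorem coregularAction_add (c d v : FreeAlgebra k I) :
    R.coregularAction q (c + d) v = R.coregularAction q c v + R.coregularAction q d v := by
  simp [coregularAction, LinearMap.lTensor_add]

theorem coregularAction_smul (r : k) (c v : FreeAlgebra k I) :
    R.coregularAction q (r • c) v = r • R.coregularAction q c v := by
  simp [coregularAction, LinearMap.lTensor_smul]

theorem coregularAction_eq_zero {c : FreeAlgebra k I} (hc : c ∈ R.radical q)
    (v : FreeAlgebra k I) : R.coregularAction q c v = 0 := by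
  have : R.freePairing q (antipode (R.braidFBar q) c) = 0 :=
    R.freePairing_eq_zero q _ (R.antipodeBar_mem_radical q hc)
  simp [coregularAction, this]

theorem lift_opF_unop (c v : FreeAlgebra k I) :
    (FreeAlgebra.lift k (fun i => MulOpposite.op (R.opF q i)) c).unop v =
      R.coregularAction q c v := by
  induction c using induction_left generalizing v with
  | one => simp [coregularAction_one]
  | ι_mul i c h =>
    rw [map_mul, MulOpposite.unop_mul, Module.End.mul_apply, h, coregularAction_ι_mul,
      FreeAlgebra.lift_ι_apply, MulOpposite.unop_op]
  | add a b ha hb => simp [ha, hb, coregularAction_add]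
  | smul r b hb => simp [hb, coregularAction_smul]

end LusztigRootDatum

namespace LusztigRootDatum

variable {I X Y : Type*} [AddCommGroup X] [AddCommGroup Y] (R : LusztigRootDatum I X Y)
variable {k : Type*} [Field k] (q : kˣ)

/-! ### The fundamental representation -/

/-- The right action of `e^i` on `B`. -/
def opEB (i : I) : Module.End k (R.B q) :=
  R.descendB q (R.opE q i) fun _ => R.opE_mem_radical q i

@[simp]
theorem opEB_toB (i : I) (v : FreeAlgebra k I) :
    R.opEB q i (R.toB q v) = R.toB q (R.opE q i v) :=
  R.descendB_toB ..

theorem opEB_apply (i : I) (v : R.B q) :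
    R.opEB q i v = v * R.toB q (ι k i) - R.toB q (ι k i) * R.scaleB q (R.kappa i) v := by
  obtain ⟨v, rfl⟩ := R.toB_surjective q v
  rw [opEB_toB, opE_apply, scaleB_toB, map_sub, map_mul, map_mul]

theorem scaleB_mul (μ : Y) (v w : R.B q) :
    R.scaleB q μ (v * w) = R.scaleB q μ v * R.scaleB q μ w := by
  obtain ⟨v, rfl⟩ := R.toB_surjective q v
  obtain ⟨w, rfl⟩ := R.toB_surjective q w
  rw [← map_mul, scaleB_toB, scaleB_toB, scaleB_toB, map_mul, map_mul]

@[simp]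
theorem scaleB_one (μ : Y) : R.scaleB q μ 1 = 1 := by
  rw [← map_one (R.toB q), scaleB_toB, map_one]

theorem lift_unop_toB {T : I → Module.End k (FreeAlgebra k I)} {T' : I → Module.End k (R.B q)}
    (h : ∀ i v, T' i (R.toB q v) = R.toB q (T i v)) (b v : FreeAlgebra k I) :
    (FreeAlgebra.lift k (fun i => MulOpposite.op (T' i)) b).unop (R.toB q v) =
      R.toB q ((FreeAlgebra.lift k (fun i => MulOpposite.op (T i)) b).unop v) := by
  induction b using induction_left generalizing v with
  | one => simp
  | ι_mul i b hb =>
    rw [map_mul, map_mul, MulOpposite.unop_mul, MulOpposite.unop_mul, Module.End.mul_apply,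
      Module.End.mul_apply, FreeAlgebra.lift_ι_apply, FreeAlgebra.lift_ι_apply,
      MulOpposite.unop_op, MulOpposite.unop_op, h, hb]
  | add a b ha hb => simp [ha, hb]
  | smul r b hb => simp [hb]

theorem op_end_B_ext {S T : (Module.End k (R.B q))ᵐᵒᵖ}
    (h : ∀ v, S.unop (R.toB q v) = T.unop (R.toB q v)) : S = T := by
  apply MulOpposite.unop_injective
  ext v
  obtain ⟨v, rfl⟩ := R.toB_surjective q v
  exact h v

variable {q} (hq : ∀ i, R.qdiff q i ≠ 0)

/-- The right action of `f_i` on `B`. -/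
def opFB (i : I) : Module.End k (R.B q) :=
  R.descendB q (R.opF q i) fun _ => R.opF_mem_radical q i (hq i)

@[simp]
theorem opFB_toB (i : I) (v : FreeAlgebra k I) :
    R.opFB hq i (R.toB q v) = R.toB q (R.opF q i v) :=
  R.descendB_toB ..

theorem opFB_mul (i : I) (v w : R.B q) :
    R.opFB hq i (v * w) = R.opFB hq i v * w + R.scaleB q (-R.kappa i) v * R.opFB hq i w := by
  obtain ⟨v, rfl⟩ := R.toB_surjective q v
  obtain ⟨w, rfl⟩ := R.toB_surjective q w
  rw [← map_mul, opFB_toB, opFB_toB, opFB_toB, opF_mul, map_add, map_mul, map_mul, scaleB_toB]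

/-- The torus and cross relations are operator identities already on the free algebra. Only the
radical relations use the quotient, through the closed adjoint formula for e and the coregular
formula for f. -/
theorem rho_satisfiesURel :
    R.SatisfiesURel q (fun i => MulOpposite.op (R.opEB q i))
      (fun i => MulOpposite.op (R.opFB hq i)) (fun μ => MulOpposite.op (R.scaleB q μ)) where
  K_zero := R.op_end_B_ext q fun v => by simp [scale_zero]
  K_add μ ν := R.op_end_B_ext q fun v => by
    simp [← R.scale_scale q μ ν, R.scale_comm q μ ν]
  e_K i μ := R.op_end_B_ext q fun v => by
    simp only [MulOpposite.unop_mul, MulOpposite.unop_smul, MulOpposite.unop_op,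
      Module.End.mul_apply, LinearMap.smul_apply, opEB_toB, scaleB_toB, opE_scale, map_smul]
  K_f i μ := R.op_end_B_ext q fun v => by
    simp only [MulOpposite.unop_mul, MulOpposite.unop_smul, MulOpposite.unop_op,
      Module.End.mul_apply, LinearMap.smul_apply, opFB_toB, scaleB_toB, opF_scale, map_smul]
  e_f_same i := R.op_end_B_ext q fun v => by
    classical
    simp only [MulOpposite.unop_sub, MulOpposite.unop_mul, MulOpposite.unop_smul,
      MulOpposite.unop_op, Module.End.mul_apply, LinearMap.smul_apply, LinearMap.sub_apply,
      opFB_toB, opEB_toB, scaleB_toB]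
    rw [← map_sub, opF_opE, if_pos rfl, map_smul, map_sub]
  e_f_ne i j hij := R.op_end_B_ext q fun v => by
    classical
    simp only [MulOpposite.unop_mul, MulOpposite.unop_op, Module.End.mul_apply, opFB_toB, opEB_toB]
    rw [← sub_eq_zero, ← map_sub, opF_opE, if_neg hij, map_zero]
  e_rad b hb := R.op_end_B_ext q fun v => by
    rw [R.lift_unop_toB q (R.opEB_toB q), lift_opE_unop, MulOpposite.unop_zero,
      LinearMap.zero_apply, toB_eq_zero_iff]
    exact R.adjointAction_mem_radical q v hb
  f_rad c hc := R.op_end_B_ext q fun v => by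
    rw [R.lift_unop_toB q (R.opFB_toB hq), lift_opF_unop, R.coregularAction_eq_zero q hc,
      MulOpposite.unop_zero, LinearMap.zero_apply, map_zero]

/-- The fundamental representation. -/
def rho : R.U q →ₐ[k] (Module.End k (R.B q))ᵐᵒᵖ := (R.rho_satisfiesURel hq).liftU

@[simp]
theorem act_rho_e (i : I) (v : R.B q) : R.act q (R.rho hq) v (R.e q i) = R.opEB q i v := by
  rw [act_apply, rho, SatisfiesURel.liftU_e, MulOpposite.unop_op]

@[simp]
theorem act_rho_f (i : I) (v : R.B q) : R.act q (R.rho hq) v (R.f q i) = R.opFB hq i v := by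
  rw [act_apply, rho, SatisfiesURel.liftU_f, MulOpposite.unop_op]

@[simp]
theorem act_rho_K (μ : Y) (v : R.B q) : R.act q (R.rho hq) v (R.K q μ) = R.scaleB q μ v := by
  rw [act_apply, rho, SatisfiesURel.liftU_K, MulOpposite.unop_op]

theorem rho_inclB (b : FreeAlgebra k I) :
    R.rho hq (R.inclB q (R.toB q b)) =
      FreeAlgebra.lift k (fun i => MulOpposite.op (R.opEB q i)) b := by
  rw [← lift_e, ← AlgHom.comp_apply]
  congr 1
  ext i
  simp [rho]

theorem rho_inclC (c : FreeAlgebra k I) :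
    R.rho hq (R.inclC q (R.toC q c)) =
      FreeAlgebra.lift k (fun i => MulOpposite.op (R.opFB hq i)) c := by
  rw [← lift_f, ← AlgHom.comp_apply]
  congr 1
  ext i
  simp [rho]

theorem isFundamentalRep_rho : R.IsFundamentalRep q (R.rho hq) where
  act_K v μ := by rw [act_rho_K, actH_single, scaleB_toB]
  act_B v b := by
    rw [act_apply, rho_inclB, R.lift_unop_toB q (R.opEB_toB q), lift_opE_unop]
  act_C v c := by
    rw [act_apply, rho_inclC, R.lift_unop_toB q (R.opFB_toB hq), lift_opF_unop]

variable {R} in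
theorem IsFundamentalRep.unique {ρ ρ' : R.U q →ₐ[k] (Module.End k (R.B q))ᵐᵒᵖ}
    (h : R.IsFundamentalRep q ρ) (h' : R.IsFundamentalRep q ρ') : ρ = ρ' := by
  refine R.U_algHom_ext (W := (Module.End k (R.B q))ᵐᵒᵖ) q (fun i => ?_) (fun i => ?_)
    (fun μ => ?_) <;> refine R.op_end_B_ext q fun v => ?_
  · have h0 := (h.act_B v (ι k i)).trans (h'.act_B v (ι k i)).symm
    rwa [inclB_ι, act_apply, act_apply] at h0
  · have h0 := (h.act_C v (ι k i)).trans (h'.act_C v (ι k i)).symm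
    rwa [inclC_ι, act_apply, act_apply] at h0
  · exact (h.act_K v _).trans (h'.act_K v _).symm

/-! ### Braided differentiation -/

/-- The pairing with f_i sees only the coefficient of the letter i. On it the twist by ℛ̄ of a leg a
produces q^(-i·|a|), the eigenvalue of K_i^(-(i·i)/2) on a. -/
theorem freeDeriv_eq (i : I) (v : FreeAlgebra k I) : R.freeDeriv q i v = -R.opF q i v := by
  classical
  have hp (b : FreeAlgebra k I) : R.freePairing q (ι k i) b =
      (R.qdiff q i)⁻¹ * genCoeff k i b := by
    rw [← mul_one (ι k i), freePairing_ι_mul_left, freePairing_one_left, counit_leftSkew]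
  have key (a b : FreeAlgebra k I) : TensorProduct.lid k _ ((R.freePairing q (ι k i)).rTensor _
      (R.twist q (R.rmapBar k) (b ⊗ₜ a))) =
        ((R.qdiff q i)⁻¹ * genCoeff k i b) • R.scale q (-R.kappa i) a := by
    induction a using induction_left generalizing b with
    | one => simp [twist_tmul_one, hp]
    | ι_mul j a h =>
      have h1 (t : FreeAlgebra k I ⊗[k] FreeAlgebra k I) :
          TensorProduct.lid k _ ((R.freePairing q (ι k i)).rTensor _
            ((LinearMap.mulLeft k (ι k j)).lTensor _ t)) =
          ι k j * TensorProduct.lid k _ ((R.freePairing q (ι k i)).rTensor _ t) := by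
        induction t using TensorProduct.induction_on with
        | zero => simp
        | tmul a b => simp
        | add s t hs ht => simp only [map_add, mul_add, hs, ht]
      rw [R.twist_tmul_ι_mul q R.rmapBar_single, h1, h, genCoeff_scale, map_neg,
        LinearMap.neg_apply, pairing_kappa_root, map_mul, scale_neg_kappa_ι, R.form_symm j i,
        zpow_neg, mul_smul_comm, smul_mul_assoc, smul_smul]
      congr 1
      simp only [chi, Units.val_inv_eq_inv_val]
      ring
    | add v w hv hw => simp only [map_add, TensorProduct.tmul_add, smul_add, hv, hw]
    | smul r v hv => simp only [map_smul, TensorProduct.tmul_smul, hv]; exact smul_comm ..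
  rw [opF_apply, neg_neg, rightSkew_eq]
  simp only [freeDeriv, braidEInv, flip, LinearMap.comp_apply, LinearEquiv.coe_coe]
  induction coproduct (R.braidE q) v using TensorProduct.induction_on with
  | zero => simp
  | tmul a b => simp [key, mul_smul]
  | add s t hs ht => simp only [map_add, smul_add, hs, ht]

/-- Braided differentiation on `B`. -/
def deriv (i : I) : R.B q →ₗ[k] R.B q := -R.opFB hq i

theorem deriv_toB (i : I) (v : FreeAlgebra k I) :
    R.deriv hq i (R.toB q v) = R.toB q (R.freeDeriv q i v) := by
  rw [deriv, LinearMap.neg_apply, opFB_toB, freeDeriv_eq, map_neg]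

theorem deriv_mul (i : I) (v w : R.B q) :
    R.deriv hq i (v * w) = R.deriv hq i v * w + R.scaleB q (-R.kappa i) v * R.deriv hq i w := by
  have h {A : Type _} [Ring A] (a b c d : A) : -(a * b + c * d) = -a * b + c * -d := by
    noncomm_ring
  rw [deriv, LinearMap.neg_apply, opFB_mul]
  exact h ..

@[simp]
theorem deriv_one (i : I) : R.deriv hq i 1 = 0 := by
  rw [deriv, LinearMap.neg_apply, ← map_one (R.toB q), opFB_toB, opF_apply]
  simp

theorem deriv_x [DecidableEq I] (i j : I) :
    R.deriv hq i (R.x q j) = if i = j then 1 else 0 := by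
  rw [deriv, LinearMap.neg_apply, x, map_smul, opFB_toB, opF_ι]
  by_cases h : i = j
  · subst h; simp [hq i]
  · simp [h]

theorem scaleB_x (μ : Y) (i : I) :
    R.scaleB q μ (R.x q i) = ((q ^ R.pairing μ (R.root i) : kˣ) : k) • R.x q i := by
  rw [x, map_smul, scaleB_toB, scale_ι, map_smul, smul_comm]

theorem scaleB_pow (μ : Y) (v : R.B q) (n : ℕ) :
    R.scaleB q μ (v ^ n) = R.scaleB q μ v ^ n := by
  induction n with
  | zero => simp
  | succ n ih => rw [pow_succ, pow_succ, scaleB_mul, ih]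

theorem scaleB_list_prod (i : I) (ν : I → ℕ) (l : List I) :
    R.scaleB q (-R.kappa i) (l.map fun j => R.x q j ^ ν j).prod =
      ((q ^ (-(l.map fun j => (ν j : ℤ) * R.form i j).sum) : kˣ) : k) •
        (l.map fun j => R.x q j ^ ν j).prod := by
  induction l with
  | nil => simp
  | cons j l ih =>
    rw [List.map_cons, List.prod_cons, scaleB_mul, ih, scaleB_pow, scaleB_x, smul_pow,
      smul_mul_smul_comm, List.map_cons, List.sum_cons, neg_add, zpow_add, map_neg,
      LinearMap.neg_apply, pairing_kappa_root, Units.val_mul, ← Units.val_pow_eq_pow_val,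
      ← zpow_natCast, ← zpow_mul]
    congr 5
    ring

theorem deriv_list_prod_of_notMem (i : I) (ν : I → ℕ) (l : List I) (h : i ∉ l) :
    R.deriv hq i (l.map fun j => R.x q j ^ ν j).prod = 0 := by
  classical
  induction l with
  | nil => simp
  | cons j l ih =>
    rw [List.mem_cons, not_or] at h
    have hj (n : ℕ) : R.deriv hq i (R.x q j ^ n) = 0 := by
      induction n with
      | zero => simp
      | succ n ihn => rw [pow_succ, deriv_mul, ihn, deriv_x, if_neg h.1]; simp
    rw [List.map_cons, List.prod_cons, deriv_mul, ih h.2, hj]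
    simp

theorem qi_sq_inv (i : I) : (R.qi q i ^ 2)⁻¹ = ((q ^ (-R.form i i) : kˣ) : k) := by
  rw [qi, ← Units.val_pow_eq_pow_val, ← Units.val_inv_eq_inv_val, ← R.two_mul_half i, zpow_neg,
    mul_comm, zpow_mul]
  rfl

/-- Indeed 1 - q_i⁻² = q_i⁻¹ (q_i - q_i⁻¹), so the denominator of the q-integer is invertible. -/
theorem one_sub_qi_sq_inv_ne_zero (hq : ∀ i, R.qdiff q i ≠ 0) (i : I) : 1 - (R.qi q i ^ 2)⁻¹ ≠ 0 := by
  have h0 : R.qi q i ≠ 0 := Units.ne_zero _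
  have h := hq i
  rw [qdiff] at h
  intro h'
  apply h
  field_simp at h' ⊢
  linear_combination h'

/-- The Leibniz rule gives the recursion [n + 1] = 1 + t [n] with t = q_i⁻². -/
theorem deriv_x_pow (i : I) (n : ℕ) :
    R.deriv hq i (R.x q i ^ n) =
      ((1 - ((R.qi q i ^ 2)⁻¹) ^ n) / (1 - (R.qi q i ^ 2)⁻¹)) • R.x q i ^ (n - 1) := by
  classical
  induction n with
  | zero => simp
  | succ n ih =>
    have h1 := R.one_sub_qi_sq_inv_ne_zero hq i
    have hs : R.scaleB q (-R.kappa i) (R.x q i) = (R.qi q i ^ 2)⁻¹ • R.x q i := by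
      rw [scaleB_x, map_neg, LinearMap.neg_apply, pairing_kappa_root, qi_sq_inv]
    rw [pow_succ', deriv_mul, deriv_x, if_pos rfl, ih, hs, one_mul, smul_mul_smul_comm,
      Nat.add_sub_cancel]
    -- The exponent `n - 1` is truncated, so `n = 0` is separated: the q-integer [0] vanishes there
    -- and the power is irrelevant.
    cases n with
    | zero => simp [h1]
    | succ n =>
      rw [Nat.add_sub_cancel, ← pow_succ']
      nth_rw 1 [← one_smul k (R.x q i ^ (n + 1))]
      rw [← add_smul]
      congr 1
      rw [eq_div_iff h1, add_mul, mul_assoc, div_mul_cancel₀ _ h1]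
      ring

theorem deriv_list_prod (i : I) (ν : I → ℕ) (l₁ l₂ : List I) (h₁ : i ∉ l₁) (h₂ : i ∉ l₂) :
    R.deriv hq i ((l₁ ++ i :: l₂).map fun j => R.x q j ^ ν j).prod =
      (((q ^ (-(l₁.map fun j => (ν j : ℤ) * R.form i j).sum) : kˣ) : k) *
        ((1 - ((R.qi q i ^ 2)⁻¹) ^ ν i) / (1 - (R.qi q i ^ 2)⁻¹))) •
      ((l₁.map fun j => R.x q j ^ ν j).prod *
        (R.x q i ^ (ν i - 1) * (l₂.map fun j => R.x q j ^ ν j).prod)) := by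
  rw [List.map_append, List.prod_append, List.map_cons, List.prod_cons, deriv_mul, deriv_mul,
    R.deriv_list_prod_of_notMem hq i ν l₁ h₁, R.deriv_list_prod_of_notMem hq i ν l₂ h₂,
    scaleB_list_prod, deriv_x_pow, zero_mul, zero_add, mul_zero, add_zero, smul_mul_assoc,
    smul_mul_assoc, mul_smul_comm, smul_smul]

/-- Braided differentiation of ordered monomials. -/
theorem deriv_monomial {r : ℕ} (R : LusztigRootDatum (Fin r) X Y) (hq : ∀ i, R.qdiff q i ≠ 0)
    (i : Fin r) (ν : Fin r → ℕ) :
    R.deriv hq i (List.ofFn fun j => R.x q j ^ ν j).prod =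
      (((q ^ (-∑ j ∈ Finset.univ.filter (· < i), (ν j : ℤ) * R.form i j) : kˣ) : k) *
        ((1 - ((R.qi q i ^ 2)⁻¹) ^ ν i) / (1 - (R.qi q i ^ 2)⁻¹))) •
        (List.ofFn fun j => R.x q j ^ (if j = i then ν j - 1 else ν j)).prod := by
  -- The ordered index list is cut at `i`; being strictly increasing, its initial piece consists
  -- exactly of the j < i, the factors past which the derivation is braided.
  obtain ⟨l₁, l₂, hl⟩ := List.append_of_mem (List.mem_finRange i)
  have hs := List.pairwise_lt_finRange r
  rw [hl, List.pairwise_append, List.pairwise_cons] at hs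
  obtain ⟨h1, ⟨h2, -⟩, h3⟩ := hs
  have h₁ (j) (hj : j ∈ l₁) : j < i := h3 j hj i List.mem_cons_self
  have hmem (j) : j ∈ l₁ ↔ j < i := by
    refine ⟨h₁ j, fun hj => ?_⟩
    have := List.mem_finRange j
    rw [hl, List.mem_append, List.mem_cons] at this
    rcases this with h | rfl | h
    · exact h
    · exact absurd hj (lt_irrefl _)
    · exact absurd hj (h2 j h).not_gt
  have hn₁ : i ∉ l₁ := fun h => lt_irrefl _ (h₁ i h)
  have hn₂ : i ∉ l₂ := fun h => lt_irrefl _ (h2 i h)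
  have hsum : (l₁.map fun j => (ν j : ℤ) * R.form i j).sum =
      ∑ j ∈ Finset.univ.filter (· < i), (ν j : ℤ) * R.form i j := by
    rw [← List.sum_toFinset _ (h1.imp fun h => h.ne)]
    congr 1
    ext j
    simp [hmem]
  have hmap {l : List (Fin r)} (h : i ∉ l) :
      (l.map fun j => R.x q j ^ (if j = i then ν j - 1 else ν j)) =
        l.map fun j => R.x q j ^ ν j :=
    List.map_congr_left fun j hj => by rw [if_neg (ne_of_mem_of_not_mem hj h)]
  rw [List.ofFn_eq_map, List.ofFn_eq_map, hl, R.deriv_list_prod hq i ν l₁ l₂ hn₁ hn₂, hsum,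
    List.map_append, List.prod_append, List.map_cons, List.prod_cons, if_pos rfl,
    hmap hn₁, hmap hn₂]

/-! ### The Verma module representation -/

/-- The left action of `K_μ` on `C̄`. -/
def scaleC (μ : Y) : Module.End k (R.C q) :=
  R.descendC q (R.scale q μ).toLinearMap fun _ => R.scale_mem_radical q μ

@[simp]
theorem scaleC_toC (μ : Y) (v : FreeAlgebra k I) :
    R.scaleC μ (R.toC q v) = R.toC q (R.scale q μ v) :=
  R.descendC_toC ..

@[simp]
theorem scaleC_one (μ : Y) : R.scaleC μ (1 : R.C q) = 1 := by
  rw [← map_one (R.toC q), scaleC_toC, map_one]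

/-- The linear map `S̄` on `C̄`. -/
def antipodeC : R.C q →ₗ[k] R.C q :=
  R.descendC q (LusztigRootDatum.antipode (R.braidFBar q)) fun _ => R.antipodeBar_mem_radical q

@[simp]
theorem antipodeC_toC (c : FreeAlgebra k I) :
    R.antipodeC (R.toC q c) = R.toC q (LusztigRootDatum.antipode (R.braidFBar q) c) :=
  R.descendC_toC ..

theorem antipodeC_bijective : Function.Bijective (R.antipodeC (q := q)) := by
  let T : R.C q →ₗ[k] R.C q :=
    R.descendC q (LusztigRootDatum.antipode (R.braidE q)) fun _ => R.antipode_mem_radical q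
  have hT (c : FreeAlgebra k I) :
      T (R.toC q c) = R.toC q (LusztigRootDatum.antipode (R.braidE q) c) := R.descendC_toC ..
  refine Function.bijective_iff_has_inverse.2 ⟨T, fun c => ?_, fun c => ?_⟩ <;>
    obtain ⟨c, rfl⟩ := R.toC_surjective q c
  · rw [antipodeC_toC, hT, antipode_antipodeBar]
  · rw [hT, antipodeC_toC, antipodeBar_antipode]

/-- The operator by which `e^i` acts on `C̄`, on representatives. -/
def vermaOpE (q : kˣ) (i : I) : FreeAlgebra k I →ₗ[k] FreeAlgebra k I :=
  (R.qdiff q i)⁻¹ •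
    (R.rightSkew q i - (R.scale q (-R.kappa i)).toLinearMap ∘ₗ R.leftSkew q i)

theorem vermaOpE_apply (i : I) (c : FreeAlgebra k I) :
    R.vermaOpE q i c =
      (R.qdiff q i)⁻¹ • (R.rightSkew q i c - R.scale q (-R.kappa i) (R.leftSkew q i c)) :=
  rfl

/-- The left action of `e^i` on `C̄`. -/
def vermaE (i : I) : Module.End k (R.C q) :=
  R.descendC q (R.vermaOpE q i) fun c hc => by
    rw [vermaOpE_apply]
    exact Submodule.smul_mem _ _ (sub_mem (R.rightSkew_mem_radical q i (hq i) hc)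
      (R.scale_mem_radical q _ (R.leftSkew_mem_radical q i (hq i) hc)))

@[simp]
theorem vermaE_toC (i : I) (c : FreeAlgebra k I) :
    R.vermaE hq i (R.toC q c) = R.toC q (R.vermaOpE q i c) :=
  R.descendC_toC ..

/-- The left action of `f_i` on `C̄`. -/
def vermaF (i : I) : Module.End k (R.C q) := LinearMap.mulLeft k (R.toC q (ι k i))

/-- S̄ exchanges r_i and _i r, which are adjoint to left and right multiplication by e^i. The two
terms of the Verma operator thus match the two terms of v ↦ v e^i - e^i (K_i^((i·i)/2) v). -/
theorem pairingCB_vermaE (i : I) (c : R.C q) (v : R.B q) :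
    R.pairingCB q (R.antipodeC (R.vermaE hq i c)) v =
      R.pairingCB q (R.antipodeC c) (R.opEB q i v) := by
  obtain ⟨c, rfl⟩ := R.toC_surjective q c
  obtain ⟨v, rfl⟩ := R.toB_surjective q v
  rw [vermaE_toC, antipodeC_toC, antipodeC_toC, opEB_toB, pairingCB_apply, pairingCB_apply,
    vermaOpE_apply, map_smul, map_sub, R.antipode_scale q (R.braidFBar_ι_tmul q),
    antipodeBar_leftSkew, antipodeBar_rightSkew, map_neg, scale_neg_scale, opE_apply, map_sub,
    freePairing_mul_ι_right, freePairing_ι_mul_right, ← freePairing_scale, map_smul, map_sub,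
    map_neg, map_neg]
  simp only [LinearMap.smul_apply, LinearMap.sub_apply, LinearMap.neg_apply, smul_eq_mul]
  ring

theorem pairingCB_vermaF (i : I) (c : R.C q) (v : R.B q) :
    R.pairingCB q (R.antipodeC (R.vermaF i c)) v =
      R.pairingCB q (R.antipodeC c) (R.opFB hq i v) := by
  obtain ⟨c, rfl⟩ := R.toC_surjective q c
  obtain ⟨v, rfl⟩ := R.toB_surjective q v
  rw [vermaF, LinearMap.mulLeft_apply, ← map_mul, antipodeC_toC, antipodeC_toC, opFB_toB,
    pairingCB_apply, pairingCB_apply, freePairing_antipodeBar_ι_mul]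

theorem pairingCB_scaleC (μ : Y) (c : R.C q) (v : R.B q) :
    R.pairingCB q (R.antipodeC (R.scaleC μ c)) v =
      R.pairingCB q (R.antipodeC c) (R.scaleB q μ v) := by
  obtain ⟨c, rfl⟩ := R.toC_surjective q c
  obtain ⟨v, rfl⟩ := R.toB_surjective q v
  rw [scaleC_toC, antipodeC_toC, antipodeC_toC, scaleB_toB, pairingCB_apply, pairingCB_apply,
    R.antipode_scale q (R.braidFBar_ι_tmul q), freePairing_scale]

/-- The adjunction is proved before the Verma operators are known to satisfy any relation, for words
in the symbols of the generators. -/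
theorem pairingCB_lift_genMap (w : FreeAlgebra k (Gen I Y)) (c : R.C q) (v : R.B q) :
    R.pairingCB q (R.antipodeC (FreeAlgebra.lift k (genMap (R.vermaE hq) R.vermaF R.scaleC) w c))
        v =
      R.pairingCB q (R.antipodeC c)
        ((R.rho hq (RingQuot.mkAlgHom k (R.URel q) w)).unop v) := by
  induction w using induction_left generalizing v with
  | one => simp
  | ι_mul x w h =>
    rw [map_mul, map_mul, map_mul, Module.End.mul_apply, MulOpposite.unop_mul,
      Module.End.mul_apply, ← h, FreeAlgebra.lift_ι_apply]
    cases x with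
    | e i => rw [← e, ← act_apply, act_rho_e]; exact R.pairingCB_vermaE hq i _ v
    | f i => rw [← f, ← act_apply, act_rho_f]; exact R.pairingCB_vermaF hq i _ v
    | K μ => rw [← K, ← act_apply, act_rho_K]; exact R.pairingCB_scaleC μ _ v
  | add a b ha hb => simp [ha, hb]
  | smul r b hb => simp [hb]

/-- The Verma module representation. -/
def verma : R.U q →ₐ[k] Module.End k (R.C q) :=
  RingQuot.liftAlgHom k ⟨FreeAlgebra.lift k (genMap (R.vermaE hq) R.vermaF R.scaleC),
    fun a b hab => by
      ext c
      -- The relations are inherited: related words act equally on B, so after the injective S̄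
      -- their values on C̄ pair equally with all of B, and non-degeneracy concludes.
      apply R.antipodeC_bijective.1
      rw [← sub_eq_zero]
      refine R.pairingCB_left q _ fun v => ?_
      rw [map_sub, LinearMap.sub_apply, pairingCB_lift_genMap, pairingCB_lift_genMap,
        RingQuot.mkAlgHom_rel k hab, sub_self]⟩

theorem verma_mkAlgHom (w : FreeAlgebra k (Gen I Y)) :
    R.verma hq (RingQuot.mkAlgHom k (R.URel q) w) =
      FreeAlgebra.lift k (genMap (R.vermaE hq) R.vermaF R.scaleC) w :=
  RingQuot.liftAlgHom_mkAlgHom_apply ..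

theorem pairingCB_verma (u : R.U q) (c : R.C q) (v : R.B q) :
    R.pairingCB q (R.antipodeC (R.verma hq u c)) v =
      R.pairingCB q (R.antipodeC c) (R.act q (R.rho hq) v u) := by
  obtain ⟨w, rfl⟩ := RingQuot.mkAlgHom_surjective k (R.URel q) u
  rw [verma_mkAlgHom, pairingCB_lift_genMap, act_apply]

@[simp]
theorem verma_e (i : I) : R.verma hq (R.e q i) = R.vermaE hq i :=
  (R.verma_mkAlgHom hq _).trans (FreeAlgebra.lift_ι_apply _ _)

@[simp]
theorem verma_f (i : I) : R.verma hq (R.f q i) = R.vermaF i :=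
  (R.verma_mkAlgHom hq _).trans (FreeAlgebra.lift_ι_apply _ _)

@[simp]
theorem verma_K (μ : Y) : R.verma hq (R.K q μ) = R.scaleC μ :=
  (R.verma_mkAlgHom hq _).trans (FreeAlgebra.lift_ι_apply _ _)

theorem verma_inclC (c : FreeAlgebra k I) :
    R.verma hq (R.inclC q (R.toC q c)) 1 = R.toC q c := by
  induction c using induction_left with
  | one => simp
  | ι_mul i c h =>
    rw [map_mul, map_mul, map_mul, Module.End.mul_apply, h, inclC_ι, verma_f, vermaF,
      LinearMap.mulLeft_apply]
  | add a b ha hb => simp [ha, hb]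
  | smul r b hb => simp [hb]

/-- The left ideal of the Verma module. -/
def vermaIdeal (q : kˣ) : Ideal (R.U q) :=
  Ideal.span (Set.range (R.e q) ∪ Set.range (fun μ => R.K q μ - 1))

theorem K_mul_inclC (μ : Y) (c : FreeAlgebra k I) :
    R.K q μ * R.inclC q (R.toC q c) = R.inclC q (R.toC q (R.scale q μ c)) * R.K q μ := by
  induction c using induction_left with
  | one => simp
  | ι_mul i c h =>
    rw [map_mul, map_mul, inclC_ι, ← mul_assoc, (R.satisfiesURel q).K_f, smul_mul_assoc, mul_assoc,
      h, map_mul, map_mul, map_mul, scale_ι, map_smul, map_smul, inclC_ι, smul_mul_assoc,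
      smul_mul_assoc, mul_assoc]
  | add a b ha hb => simp only [map_add, mul_add, add_mul, ha, hb]
  | smul r b hb => simp only [map_smul, mul_smul_comm, smul_mul_assoc, hb]

theorem smul_mem_vermaIdeal (r : k) {u : R.U q} (hu : u ∈ R.vermaIdeal q) :
    r • u ∈ R.vermaIdeal q := by
  rw [Algebra.smul_def]
  exact Ideal.mul_mem_left _ _ hu

theorem K_mul_inclC_sub_mem (μ : Y) (c : FreeAlgebra k I) :
    R.K q μ * R.inclC q (R.toC q c) - R.inclC q (R.toC q (R.scale q μ c)) ∈ R.vermaIdeal q := by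
  rw [K_mul_inclC, ← mul_sub_one]
  exact Ideal.mul_mem_left _ _ (Ideal.subset_span (Or.inr ⟨μ, rfl⟩))

/-- Moving e^i to the right through the letters f_j leaves commutators in the torus. Modulo the left
ideal these become scalings of the remaining word. -/
theorem exists_e_mul_inclC_sub_mem (i : I) (c : FreeAlgebra k I) :
    ∃ d, R.e q i * R.inclC q (R.toC q c) - R.inclC q d ∈ R.vermaIdeal q := by
  induction c using induction_left with
  | one =>
    refine ⟨0, ?_⟩
    rw [map_one, map_one, mul_one, map_zero, sub_zero]
    exact Ideal.subset_span (Or.inl ⟨i, rfl⟩)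
  | ι_mul j c h =>
    obtain ⟨d, hd⟩ := h
    rw [map_mul, map_mul, inclC_ι, ← mul_assoc]
    by_cases hij : i = j
    · subst hij
      refine ⟨R.toC q (ι k i) * d + (R.qdiff q i)⁻¹ •
        (R.toC q (R.scale q (R.kappa i) c) - R.toC q (R.scale q (-R.kappa i) c)), ?_⟩
      have h1 := add_mem (Ideal.mul_mem_left _ (R.f q i) hd)
        (R.smul_mem_vermaIdeal (R.qdiff q i)⁻¹ (sub_mem
          (R.K_mul_inclC_sub_mem (R.kappa i) c) (R.K_mul_inclC_sub_mem (-R.kappa i) c)))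
      rw [← sub_add_cancel (R.e q i * R.f q i) (R.f q i * R.e q i),
        (R.satisfiesURel q).e_f_same]
      convert h1 using 1
      simp only [map_add, map_mul, map_smul, map_sub, inclC_ι, add_mul, mul_sub, smul_sub,
        sub_mul, smul_mul_assoc, mul_assoc]
      abel
    · refine ⟨R.toC q (ι k j) * d, ?_⟩
      rw [(R.satisfiesURel q).e_f_ne i j hij, map_mul, inclC_ι, mul_assoc, ← mul_sub]
      exact Ideal.mul_mem_left _ _ hd
  | add a b ha hb =>
    obtain ⟨c, hc⟩ := ha
    obtain ⟨d, hd⟩ := hb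
    refine ⟨c + d, ?_⟩
    rw [map_add, map_add, mul_add, map_add, add_sub_add_comm]
    exact add_mem hc hd
  | smul r b hb =>
    obtain ⟨d, hd⟩ := hb
    refine ⟨r • d, ?_⟩
    rw [map_smul, map_smul, mul_smul_comm, map_smul]
    convert R.smul_mem_vermaIdeal r hd using 1
    exact (smul_sub r _ _).symm

/-- The image of C̄ plus the left ideal is stable under left multiplication by generators and
contains 1, so it is all of U. This is the only part of a triangular decomposition that is needed.
-/
theorem exists_sub_inclC_mem (u : R.U q) : ∃ c, u - R.inclC q c ∈ R.vermaIdeal q := by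
  have of_sub {x u : R.U q} {c : R.C q} (hc : u - R.inclC q c ∈ R.vermaIdeal q)
      (h : ∃ d, x * R.inclC q c - R.inclC q d ∈ R.vermaIdeal q) :
      ∃ d, x * u - R.inclC q d ∈ R.vermaIdeal q := by
    obtain ⟨d, hd⟩ := h
    refine ⟨d, ?_⟩
    rw [← sub_add_sub_cancel (x * u) (x * R.inclC q c), ← mul_sub]
    exact add_mem (Ideal.mul_mem_left _ _ hc) hd
  induction u using R.U_induction_left q with
  | one => exact ⟨1, by rw [map_one, sub_self]; exact zero_mem _⟩
  | e_mul i u h =>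
    obtain ⟨c, hc⟩ := h
    refine of_sub hc ?_
    obtain ⟨c, rfl⟩ := R.toC_surjective q c
    exact R.exists_e_mul_inclC_sub_mem i c
  | f_mul i u h =>
    obtain ⟨c, hc⟩ := h
    refine of_sub hc ⟨R.toC q (ι k i) * c, ?_⟩
    rw [map_mul, inclC_ι, sub_self]
    exact zero_mem _
  | K_mul μ u h =>
    obtain ⟨c, hc⟩ := h
    refine of_sub hc ?_
    obtain ⟨c, rfl⟩ := R.toC_surjective q c
    exact ⟨_, R.K_mul_inclC_sub_mem μ c⟩
  | add u v hu hv =>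
    obtain ⟨c, hc⟩ := hu
    obtain ⟨d, hd⟩ := hv
    exact ⟨c + d, by rw [map_add, add_sub_add_comm]; exact add_mem hc hd⟩
  | smul r u hu =>
    obtain ⟨c, hc⟩ := hu
    refine ⟨r • c, ?_⟩
    rw [map_smul]
    convert R.smul_mem_vermaIdeal r hc using 1
    exact (smul_sub r _ _).symm

theorem verma_apply_one_eq_zero {u : R.U q} (hu : u ∈ R.vermaIdeal q) :
    R.verma hq u 1 = 0 := by
  induction hu using Submodule.span_induction with
  | mem u hu =>
    rcases hu with ⟨i, rfl⟩ | ⟨μ, rfl⟩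
    · rw [← map_one (R.toC q), verma_e, vermaE_toC, vermaOpE_apply]
      simp
    · simp
  | zero => simp
  | add u v _ _ hu hv => rw [map_add, LinearMap.add_apply, hu, hv, add_zero]
  | smul a u _ hu => rw [smul_eq_mul, map_mul, Module.End.mul_apply, hu, map_zero]

theorem isVermaRep_verma : R.IsVermaRep q (R.verma hq) where
  act_f i c := by rw [verma_f, vermaF, LinearMap.mulLeft_apply]
  act_K μ c := by rw [verma_K, scaleC_toC, actH_single]
  act_e i c := by rw [verma_e, vermaE_toC, vermaOpE_apply, map_smul, actH_single]
  surjective c := by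
    obtain ⟨c, rfl⟩ := R.toC_surjective q c
    exact ⟨_, R.verma_inclC hq c⟩
  kernel u := by
    -- If u kills 1 and u is congruent to c from C̄ modulo the ideal, then c = c ▷ 1 = 0, so u
    -- itself lies in the ideal.
    refine ⟨fun h => ?_, R.verma_apply_one_eq_zero hq⟩
    obtain ⟨c, hc⟩ := R.exists_sub_inclC_mem u
    obtain ⟨c, rfl⟩ := R.toC_surjective q c
    have h0 := R.verma_apply_one_eq_zero hq hc
    rw [map_sub, LinearMap.sub_apply, h, verma_inclC, zero_sub, neg_eq_zero] at h0
    rwa [h0, map_zero, sub_zero] at hc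

end LusztigRootDatum

namespace LusztigRootDatum

variable {I X Y : Type*} [AddCommGroup X] [AddCommGroup Y] (R : LusztigRootDatum I X Y)
variable {k : Type*} [Field k] (q : kˣ)

/-! ### The Hopf algebra structure of `U` -/

@[simp]
theorem K_zero : R.K q 0 = 1 := (R.satisfiesURel q).K_zero

theorem K_add (μ ν : Y) : R.K q (μ + ν) = R.K q μ * R.K q ν := (R.satisfiesURel q).K_add μ ν

theorem U_neg_mul (a b : R.U q) : -a * b = -(a * b) := neg_mul a b

theorem U_mul_neg (a b : R.U q) : a * -b = -(a * b) := mul_neg a b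

theorem U_smul_neg (c : k) (a : R.U q) : c • -a = -(c • a) := smul_neg c a

theorem K_mul_K_comm (μ ν : Y) : R.K q μ * R.K q ν = R.K q ν * R.K q μ := by
  rw [← K_add, ← K_add, add_comm]

@[simp]
theorem K_mul_K_neg (μ : Y) : R.K q μ * R.K q (-μ) = 1 := by
  rw [← K_add, add_neg_cancel, K_zero]

@[simp]
theorem K_neg_mul_K (μ : Y) : R.K q (-μ) * R.K q μ = 1 := by
  rw [← K_add, neg_add_cancel, K_zero]

theorem e_mul_K (i : I) (μ : Y) : R.e q i * R.K q μ =
    ((q ^ R.pairing μ (R.root i) : kˣ) : k) • (R.K q μ * R.e q i) :=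
  (R.satisfiesURel q).e_K i μ

theorem K_mul_f (i : I) (μ : Y) : R.K q μ * R.f q i =
    ((q ^ R.pairing μ (R.root i) : kˣ) : k) • (R.f q i * R.K q μ) :=
  (R.satisfiesURel q).K_f i μ

theorem e_mul_K_kappa (i j : I) :
    R.e q i * R.K q (R.kappa j) = R.chi q i j • (R.K q (R.kappa j) * R.e q i) := by
  rw [e_mul_K, pairing_kappa_root, R.form_symm, chi]

theorem e_mul_K_neg_kappa (i j : I) :
    R.e q i * R.K q (-R.kappa j) = (R.chi q i j)⁻¹ • (R.K q (-R.kappa j) * R.e q i) := by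
  rw [e_mul_K, map_neg, LinearMap.neg_apply, pairing_kappa_root, R.form_symm, chi, zpow_neg,
    Units.val_inv_eq_inv_val]

theorem K_kappa_mul_f (i j : I) :
    R.K q (R.kappa i) * R.f q j = R.chi q i j • (R.f q j * R.K q (R.kappa i)) := by
  rw [K_mul_f, pairing_kappa_root, chi]

theorem K_neg_kappa_mul_f (i j : I) :
    R.K q (-R.kappa i) * R.f q j = (R.chi q i j)⁻¹ • (R.f q j * R.K q (-R.kappa i)) := by
  rw [K_mul_f, map_neg, LinearMap.neg_apply, pairing_kappa_root, chi, zpow_neg,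
    Units.val_inv_eq_inv_val]

/-- The algebra map `H → U`. -/
def inclH : AddMonoidAlgebra k Y →ₐ[k] R.U q :=
  AddMonoidAlgebra.lift k (R.U q) Y
    { toFun := fun μ => R.K q μ.toAdd
      map_one' := R.K_zero q
      map_mul' := fun μ ν => R.K_add q μ.toAdd ν.toAdd }

@[simp]
theorem inclH_single (μ : Y) : R.inclH q (AddMonoidAlgebra.single μ 1) = R.K q μ := by
  rw [inclH, AddMonoidAlgebra.lift_single, one_smul]
  rfl

/-- The value of the coproduct of `U` on `e^i`. -/
def comulE (i : I) : R.U q ⊗[k] R.U q := R.e q i ⊗ₜ R.K q (R.kappa i) + 1 ⊗ₜ R.e q i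

/-- The value of the coproduct of `U` on `f_i`. -/
def comulF (i : I) : R.U q ⊗[k] R.U q := R.f q i ⊗ₜ 1 + R.K q (-R.kappa i) ⊗ₜ R.f q i

/-- The two summands of Δ e^i q-commute in the required order, and e^i ⊗ K_i^((i·i)/2) is e^i ⊗ 1
twisted by group-like elements that commute with it. -/
theorem comulE_rad {v : FreeAlgebra k I} (hv : v ∈ R.radical q) :
    FreeAlgebra.lift k (R.comulE q) v = 0 := by
  refine R.lift_add_eq_zero (W := R.U q ⊗[k] R.U q) q
    (x := fun i => R.e q i ⊗ₜ R.K q (R.kappa i)) (y := fun i => 1 ⊗ₜ R.e q i)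
    (fun i j => ?_) (fun v hv => ?_) (fun v hv => ?_) hv
  · rw [Algebra.TensorProduct.tmul_mul_tmul, Algebra.TensorProduct.tmul_mul_tmul, e_mul_K_kappa,
      TensorProduct.tmul_smul, one_mul, mul_one]
  · have := R.lift_mul_eq_zero q (W := R.U q ⊗[k] R.U q) (x := fun i => R.e q i ⊗ₜ 1)
      (Algebra.TensorProduct.includeRight.comp ((R.inclH q).comp (R.rmap k)))
      (fun i a => by simp [commute_iff_eq]) (fun v hv => ?_) hv
    · convert this using 4 with i
      rw [AlgHom.comp_apply, AlgHom.comp_apply, rmap_single, inclH_single]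
      simp
    · have h : FreeAlgebra.lift k (fun i => R.e q i ⊗ₜ[k] (1 : R.U q)) =
          (Algebra.TensorProduct.includeLeft : R.U q →ₐ[k] R.U q ⊗[k] R.U q).comp
            (FreeAlgebra.lift k (R.e q)) := by
        ext i; simp
      rw [h, AlgHom.comp_apply, (R.satisfiesURel q).e_rad v hv, map_zero]
  · have h : FreeAlgebra.lift k (fun i => (1 : R.U q) ⊗ₜ[k] R.e q i) =
        (Algebra.TensorProduct.includeRight : R.U q →ₐ[k] R.U q ⊗[k] R.U q).comp
          (FreeAlgebra.lift k (R.e q)) := by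
      ext i; simp
    rw [h, AlgHom.comp_apply, (R.satisfiesURel q).e_rad v hv, map_zero]

theorem comulF_rad {v : FreeAlgebra k I} (hv : v ∈ R.radical q) :
    FreeAlgebra.lift k (R.comulF q) v = 0 := by
  -- In the order of the definition the summands commute with q^(-i·j); exchanging them gives the
  -- q^(i·j) that `lift_add_eq_zero` requires.
  have hc : R.comulF q = fun i => R.K q (-R.kappa i) ⊗ₜ R.f q i + R.f q i ⊗ₜ 1 :=
    funext fun i => add_comm _ _
  rw [hc]
  refine R.lift_add_eq_zero (W := R.U q ⊗[k] R.U q) q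
    (x := fun i => R.K q (-R.kappa i) ⊗ₜ R.f q i) (y := fun i => R.f q i ⊗ₜ 1)
    (fun i j => ?_) (fun v hv => ?_) (fun v hv => ?_) hv
  · rw [Algebra.TensorProduct.tmul_mul_tmul, Algebra.TensorProduct.tmul_mul_tmul,
      K_neg_kappa_mul_f, ← TensorProduct.smul_tmul', smul_smul, R.chi_symm q j i,
      mul_inv_cancel₀ (R.chi_ne_zero q i j), one_smul, one_mul, mul_one]
  · have := R.lift_mul_eq_zero q (W := R.U q ⊗[k] R.U q) (x := fun i => 1 ⊗ₜ R.f q i)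
      ((Algebra.TensorProduct.includeLeft : R.U q →ₐ[k] R.U q ⊗[k] R.U q).comp
        ((R.inclH q).comp (R.rmapBar k)))
      (fun i a => by simp [commute_iff_eq]) (fun v hv => ?_) hv
    · convert this using 4 with i
      rw [AlgHom.comp_apply, AlgHom.comp_apply, rmapBar_single, inclH_single]
      simp
    · have h : FreeAlgebra.lift k (fun i => (1 : R.U q) ⊗ₜ[k] R.f q i) =
          (Algebra.TensorProduct.includeRight : R.U q →ₐ[k] R.U q ⊗[k] R.U q).comp
            (FreeAlgebra.lift k (R.f q)) := by
        ext i; simp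
      rw [h, AlgHom.comp_apply, (R.satisfiesURel q).f_rad v hv, map_zero]
  · have h : FreeAlgebra.lift k (fun i => R.f q i ⊗ₜ[k] (1 : R.U q)) =
        (Algebra.TensorProduct.includeLeft : R.U q →ₐ[k] R.U q ⊗[k] R.U q).comp
          (FreeAlgebra.lift k (R.f q)) := by
      ext i; simp
    rw [h, AlgHom.comp_apply, (R.satisfiesURel q).f_rad v hv, map_zero]

/-- The mixed terms cancel because the scalars from moving K past e and past f are mutually inverse.
-/
theorem comulE_mul_comulF (i j : I) :
    R.comulE q i * R.comulF q j - R.comulF q j * R.comulE q i =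
      (R.e q i * R.f q j - R.f q j * R.e q i) ⊗ₜ R.K q (R.kappa i) +
        R.K q (-R.kappa j) ⊗ₜ (R.e q i * R.f q j - R.f q j * R.e q i) := by
  have h : (R.e q i * R.K q (-R.kappa j)) ⊗ₜ[k] (R.K q (R.kappa i) * R.f q j) =
      (R.K q (-R.kappa j) * R.e q i) ⊗ₜ[k] (R.f q j * R.K q (R.kappa i)) := by
    rw [e_mul_K_neg_kappa, K_kappa_mul_f, ← TensorProduct.smul_tmul', TensorProduct.tmul_smul,
      smul_smul, inv_mul_cancel₀ (R.chi_ne_zero q i j), one_smul]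
  simp only [comulE, comulF, add_mul, mul_add, Algebra.TensorProduct.tmul_mul_tmul, h, one_mul,
    mul_one, TensorProduct.sub_tmul, TensorProduct.tmul_sub]
  abel

theorem comul_satisfiesURel :
    R.SatisfiesURel q (R.comulE q) (R.comulF q) (fun μ => R.K q μ ⊗ₜ[k] R.K q μ) where
  K_zero := by rw [K_zero]; rfl
  K_add μ ν := by rw [Algebra.TensorProduct.tmul_mul_tmul, K_add]
  e_K i μ := by
    simp only [comulE, add_mul, mul_add, Algebra.TensorProduct.tmul_mul_tmul, e_mul_K,
      ← TensorProduct.smul_tmul', TensorProduct.tmul_smul, smul_add, one_mul, mul_one,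
      R.K_mul_K_comm q μ]
  K_f i μ := by
    simp only [comulF, add_mul, mul_add, Algebra.TensorProduct.tmul_mul_tmul, K_mul_f,
      ← TensorProduct.smul_tmul', TensorProduct.tmul_smul, smul_add, one_mul, mul_one,
      R.K_mul_K_comm q μ]
  e_f_same i := by
    rw [comulE_mul_comulF, (R.satisfiesURel q).e_f_same, ← TensorProduct.smul_tmul',
      TensorProduct.tmul_smul, ← smul_add, TensorProduct.sub_tmul, TensorProduct.tmul_sub]
    congr 1
    abel
  e_f_ne i j hij := by
    rw [← sub_eq_zero, comulE_mul_comulF, (R.satisfiesURel q).e_f_ne i j hij, sub_self]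
    simp
  e_rad v hv := R.comulE_rad q hv
  f_rad v hv := R.comulF_rad q hv

/-- The coproduct of `U`. -/
def comulU : R.U q →ₐ[k] R.U q ⊗[k] R.U q := (R.comul_satisfiesURel q).liftU

theorem comulU_e (i : I) :
    R.comulU q (R.e q i) = R.e q i ⊗ₜ R.K q (R.kappa i) + 1 ⊗ₜ R.e q i :=
  SatisfiesURel.liftU_e ..

theorem comulU_f (i : I) :
    R.comulU q (R.f q i) = R.f q i ⊗ₜ 1 + R.K q (-R.kappa i) ⊗ₜ R.f q i :=
  SatisfiesURel.liftU_f ..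

theorem comulU_K (μ : Y) : R.comulU q (R.K q μ) = R.K q μ ⊗ₜ R.K q μ :=
  SatisfiesURel.liftU_K ..

theorem counit_satisfiesURel :
    R.SatisfiesURel q (fun _ => (0 : k)) (fun _ => 0) (fun _ => 1) where
  K_zero := rfl
  K_add _ _ := (one_mul 1).symm
  e_K _ _ := by simp
  K_f _ _ := by simp
  e_f_same _ := by simp
  e_f_ne _ _ _ := rfl
  -- The algebra map sending all letters to 0 is the pairing with 1.
  e_rad v hv := (R.freePairing_one_left q v).symm.trans ((R.mem_radical q).1 hv 1)
  f_rad v hv := (R.freePairing_one_left q v).symm.trans ((R.mem_radical q).1 hv 1)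

/-- The counit of `U`. -/
def counitU : R.U q →ₐ[k] k := (R.counit_satisfiesURel q).liftU

@[simp]
theorem counitU_e (i : I) : R.counitU q (R.e q i) = 0 := SatisfiesURel.liftU_e ..

@[simp]
theorem counitU_f (i : I) : R.counitU q (R.f q i) = 0 := SatisfiesURel.liftU_f ..

@[simp]
theorem counitU_K (μ : Y) : R.counitU q (R.K q μ) = 1 := SatisfiesURel.liftU_K ..

/-- The value of the antipode of `U` on `e^i`. -/
def antipodeUE (i : I) : (R.U q)ᵐᵒᵖ := MulOpposite.op (-(R.e q i * R.K q (-R.kappa i)))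

/-- The value of the antipode of `U` on `f_i`. -/
def antipodeUF (i : I) : (R.U q)ᵐᵒᵖ := MulOpposite.op (-(R.K q (R.kappa i) * R.f q i))

theorem coaction_mul_ι (i : I) (v : FreeAlgebra k I) :
    coaction k I (v * ι k i) =
      coaction k I v * (AddMonoidAlgebra.single (Finsupp.single i 1) 1 ⊗ₜ ι k i) := by
  simp [coaction]

theorem K_neg_mul_inclB (μ : Y) (v : FreeAlgebra k I) :
    R.K q (-μ) * R.inclB q (R.toB q v) = R.inclB q (R.toB q (R.scale q μ v)) * R.K q (-μ) := by
  induction v using induction_left with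
  | one => simp
  | ι_mul i v h =>
    have he : R.K q (-μ) * R.e q i =
        ((q ^ R.pairing μ (R.root i) : kˣ) : k) • (R.e q i * R.K q (-μ)) := by
      rw [e_mul_K, smul_smul, map_neg, LinearMap.neg_apply, zpow_neg, Units.mul_inv, one_smul]
    rw [map_mul, map_mul, inclB_ι, ← mul_assoc, he, smul_mul_assoc, mul_assoc, h, map_mul, map_mul,
      map_mul, scale_ι, map_smul, map_smul, inclB_ι, smul_mul_assoc, smul_mul_assoc, mul_assoc]
  | add a b ha hb => simp only [map_add, mul_add, add_mul, ha, hb]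
  | smul r b hb => simp only [map_smul, mul_smul_comm, smul_mul_assoc, hb]

/-- The bosonisation formula: the antipode of U sends v to (S v⁽²⁾) ℛ̄(v⁽¹⁾) with S the braided
antipode. Homogeneity of the radical and its stability under S give the vanishing. -/
theorem antipodeUE_rad {v : FreeAlgebra k I} (hv : v ∈ R.radical q) :
    FreeAlgebra.lift k (R.antipodeUE q) v = 0 := by
  let β : AddMonoidAlgebra k (I →₀ ℤ) →ₗ[k] FreeAlgebra k I →ₗ[k] R.U q :=
    ((LinearMap.mul k (R.U q)).compl₁₂ ((R.inclB q).toLinearMap ∘ₗ (R.toB q).toLinearMap ∘ₗ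
      antipode (R.braidE q)) ((R.inclH q).comp (R.rmapBar k)).toLinearMap).flip
  have hβ (a v) : β a v =
    R.inclB q (R.toB q (antipode (R.braidE q) v)) * R.inclH q (R.rmapBar k a) := rfl
  have key (v : FreeAlgebra k I) : (FreeAlgebra.lift k (R.antipodeUE q) v).unop =
      TensorProduct.lift β (coaction k I v) := by
    -- An antihomomorphism turns a new last letter into a new first factor, which matches the
    -- right-handed recursion `antipode_mul_ι`.
    induction v using induction_right with
    | one => simp [Algebra.TensorProduct.one_def, hβ, antipode_one]
    | mul_ι i v h =>
      rw [map_mul, MulOpposite.unop_mul, h, FreeAlgebra.lift_ι_apply, antipodeUE,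
        MulOpposite.unop_op, coaction_mul_ι]
      induction coaction k I v using TensorProduct.induction_on with
      | zero => simp
      | tmul a w =>
        rw [Algebra.TensorProduct.tmul_mul_tmul, TensorProduct.lift.tmul, TensorProduct.lift.tmul,
          hβ, hβ, R.antipode_mul_ι q (R.braidE_ι_tmul q) R.pairing_kappa_symm, mul_comm a, map_mul,
          map_mul, rmapBar_single, inclH_single, map_neg, map_neg, map_mul, map_mul, inclB_ι,
          U_neg_mul, U_neg_mul, mul_assoc (R.e q i), ← mul_assoc (R.K q _), K_neg_mul_inclB]
        simp only [mul_assoc]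
      | add s t hs ht => simp only [map_add, mul_add, add_mul, hs, ht]
    | add v w hv hw => simp only [map_add, MulOpposite.unop_add, hv, hw]
    | smul r v hv => simp only [map_smul, MulOpposite.unop_smul, hv]
  apply MulOpposite.unop_injective
  rw [key, MulOpposite.unop_zero]
  refine R.apply_coaction_eq_zero q β (fun a v hv => ?_) hv
  rw [hβ, (R.toB_eq_zero_iff q _).2 (R.antipode_mem_radical q hv), map_zero, zero_mul]

/-- The mirror formula ℛ(c⁽¹⁾) (S̄ c⁽²⁾) holds on the f-side. Here S̄ appears, so the induction can
peel letters off on the left. -/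
theorem antipodeUF_rad {v : FreeAlgebra k I} (hv : v ∈ R.radical q) :
    FreeAlgebra.lift k (R.antipodeUF q) v = 0 := by
  let β : AddMonoidAlgebra k (I →₀ ℤ) →ₗ[k] FreeAlgebra k I →ₗ[k] R.U q :=
    (LinearMap.mul k (R.U q)).compl₁₂ ((R.inclH q).comp (R.rmap k)).toLinearMap
      ((R.inclC q).toLinearMap ∘ₗ (R.toC q).toLinearMap ∘ₗ antipode (R.braidFBar q))
  have hβ (a v) : β a v = R.inclH q (R.rmap k a) *
    R.inclC q (R.toC q (antipode (R.braidFBar q) v)) := rfl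
  have key (v : FreeAlgebra k I) : (FreeAlgebra.lift k (R.antipodeUF q) v).unop =
      TensorProduct.lift β (coaction k I v) := by
    induction v using induction_left with
    | one => simp [Algebra.TensorProduct.one_def, hβ, antipode_one]
    | ι_mul i v h =>
      rw [map_mul, MulOpposite.unop_mul, h, FreeAlgebra.lift_ι_apply, antipodeUF,
        MulOpposite.unop_op, coaction_ι_mul]
      induction coaction k I v using TensorProduct.induction_on with
      | zero => simp
      | tmul a w =>
        have hK : R.inclC q (R.toC q (antipode (R.braidFBar q) w)) * R.K q (R.kappa i) =
            R.K q (R.kappa i) * R.inclC q (R.toC q (R.scale q (-R.kappa i)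
              (antipode (R.braidFBar q) w))) := by
          rw [K_mul_inclC, scale_scale_neg]
        rw [Algebra.TensorProduct.tmul_mul_tmul, TensorProduct.lift.tmul, TensorProduct.lift.tmul,
          hβ, hβ, R.antipode_ι_mul_eq q (R.braidFBar_ι_tmul q), mul_comm _ a, map_mul,
          map_mul, rmap_single, inclH_single, map_neg, map_neg, map_mul, map_mul, inclC_ι,
          U_mul_neg, U_mul_neg, mul_assoc, ← mul_assoc _ (R.K q _) (R.f q i), hK]
        simp only [mul_assoc]
      | add s t hs ht => simp only [map_add, mul_add, add_mul, hs, ht]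
    | add v w hv hw => simp only [map_add, MulOpposite.unop_add, hv, hw]
    | smul r v hv => simp only [map_smul, MulOpposite.unop_smul, hv]
  apply MulOpposite.unop_injective
  rw [key, MulOpposite.unop_zero]
  refine R.apply_coaction_eq_zero q β (fun a v hv => ?_) hv
  rw [hβ, (R.toC_eq_zero_iff q _).2 (R.antipodeBar_mem_radical q hv), map_zero, mul_zero]

theorem e_mul_K_mul_K_mul_f (i j : I) :
    R.e q i * R.K q (-R.kappa i) * (R.K q (R.kappa j) * R.f q j) =
      R.K q (R.kappa j) * (R.e q i * R.f q j) * R.K q (-R.kappa i) := by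
  rw [mul_assoc, ← mul_assoc (R.K q (-R.kappa i)), R.K_mul_K_comm q (-R.kappa i), mul_assoc,
    K_neg_kappa_mul_f, mul_smul_comm, mul_smul_comm, ← mul_assoc, e_mul_K_kappa, smul_mul_assoc,
    smul_smul, inv_mul_cancel₀ (R.chi_ne_zero q i j), one_smul]
  simp only [mul_assoc]

/-- Both products can be sandwiched between the same K_j^((j·j)/2) and K_i^(-(i·i)/2), so the cross
relations for the antipode reduce to those of U. -/
theorem antipodeU_commutator (i j : I) :
    R.antipodeUE q i * R.antipodeUF q j - R.antipodeUF q j * R.antipodeUE q i =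
      MulOpposite.op (-(R.K q (R.kappa j) * (R.e q i * R.f q j - R.f q j * R.e q i) *
        R.K q (-R.kappa i))) := by
  apply MulOpposite.unop_injective
  rw [antipodeUE, antipodeUF, ← MulOpposite.op_mul, ← MulOpposite.op_mul, ← MulOpposite.op_sub,
    MulOpposite.unop_op, MulOpposite.unop_op, U_neg_mul, U_neg_mul, U_mul_neg, U_mul_neg, neg_neg, neg_neg,
    e_mul_K_mul_K_mul_f]
  simp only [mul_sub, sub_mul, mul_assoc, neg_sub]

theorem antipode_satisfiesURel :
    R.SatisfiesURel q (R.antipodeUE q) (R.antipodeUF q)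
      (fun μ => MulOpposite.op (R.K q (-μ))) where
  K_zero := by rw [neg_zero, K_zero]; rfl
  K_add μ ν := by rw [← MulOpposite.op_mul, ← K_add, neg_add, add_comm]
  e_K i μ := by
    rw [antipodeUE, ← MulOpposite.op_mul, ← MulOpposite.op_mul, ← MulOpposite.op_smul, U_mul_neg,
      U_neg_mul, mul_assoc _ _ (R.K q (-μ)), R.K_mul_K_comm q _ (-μ), ← mul_assoc (R.e q i),
      R.e_mul_K q i (-μ), map_neg,
      LinearMap.neg_apply, smul_mul_assoc, ← U_smul_neg, smul_smul, zpow_neg, Units.mul_inv,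
      one_smul, mul_assoc]
  K_f i μ := by
    rw [antipodeUF, ← MulOpposite.op_mul, ← MulOpposite.op_mul, ← MulOpposite.op_smul, U_neg_mul,
      U_mul_neg, ← mul_assoc (R.K q (-μ)), R.K_mul_K_comm q (-μ),
      mul_assoc _ (R.K q (-μ)) (R.f q i), R.K_mul_f q i (-μ), map_neg, LinearMap.neg_apply, mul_smul_comm, ← U_smul_neg, smul_smul, zpow_neg,
      Units.mul_inv, one_smul, mul_assoc]
  e_f_same i := by
    rw [antipodeU_commutator, (R.satisfiesURel q).e_f_same, ← MulOpposite.op_sub,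
      ← MulOpposite.op_smul, neg_neg, mul_smul_comm, smul_mul_assoc, ← U_smul_neg]
    congr 2
    rw [mul_sub, sub_mul, mul_assoc, K_mul_K_neg, mul_one, one_mul, neg_sub]
  e_f_ne i j hij := by
    rw [← sub_eq_zero, antipodeU_commutator, (R.satisfiesURel q).e_f_ne i j hij, sub_self,
      mul_zero, zero_mul, neg_zero, MulOpposite.op_zero]
  e_rad v hv := R.antipodeUE_rad q hv
  f_rad v hv := R.antipodeUF_rad q hv

/-- The antipode of `U`. -/
def antipodeU : R.U q →ₗ[k] R.U q :=
  (MulOpposite.opLinearEquiv k).symm.toLinearMap ∘ₗ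
    (R.antipode_satisfiesURel q).liftU.toLinearMap

theorem antipodeU_apply (u : R.U q) :
    R.antipodeU q u = ((R.antipode_satisfiesURel q).liftU u).unop := rfl

theorem antipodeU_e (i : I) :
    R.antipodeU q (R.e q i) = -(R.e q i * R.K q (-R.kappa i)) := by
  rw [antipodeU_apply, SatisfiesURel.liftU_e]
  rfl

theorem antipodeU_f (i : I) :
    R.antipodeU q (R.f q i) = -(R.K q (R.kappa i) * R.f q i) := by
  rw [antipodeU_apply, SatisfiesURel.liftU_f]
  rfl

theorem antipodeU_K (μ : Y) : R.antipodeU q (R.K q μ) = R.K q (-μ) := by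
  rw [antipodeU_apply, SatisfiesURel.liftU_K]
  rfl

theorem antipodeU_one : R.antipodeU q 1 = 1 := by
  rw [antipodeU_apply, map_one]
  rfl

theorem antipodeU_mul (u v : R.U q) :
    R.antipodeU q (u * v) = R.antipodeU q v * R.antipodeU q u := by
  rw [antipodeU_apply, map_mul]
  rfl

/-- For an antihomomorphism the contribution of `s` appears in the middle of the product; being a
scalar it moves out. Hence the antipode axiom need only be checked on generators. -/
theorem mul_antipodeU_rTensor_mul (s t : R.U q ⊗[k] R.U q) (r : k)
    (hs : LinearMap.mul' k (R.U q) ((R.antipodeU q).rTensor _ s) = algebraMap k _ r) :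
    LinearMap.mul' k (R.U q) ((R.antipodeU q).rTensor _ (s * t)) =
      r • LinearMap.mul' k (R.U q) ((R.antipodeU q).rTensor _ t) := by
  induction t using TensorProduct.induction_on with
  | zero => simp
  | tmul a b =>
    have h (s : R.U q ⊗[k] R.U q) :
        LinearMap.mul' k (R.U q) ((R.antipodeU q).rTensor _ (s * a ⊗ₜ b)) =
          R.antipodeU q a * LinearMap.mul' k (R.U q) ((R.antipodeU q).rTensor _ s) * b := by
      induction s using TensorProduct.induction_on with
      | zero => simp
      | tmul c d =>
        simp only [Algebra.TensorProduct.tmul_mul_tmul, LinearMap.rTensor_tmul,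
          LinearMap.mul'_apply, antipodeU_mul, mul_assoc]
      | add s t hs ht => simp only [add_mul, mul_add, map_add, hs, ht]
    rw [h, hs, LinearMap.rTensor_tmul, LinearMap.mul'_apply, ← Algebra.commutes, mul_assoc,
      ← Algebra.smul_def]
  | add s t hs ht => simp only [mul_add, map_add, smul_add, hs, ht]

theorem mul_antipodeU_lTensor_mul (s t : R.U q ⊗[k] R.U q) (r : k)
    (ht : LinearMap.mul' k (R.U q) ((R.antipodeU q).lTensor _ t) = algebraMap k _ r) :
    LinearMap.mul' k (R.U q) ((R.antipodeU q).lTensor _ (s * t)) =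
      r • LinearMap.mul' k (R.U q) ((R.antipodeU q).lTensor _ s) := by
  induction s using TensorProduct.induction_on with
  | zero => simp
  | tmul a b =>
    have h (t : R.U q ⊗[k] R.U q) :
        LinearMap.mul' k (R.U q) ((R.antipodeU q).lTensor _ (a ⊗ₜ b * t)) =
          a * LinearMap.mul' k (R.U q) ((R.antipodeU q).lTensor _ t) * R.antipodeU q b := by
      induction t using TensorProduct.induction_on with
      | zero => simp
      | tmul c d =>
        simp only [Algebra.TensorProduct.tmul_mul_tmul, LinearMap.lTensor_tmul,
          LinearMap.mul'_apply, antipodeU_mul, mul_assoc]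
      | add s t hs ht => simp only [add_mul, mul_add, map_add, hs, ht]
    rw [h, ht, LinearMap.lTensor_tmul, LinearMap.mul'_apply, ← Algebra.commutes, mul_assoc,
      ← Algebra.smul_def]
  | add s t hs ht => simp only [add_mul, map_add, smul_add, hs, ht]

theorem isHopf : R.IsHopf q (R.comulU q) (R.counitU q) (R.antipodeU q) where
  comul_e := R.comulU_e q
  comul_f := R.comulU_f q
  comul_K := R.comulU_K q
  coassoc := by
    let φ : R.U q →ₐ[k] R.U q ⊗[k] (R.U q ⊗[k] R.U q) :=
      (Algebra.TensorProduct.assoc k k k (R.U q) (R.U q) (R.U q)).toAlgHom.comp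
        ((Algebra.TensorProduct.map (R.comulU q) (AlgHom.id k _)).comp (R.comulU q))
    let ψ : R.U q →ₐ[k] R.U q ⊗[k] (R.U q ⊗[k] R.U q) :=
      (Algebra.TensorProduct.map (AlgHom.id k _) (R.comulU q)).comp (R.comulU q)
    have h : φ = ψ := by
      refine R.U_algHom_ext (W := R.U q ⊗[k] (R.U q ⊗[k] R.U q)) q (fun i => ?_) (fun i => ?_) (fun μ => ?_)
      · simp [φ, ψ, comulU_e, comulU_K, TensorProduct.add_tmul, TensorProduct.tmul_add,
          Algebra.TensorProduct.one_def, add_assoc]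
      · simp [φ, ψ, comulU_f, comulU_K, TensorProduct.add_tmul, TensorProduct.tmul_add,
          Algebra.TensorProduct.one_def, add_assoc]
      · simp [φ, ψ, comulU_K]
    exact LinearMap.ext fun u => AlgHom.congr_fun h u
  counit_left u := by
    let φ : R.U q →ₐ[k] R.U q := (Algebra.TensorProduct.lid k (R.U q)).toAlgHom.comp
      ((Algebra.TensorProduct.map (R.counitU q) (AlgHom.id k _)).comp (R.comulU q))
    have h : φ = AlgHom.id k _ := by
      refine R.U_algHom_ext q (fun i => ?_) (fun i => ?_) (fun μ => ?_)
      · simp [φ, comulU_e]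
      · simp [φ, comulU_f]
      · simp [φ, comulU_K]
    exact AlgHom.congr_fun h u
  counit_right u := by
    let φ : R.U q →ₐ[k] R.U q := (Algebra.TensorProduct.rid k k (R.U q)).toAlgHom.comp
      ((Algebra.TensorProduct.map (AlgHom.id k _) (R.counitU q)).comp (R.comulU q))
    have h : φ = AlgHom.id k _ := by
      refine R.U_algHom_ext q (fun i => ?_) (fun i => ?_) (fun μ => ?_)
      · simp [φ, comulU_e]
      · simp [φ, comulU_f]
      · simp [φ, comulU_K]
    exact AlgHom.congr_fun h u
  antipode_left u := by
    induction u using R.U_induction_mul q with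
    | one => simp [Algebra.TensorProduct.one_def, antipodeU_one]
    | he i => simp [comulU_e, antipodeU_e, antipodeU_one, U_neg_mul, mul_assoc]
    | hf i => simp [comulU_f, antipodeU_f, antipodeU_K]
    | hK μ => simp [comulU_K, antipodeU_K]
    | mul u v hu hv =>
      rw [map_mul, R.mul_antipodeU_rTensor_mul q _ _ _ hu, hv, map_mul, map_mul, Algebra.smul_def]
    | add u v hu hv => simp only [map_add, hu, hv]
    | smul r u hu =>
      rw [map_smul, map_smul, map_smul, hu, map_smul, smul_eq_mul, map_mul, Algebra.smul_def]
  antipode_right u := by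
    induction u using R.U_induction_mul q with
    | one => simp [Algebra.TensorProduct.one_def, antipodeU_one]
    | he i => simp [comulU_e, antipodeU_e, antipodeU_K]
    | hf i => simp [comulU_f, antipodeU_f, antipodeU_one, U_mul_neg, ← mul_assoc]
    | hK μ => simp [comulU_K, antipodeU_K]
    | mul u v hu hv =>
      rw [map_mul, R.mul_antipodeU_lTensor_mul q _ _ _ hv, hu, map_mul, map_mul, Algebra.smul_def,
        Algebra.commutes]
    | add u v hu hv => simp only [map_add, hu, hv]
    | smul r u hu =>
      rw [map_smul, map_smul, map_smul, hu, map_smul, smul_eq_mul, map_mul, Algebra.smul_def]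

/-! ### The module algebra structure of `B` -/

variable {q} (hq : ∀ i, R.qdiff q i ≠ 0)

variable {R} in
theorem act_mul (ρ : R.U q →ₐ[k] (Module.End k (R.B q))ᵐᵒᵖ) (v : R.B q) (a b : R.U q) :
    R.act q ρ v (a * b) = R.act q ρ (R.act q ρ v a) b := by
  simp only [act_apply, map_mul, MulOpposite.unop_mul, Module.End.mul_apply]

theorem act_one (ρ : R.U q →ₐ[k] (Module.End k (R.B q))ᵐᵒᵖ) (v : R.B q) :
    R.act q ρ v 1 = v := by
  simp [act_apply]

/-- On generators this is the Leibniz rule of the corresponding operator. -/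
theorem act_mul_rho (u : R.U q) (v w : R.B q) :
    R.act q (R.rho hq) (v * w) u = LinearMap.mul' k (R.B q)
      (TensorProduct.map (R.act q (R.rho hq) v) (R.act q (R.rho hq) w) (R.comulU q u)) := by
  induction u using R.U_induction_mul q generalizing v w with
  | one => simp [Algebra.TensorProduct.one_def, act_one]
  | he i =>
    have h {A : Type _} [Ring A] (v w e v' w' : A) : v * w * e - e * (v' * w') =
        (v * e - e * v') * w' + v * (w * e - e * w') := by noncomm_ring
    rw [act_rho_e, comulU_e, map_add, map_add, TensorProduct.map_tmul, TensorProduct.map_tmul,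
      act_rho_e, act_rho_e, act_rho_K, act_one, LinearMap.mul'_apply, LinearMap.mul'_apply,
      opEB_apply, opEB_apply, opEB_apply, scaleB_mul]
    exact h ..
  | hf i =>
    rw [act_rho_f, comulU_f, map_add, map_add, TensorProduct.map_tmul, TensorProduct.map_tmul,
      act_rho_f, act_rho_f, act_rho_K, act_one, LinearMap.mul'_apply, LinearMap.mul'_apply,
      opFB_mul]
  | hK μ => rw [comulU_K, TensorProduct.map_tmul, LinearMap.mul'_apply, act_rho_K, act_rho_K,
      act_rho_K, scaleB_mul]
  -- The property passes to products because the coproduct is multiplicative and the action is a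
  -- right action: each tensor leg of Δa acts first, then that of Δb.
  | mul a b ha hb =>
    rw [act_mul, ha, map_mul]
    induction R.comulU q a using TensorProduct.induction_on with
    | zero => simp [act_apply]
    | tmul c d =>
      rw [TensorProduct.map_tmul, LinearMap.mul'_apply, hb]
      induction R.comulU q b using TensorProduct.induction_on with
      | zero => simp
      | tmul c' d' =>
        simp only [TensorProduct.map_tmul, Algebra.TensorProduct.tmul_mul_tmul, act_mul]
      | add s t hs ht => simp only [map_add, mul_add, hs, ht]
    | add s t hs ht =>
      rw [add_mul, map_add, map_add, map_add, map_add, ← hs, ← ht]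
      simp only [act_apply, map_add]
  | add a b ha hb => rw [map_add, map_add, map_add, map_add, ha, hb]
  | smul r a ha => rw [map_smul, map_smul, map_smul, map_smul, ha]

theorem act_one_rho (u : R.U q) :
    R.act q (R.rho hq) 1 u = algebraMap k (R.B q) (R.counitU q u) := by
  induction u using R.U_induction_mul q with
  | one => simp [act_one]
  | he i => simp [opEB_apply]
  | hf i =>
    rw [act_rho_f, counitU_f, map_zero, ← map_one (R.toB q), opFB_toB, opF_apply]
    simp
  | hK μ => simp
  | mul a b ha hb =>
    rw [act_mul, ha, Algebra.algebraMap_eq_smul_one, act_apply, map_smul, ← act_apply, hb,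
      map_mul, map_mul, Algebra.smul_def]
  | add a b ha hb => simp only [map_add, ha, hb]
  | smul r a ha => rw [map_smul, ha, map_smul, smul_eq_mul, map_mul, Algebra.smul_def]

end LusztigRootDatum

end

/-! ### The assembled proposition -/

theorem proposition4p4 {r : ℕ} {X Y : Type*} [AddCommGroup X] [AddCommGroup Y]
    [Module.Free ℤ X] [Module.Finite ℤ X] [Module.Free ℤ Y] [Module.Finite ℤ Y]
    (R : LusztigRootDatum (Fin r) X Y) {k : Type*} [Field k] (q : kˣ)
    (hq : ∀ i, R.qi q i ≠ (R.qi q i)⁻¹) :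
    ∃ ρ : R.U q →ₐ[k] (Module.End k (R.B q))ᵐᵒᵖ,
      -- the fundamental representation exists and is unique
      R.IsFundamentalRep q ρ ∧ (∀ ρ', R.IsFundamentalRep q ρ' → ρ' = ρ) ∧
      -- the action of `K_μ` and `e^i`
      (∀ i μ, R.act q ρ (R.x q i) (R.K q μ) =
        ((q ^ R.pairing μ (R.root i) : kˣ) : k) • R.x q i) ∧
      (∀ i v, R.act q ρ v (R.e q i) =
        (R.qi q i - (R.qi q i)⁻¹)⁻¹ •
          (v * R.x q i - R.x q i * R.act q ρ v (R.K q (R.kappa i)))) ∧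
      -- the action of `f_i` by braided differentiation, and its explicit form
      (∃ D : Fin r → R.B q →ₗ[k] R.B q,
        (∀ i v, D i (R.toB q v) = R.toB q (R.freeDeriv q i v)) ∧
        (∀ i v, R.act q ρ v (R.f q i) = -D i v) ∧
        (∀ (i : Fin r) (ν : Fin r → ℕ),
          D i (List.ofFn fun j => R.x q j ^ ν j).prod =
            (((q ^ (-∑ j ∈ Finset.univ.filter (· < i), (ν j : ℤ) * R.form i j) : kˣ) : k) *
              ((1 - ((R.qi q i ^ 2)⁻¹) ^ ν i) / (1 - (R.qi q i ^ 2)⁻¹))) •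
              (List.ofFn fun j => R.x q j ^ (if j = i then ν j - 1 else ν j)).prod)) ∧
      -- `B` is a right module algebra over the Hopf algebra `U`
      (∃ (Δ : R.U q →ₐ[k] R.U q ⊗[k] R.U q) (ε : R.U q →ₐ[k] k) (S : R.U q →ₗ[k] R.U q),
        R.IsHopf q Δ ε S ∧
        (∀ u v w, R.act q ρ (v * w) u =
          LinearMap.mul' k (R.B q) (TensorProduct.map (R.act q ρ v) (R.act q ρ w) (Δ u))) ∧
        (∀ u, R.act q ρ 1 u = algebraMap k (R.B q) (ε u))) ∧
      -- the representation is adjoint to the Verma module representation on `C̄`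
      (∃ (lam : R.U q →ₐ[k] Module.End k (R.C q)) (Sbar : R.C q →ₗ[k] R.C q)
          (P : R.C q →ₗ[k] R.B q →ₗ[k] k),
        R.IsVermaRep q lam ∧
        (∀ c v, P (R.toC q c) (R.toB q v) = R.freePairing q c v) ∧ P.Nondegenerate ∧
        (∀ c, Sbar (R.toC q c) = R.toC q (LusztigRootDatum.antipode (R.braidFBar q) c)) ∧
        Function.Bijective Sbar ∧
        (∀ u c v, P (Sbar (lam u c)) v = P (Sbar c) (R.act q ρ v u))) := by
  have hq' : ∀ i, R.qdiff q i ≠ 0 := fun i => sub_ne_zero.2 (hq i)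
  refine ⟨R.rho hq', R.isFundamentalRep_rho hq', fun ρ' h => h.unique (R.isFundamentalRep_rho hq'),
    fun i μ => ?_, fun i v => ?_,
    ⟨R.deriv hq', R.deriv_toB hq', fun i v => ?_, R.deriv_monomial hq'⟩,
    ⟨R.comulU q, R.counitU q, R.antipodeU q, R.isHopf q, fun u v w => R.act_mul_rho hq' u v w,
      R.act_one_rho hq'⟩,
    ⟨R.verma hq', R.antipodeC, R.pairingCB q, R.isVermaRep_verma hq', R.pairingCB_apply q,
      R.pairingCB_nondegenerate q, R.antipodeC_toC, R.antipodeC_bijective,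
      R.pairingCB_verma hq'⟩⟩
  · rw [LusztigRootDatum.act_rho_K, LusztigRootDatum.scaleB_x]
  · have h := hq' i
    rw [LusztigRootDatum.qdiff] at h
    rw [LusztigRootDatum.act_rho_K, LusztigRootDatum.act_rho_e, LusztigRootDatum.opEB_apply,
      LusztigRootDatum.x, LusztigRootDatum.qdiff, mul_smul_comm, smul_mul_assoc]
    -- Since x^i = (q_i - q_i⁻¹) e^i, the division in the statement undoes this normalisation; `c`
    -- stands for q_i - q_i⁻¹.
    have key {A : Type _} [Ring A] [Algebra k A] (c : k) (hc : c ≠ 0) (a b : A) :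
        a - b = c⁻¹ • (c • a - c • b) := by
      rw [← smul_sub, smul_smul, inv_mul_cancel₀ hc, one_smul]
    exact key _ h _ _
  · rw [LusztigRootDatum.act_rho_f, LusztigRootDatum.deriv, LinearMap.neg_apply, neg_neg]
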